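/- **Setting.** Let $\mathcal I,\mathcal J,\mathcal H$ be finite nonempty sets of cardinalities $N_{\mathcal I},N_{\mathcal J},N_{\mathcal H}$, let $r:\mathcal I\times\mathcal J\to\mathbb R^d$ and $H:\mathcal I\times\mathcal J\to\Delta(\mathcal H)$, extended (bi)linearly to mixed actions. In the repeated game with partial monitoring $(r,H)$, in each round $t$ the players simultaneously draw $I_t\in\mathcal I$ and $J_t\in\mathcal J$, and the first player observes only a signal $S_t$ drawn from $H(I_t,J_t)$; the second player may use any strategy, depending on all past actions and signals. Put $R=\max_{i,j}\|r(i,j)\|_2$, $\widetilde H(\mathbf q)=(H(i,\mathbf q))_{i\in\mathcal I}\in\mathbb R^{\mathcal I\times\mathcal H}$, $\mathcal F=\widetilde H(\Delta(\mathcal J))$, and, for $\mathbf p\in\Delta(\mathcal I)$ and $\sigma\in\mathcal F$, $$\overline m(\mathbf p,\sigma)=\{r(\mathbf p,\mathbf q'):\ \mathbf q'\in\Delta(\mathcal J),\ \widetilde H(\mathbf q')=\sigma\}.$$ Sets are combined in the sense of Minkowski. A set-valued map is *linear* on a convex set if it commutes with convex combinations of points of this set, and *piecewise linear* on a set if the latter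 is a finite union of polytopes on each of which the map is linear. Fix a finite triangulation of $\mathcal F$ on each simplex of which $\sigma\mapsto\{\mathbf q\in\Delta(\mathcal J):\widetilde H(\mathbf q)=\sigma\}$ is linear. Let $\mathcal B$ be its set of vertices, $N_{\mathcal B}=|\mathcal B|$, and let $\Phi:\mathcal F\to\Delta(\mathcal B)$ map $\sigma$ to its barycentric coordinates. The game is *bi-piecewise linear* if $\overline m(\cdot,b)$ is piecewise linear on $\Delta(\mathcal I)$ for every $b\in\mathcal B$. A finite set $\mathcal A\subset\Delta(\mathcal I)$ is *admissible* if it is the set of all vertices of finitely many polytopes with union $\Delta(\mathcal I)$ on each of which all the maps $\overline m(\cdot,b)$, $b\in\mathcal B$, are linear; put $N_{\mathcal A}=|\mathcal A|$. For $\mu\in\Delta(\mathcal A\times\mathcal B)$ let $\overline{\overline m}(\mu)=\sum_{a,b}\mu_{a,b}\,\overline m(a,b)$. Let $\mathcal C\subseteq\mathbb R^d$, and let $\widetilde{\mathcal C}=\{\mu\in\Delta(\mathcal A\times\mathcal B):\overline{\overline m}(\mu)\subseteq\mathcal C\}$. *Blackwell's strategy* $\Psi$ for the $\overline{\overline m}$-robust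 approachability of $\mathcal C$ starts with an arbitrary $\theta_1\in\Delta(\mathcal A)$ and, given $(\theta_1,\mathbf y_1),\dots,(\theta_n,\mathbf y_n)\in\Delta(\mathcal A)\times\Delta(\mathcal B)$ with $n\ge1$, sets $\nu_n=\frac1n\sum_{s\le n}\theta_s\otimes\mathbf y_s$, lets $c_n$ be the Euclidean projection of $\nu_n$ onto $\widetilde{\mathcal C}$, and chooses $\theta_{n+1}$ as any minimizer over $\mathbf x\in\Delta(\mathcal A)$ of $\max_{\mathbf y\in\Delta(\mathcal B)}\langle\nu_n-c_n,\mathbf x\otimes\mathbf y\rangle$. The *block strategy* with block length $L\ge1$ and exploration parameter $\gamma$, fed with $\Psi$, proceeds as follows. In block $n=1,2,\dots$ (rounds $(n-1)L+1,\dots,nL$) it draws the actions $I_t$ from $\mathbf p_n=(1-\gamma)\sum_a\theta_{n,a}a+\gamma\mathbf u$, where $\mathbf u$ is uniform on $\mathcal I$; at the end of the block it computes $$\widetilde\sigma_n=\Bigl(\frac1L\sum_{t=(n-1)L+1}^{nL}\frac{\mathbb I_{\{S_t=s\}}\mathbb I_{\{I_t=i\}}}{p_{I_t,n}}\Bigr)_{(i,s)},$$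 the Euclidean projection $\widehat\sigma_n$ of $\widetilde\sigma_n$ onto $\mathcal F$, and $\theta_{n+1}=\Psi(\theta_1,\Phi(\widehat\sigma_1),\dots,\theta_n,\Phi(\widehat\sigma_n))$. **Theorem.** Let $\mathcal C\subseteq\mathbb R^d$ be closed and convex, and let $(r,H)$ be a game that is bi-piecewise linear and satisfies Condition (APM): for every $\sigma\in\mathcal F$ there is $\mathbf p\in\Delta(\mathcal I)$ with $\overline m(\mathbf p,\sigma)\subseteq\mathcal C$. Then $\Phi$ is Lipschitz on $\mathcal F$, there are admissible sets $\mathcal A$, and for every admissible $\mathcal A$ Blackwell's strategies $\Psi$ exist. Moreover, for every admissible $\mathcal A$ the following holds. 1. Let $\kappa_\Phi$ be a Lipschitz constant of $\Phi$ on $\mathcal F$ for the $\ell^2$-norms. For all integers $T>L\ge1$, all $\gamma\in(0,1]$ and $\delta\in(0,1)$, every Blackwell strategy $\Psi$ and every strategy of the second player, the block strategy satisfies, with probability at least $1-\delta$, $$\inf_{c\in\mathcal C}\Bigl\|c-\frac1T\sum_{t=1}^Tr(I_t,J_t)\Bigr\|_2\le\frac{2L}TR+4R\sqrt{\frac{\ln(2T/(L\delta))}T}+2\gamma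 R+\frac{2R}{\sqrt{T/L-1}}\sqrt{N_{\mathcal A}N_{\mathcal B}}$$ $$\qquad+R\,\kappa_\Phi\sqrt{N_{\mathcal I}N_{\mathcal H}N_{\mathcal B}}\left(\sqrt{\frac{2N_{\mathcal I}}{\gamma L}\ln\frac{2N_{\mathcal I}N_{\mathcal H}T}{L\delta}}+\frac13\frac{N_{\mathcal I}}{\gamma L}\ln\frac{2N_{\mathcal I}N_{\mathcal H}T}{L\delta}\right).$$ 2. There is a constant $\square$, depending only on $\mathcal C$, on the game and on $\mathcal A,\mathcal B,\Phi$ (which are computed from the game), such that for all $T\ge2$ and $\delta\in(0,1)$, every Blackwell strategy $\Psi$ and every strategy of the second player, the block strategy with $L=\lceil T^{3/5}\rceil$ and $\gamma=T^{-1/5}$ satisfies, with probability at least $1-\delta$, $$\inf_{c\in\mathcal C}\Bigl\|c-\frac1T\sum_{t=1}^Tr(I_t,J_t)\Bigr\|_2\le\square\left(T^{-1/5}\sqrt{\ln\frac T\delta}+T^{-2/5}\ln\frac T\delta\right).$$ -/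

import Mathlib

open scoped Pointwise

noncomputable section

/-- A point of `K` nearest to `x`; for a nonempty closed convex `K` in a Euclidean space this is the
orthogonal projection of `x` onto `K`. -/
def nearestPoint {E : Type*} [NormedAddCommGroup E] (K : Set E) (x : E) : E :=
  Classical.epsilon fun y => y ∈ K ∧ ∀ z ∈ K, ‖x - y‖ ≤ ‖x - z‖

/-- A polytope: a bounded intersection of finitely many closed half-spaces. -/
def IsPolytope {E : Type*} [NormedAddCommGroup E] [NormedSpace ℝ E] (P : Set E) : Prop :=
  Bornology.IsBounded P ∧
    ∃ s : Finset ((E →ₗ[ℝ] ℝ) × ℝ), P = {x | ∀ z ∈ s, z.1 x ≤ z.2}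

/-- A set-valued map is linear on `P` if it commutes with convex combinations of points of `P`
(convex combinations of sets being taken in the sense of Minkowski). -/
def IsSetLinearOn {E V : Type*} [AddCommGroup E] [Module ℝ E] [AddCommGroup V] [Module ℝ V]
    (f : E → Set V) (P : Set E) : Prop :=
  ∀ x ∈ P, ∀ y ∈ P, ∀ α : ℝ, 0 ≤ α → α ≤ 1 →
    f (α • x + (1 - α) • y) = α • f x + (1 - α) • f y

/-- A set-valued map is piecewise linear on `X` if `X` is the union of finitely many polytopes on
each of which the map is linear. -/
def IsSetPiecewiseLinearOn {E V : Type*} [NormedAddCommGroup E] [NormedSpace ℝ E]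
    [AddCommGroup V] [Module ℝ V] (f : E → Set V) (X : Set E) : Prop :=
  ∃ 𝒬 : Set (Set E), 𝒬.Finite ∧ (∀ P ∈ 𝒬, IsPolytope P) ∧ ⋃₀ 𝒬 = X ∧
    ∀ P ∈ 𝒬, IsSetLinearOn f P

/-- A vector-valued game with partial monitoring: action sets `I`, `J`, signal set `S`,
payoffs `r i j ∈ ℝ^d` and signal distributions `H i j ∈ Δ(S)`. -/
structure MonitoringGame (I J S : Type*) [Fintype S] (d : ℕ) where
  r : I → J → EuclideanSpace ℝ (Fin d)
  H : I → J → S → ℝ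
  H_mem : ∀ i j, H i j ∈ stdSimplex ℝ S

namespace MonitoringGame

variable {I J S : Type*} [Fintype I] [Fintype J] [Fintype S] {d : ℕ}

/-- The bilinear extension of the payoff function to mixed actions. -/
def payoff (G : MonitoringGame I J S d) (p : I → ℝ) (q : J → ℝ) : EuclideanSpace ℝ (Fin d) :=
  ∑ i, ∑ j, (p i * q j) • G.r i j

/-- `R = max_{i,j} ‖r(i,j)‖`. -/
def payoffBound (G : MonitoringGame I J S d) : ℝ :=
  ⨆ z : I × J, ‖G.r z.1 z.2‖

/-- The vector of signal distributions induced by `q`, as a point of `ℝ^{I × S}`. -/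
def signals (G : MonitoringGame I J S d) (q : J → ℝ) : EuclideanSpace ℝ (I × S) :=
  WithLp.toLp 2 fun z => ∑ j, q j * G.H z.1 j z.2

/-- The set `ℱ` of feasible vectors of signal distributions. -/
def feasible (G : MonitoringGame I J S d) : Set (EuclideanSpace ℝ (I × S)) :=
  G.signals '' stdSimplex ℝ J

/-- The mixed actions of the second player that induce `σ`. -/
def fiber (G : MonitoringGame I J S d) (σ : EuclideanSpace ℝ (I × S)) : Set (J → ℝ) :=
  {q | q ∈ stdSimplex ℝ J ∧ G.signals q = σ}

/-- The set of the payoffs of `p` that are compatible with `σ`. -/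
def mbar (G : MonitoringGame I J S d) (p : I → ℝ) (σ : EuclideanSpace ℝ (I × S)) :
    Set (EuclideanSpace ℝ (Fin d)) :=
  {v | ∃ q ∈ stdSimplex ℝ J, G.signals q = σ ∧ v = G.payoff p q}

/-- Condition (APM). -/
def APM (G : MonitoringGame I J S d) (C : Set (EuclideanSpace ℝ (Fin d))) : Prop :=
  ∀ σ ∈ G.feasible, ∃ p ∈ stdSimplex ℝ I, G.mbar p σ ⊆ C

/-- `B` is the vertex set of a finite triangulation of `ℱ` on each simplex of which the inverse
image map `σ ↦ fiber σ` is linear, and `Φ σ` is the vector of the barycentric coordinates of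
`σ ∈ ℱ` in the triangulation, padded with zeros to an element of `Δ(B)`. -/
def IsSignalTriangulation (G : MonitoringGame I J S d) (B : Finset (EuclideanSpace ℝ (I × S)))
    (Φ : EuclideanSpace ℝ (I × S) → EuclideanSpace ℝ B) : Prop :=
  ∃ K : Geometry.SimplicialComplex ℝ (EuclideanSpace ℝ (I × S)),
    K.faces.Finite ∧ K.space = G.feasible ∧ K.vertices = (B : Set (EuclideanSpace ℝ (I × S))) ∧
    (∀ s ∈ K.faces, IsSetLinearOn G.fiber (convexHull ℝ (s : Set (EuclideanSpace ℝ (I × S))))) ∧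
    ∀ σ ∈ G.feasible, (fun b => Φ σ b) ∈ stdSimplex ℝ B ∧
      (∑ b : B, Φ σ b • (b : EuclideanSpace ℝ (I × S))) = σ ∧
      ∃ s ∈ K.faces, ∀ b : B, Φ σ b ≠ 0 → (b : EuclideanSpace ℝ (I × S)) ∈ s

/-- Bi-piecewise linearity: `p ↦ mbar p b` is piecewise linear on `Δ(I)` for every `b ∈ B`. -/
def IsBiPiecewiseLinear (G : MonitoringGame I J S d)
    (B : Finset (EuclideanSpace ℝ (I × S))) : Prop :=
  ∀ b ∈ B, IsSetPiecewiseLinearOn (fun p => G.mbar p b) (stdSimplex ℝ I)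

/-- `A` is the set of all vertices of the polytopes of a finite decomposition of `Δ(I)` on each
polytope of which all the maps `p ↦ mbar p b`, `b ∈ B`, are linear. -/
def IsActionVertexSet (G : MonitoringGame I J S d) (B : Finset (EuclideanSpace ℝ (I × S)))
    (A : Finset (I → ℝ)) : Prop :=
  ∃ 𝒬 : Set (Set (I → ℝ)), 𝒬.Finite ∧ (∀ P ∈ 𝒬, IsPolytope P) ∧ ⋃₀ 𝒬 = stdSimplex ℝ I ∧
    (∀ b ∈ B, ∀ P ∈ 𝒬, IsSetLinearOn (fun p => G.mbar p b) P) ∧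
    (A : Set (I → ℝ)) = ⋃ P ∈ 𝒬, P.extremePoints ℝ

/-- The linear extension to `Δ(A × B)` of the restriction of `mbar` to `A × B`: the set
`∑_{a,b} μ_{a,b} mbar(a,b)`. -/
def lifted (G : MonitoringGame I J S d) (A : Finset (I → ℝ))
    (B : Finset (EuclideanSpace ℝ (I × S))) (μ : EuclideanSpace ℝ (A × B)) :
    Set (EuclideanSpace ℝ (Fin d)) :=
  {v | ∃ z : A × B → EuclideanSpace ℝ (Fin d),
    (∀ ab : A × B, z ab ∈ G.mbar ab.1 ab.2) ∧ v = ∑ ab, μ ab • z ab}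

/-- The set of the joint distributions `μ ∈ Δ(A × B)` with `lifted μ ⊆ C`. -/
def liftedTarget (G : MonitoringGame I J S d) (C : Set (EuclideanSpace ℝ (Fin d)))
    (A : Finset (I → ℝ)) (B : Finset (EuclideanSpace ℝ (I × S))) :
    Set (EuclideanSpace ℝ (A × B)) :=
  {μ | (fun ab => μ ab) ∈ stdSimplex ℝ (A × B) ∧ G.lifted A B μ ⊆ C}

end MonitoringGame

/-- The product distribution `x ⊗ y`. -/
def productDist {X Y : Type*} (x : X → ℝ) (y : Y → ℝ) : EuclideanSpace ℝ (X × Y) :=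
  WithLp.toLp 2 fun z => x z.1 * y z.2

/-- The average of the product distributions `x_s ⊗ y_s` of a list of pairs. -/
def averageDist {X Y : Type*} (l : List ((X → ℝ) × (Y → ℝ))) : EuclideanSpace ℝ (X × Y) :=
  (l.length : ℝ)⁻¹ • (l.map fun z => productDist z.1 z.2).sum

namespace MonitoringGame

variable {I J S : Type*} [Fintype I] [Fintype J] [Fintype S] {d : ℕ}

/-- `Ψ` is Blackwell's strategy for the robust approachability of `C` in the lifted game, with mixed
actions taken and observed. A strategy maps the list of the past pairs of mixed actions
`(θ_1, y_1), …, (θ_n, y_n)` to the next mixed action. The first action is arbitrary; then,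
`ν` being the average of the `θ_s ⊗ y_s` and `c` its projection onto
`{μ ∈ Δ(A × B) : lifted μ ⊆ C}`, the next action minimizes `max_y ⟨ν - c, x ⊗ y⟩` over
`x ∈ Δ(A)`. Only the sequences of elements of `Δ(A) × Δ(B)` matter. -/
def IsRobustBlackwell (G : MonitoringGame I J S d) (C : Set (EuclideanSpace ℝ (Fin d)))
    (A : Finset (I → ℝ)) (B : Finset (EuclideanSpace ℝ (I × S)))
    (Ψ : List ((A → ℝ) × (B → ℝ)) → A → ℝ) : Prop :=
  ∀ l : List ((A → ℝ) × (B → ℝ)),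
    (∀ z ∈ l, z.1 ∈ stdSimplex ℝ A ∧ z.2 ∈ stdSimplex ℝ B) →
    Ψ l ∈ stdSimplex ℝ A ∧
    (l ≠ [] → IsMinOn
      (fun x : A → ℝ => ⨆ y : stdSimplex ℝ B,
        inner ℝ (averageDist l - nearestPoint (G.liftedTarget C A B) (averageDist l))
          (productDist x (y : B → ℝ)))
      (stdSimplex ℝ A) (Ψ l))

/-- The mixed action `(1 - γ) ∑_a θ_a a + γ u`, where `u` is uniform on `I`. -/
def explore (A : Finset (I → ℝ)) (γ : ℝ) (θ : A → ℝ) : I → ℝ :=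
  fun i => (1 - γ) * (∑ a : A, θ a * (a : I → ℝ) i) + γ * (Fintype.card I : ℝ)⁻¹

/-- The estimated vector of signal distributions in block `n` (the rounds `s` with `s / L = n`;
rounds and blocks are numbered from `0`), when the actions and signals of the first `t` rounds are
`o` and the mixed action used in the block is `p`. -/
def estimate [DecidableEq I] [DecidableEq S] (L : ℕ) (p : I → ℝ) {t : ℕ} (o : Fin t → I × S)
    (n : ℕ) : EuclideanSpace ℝ (I × S) :=
  WithLp.toLp 2 fun z => (L : ℝ)⁻¹ *
    ∑ s : Fin t, if (s : ℕ) / L = n ∧ (o s).2 = z.2 ∧ (o s).1 = z.1 then (p (o s).1)⁻¹ else 0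

/-- The pairs `(θ_m, Φ(σ̂_m))` of the first `n` blocks. -/
def blockHistory [DecidableEq I] [DecidableEq S] (G : MonitoringGame I J S d) (A : Finset (I → ℝ))
    (B : Finset (EuclideanSpace ℝ (I × S))) (Φ : EuclideanSpace ℝ (I × S) → EuclideanSpace ℝ B)
    (Ψ : List ((A → ℝ) × (B → ℝ)) → A → ℝ) (L : ℕ) (γ : ℝ) {t : ℕ} (o : Fin t → I × S) :
    ℕ → List ((A → ℝ) × (B → ℝ))
  | 0 => []
  | n + 1 =>
    let past := blockHistory G A B Φ Ψ L γ o n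
    let θ := Ψ past
    let σ := nearestPoint G.feasible (estimate L (explore A γ θ) o n)
    past ++ [(θ, fun b => Φ σ b)]

/-- The block strategy: the mixed action of the first player in round `t` (numbered from `0`),
given the actions and signals `o` of the rounds before. -/
def blockStrategy [DecidableEq I] [DecidableEq S] (G : MonitoringGame I J S d) (A : Finset (I → ℝ))
    (B : Finset (EuclideanSpace ℝ (I × S))) (Φ : EuclideanSpace ℝ (I × S) → EuclideanSpace ℝ B)
    (Ψ : List ((A → ℝ) × (B → ℝ)) → A → ℝ) (L : ℕ) (γ : ℝ) (t : ℕ) (o : Fin t → I × S) : I → ℝ :=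
  explore A γ (Ψ (blockHistory G A B Φ Ψ L γ o (t / L)))

/-- A strategy of the second player: a mixed action for every round, depending on all the actions
and signals of the rounds before. -/
def IsOpponentStrategy (τ : (t : ℕ) → (Fin t → I × J × S) → J → ℝ) : Prop :=
  ∀ t h, τ t h ∈ stdSimplex ℝ J

/-- The probability of the play `ω` of the first `T` rounds when the players use the strategies
`π` and `τ`: in each round `I_t` and `J_t` are drawn independently given the past and the signal is
drawn according to `H(I_t, J_t)`. -/
def playProb (G : MonitoringGame I J S d) (π : (t : ℕ) → (Fin t → I × S) → I → ℝ)
    (τ : (t : ℕ) → (Fin t → I × J × S) → J → ℝ) (T : ℕ) (ω : Fin T → I × J × S) : ℝ :=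
  ∏ t : Fin T,
    π t (fun s => ((ω (Fin.castLE t.isLt.le s)).1, (ω (Fin.castLE t.isLt.le s)).2.2)) (ω t).1 *
    τ t (fun s => ω (Fin.castLE t.isLt.le s)) (ω t).2.1 *
    G.H (ω t).1 (ω t).2.1 (ω t).2.2

/-- The probability of a set of plays of the first `T` rounds. -/
def prob (G : MonitoringGame I J S d) (π : (t : ℕ) → (Fin t → I × S) → I → ℝ)
    (τ : (t : ℕ) → (Fin t → I × J × S) → J → ℝ) (T : ℕ) (E : Set (Fin T → I × J × S)) : ℝ :=
  ∑ ω, E.indicator (G.playProb π τ T) ω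

/-- The distance to `C` of the average payoff of the play `ω`. -/
def averageDistance (G : MonitoringGame I J S d) (C : Set (EuclideanSpace ℝ (Fin d))) {T : ℕ}
    (ω : Fin T → I × J × S) : ℝ :=
  Metric.infDist ((T : ℝ)⁻¹ • ∑ t, G.r (ω t).1 (ω t).2.1) C

end MonitoringGame

end

/-!
The block strategy approaches `C` for the following reason. Let `q_n` be the empirical distribution
of the actions of the second player in block `n`, and let `σ_n` be the vector of signal
distributions that it induces. As the inverse image map is linear on the simplices of the
triangulation, `q_n` is the average of mixed actions `q_{n,b}` compatible with the vertices `b`,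
with the weights `Φ(σ_n)` (`IsSignalTriangulation.exists_fiber_decomposition`). Hence the payoff of
the mixed action with the weights `θ_n` against `q_n` is `∑ θ_{n,a} Φ(σ_n)_b r(a, q_{n,b})`, and if
`Φ(σ_n)` is replaced by its estimate `y_n`, the average of these payoffs over the blocks belongs to
`lifted ν`, where `ν` is the average of the `θ_n ⊗ y_n` (`infDist_average_payoff_le`). The map `Φ`
is Lipschitz, being the inverse of a linear injection on each simplex
(`IsSignalTriangulation.lipschitz`), so the replacement costs little.

Blackwell's strategy keeps `ν` within `√(2 / n)` of the set of the `μ` with `lifted μ ⊆ C`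
(`IsRobustBlackwell.sq_mul_norm_sq_le`). Blackwell's condition follows from the minimax theorem
and from (APM): each `y ∈ Δ(B)` has a reply `x` with `lifted (x ⊗ y) ⊆ C`. This reply is obtained
by writing the mixed action that (APM) provides for `∑ y_b b` as an average of vertices `a ∈ A`
(`exists_productDist_mem_liftedTarget`).

Two random errors remain. The actual payoffs differ from their conditional expectations by a
martingale, controlled by an Azuma–Hoeffding inequality in Hilbert space; its constants do not
depend on the dimension since `E cosh ‖y + D‖ ≤ cosh c * cosh ‖y‖` for centered `D` with `‖D‖ ≤ c`
(`sum_mul_cosh_norm_add_le`). The signals are estimated within the precision of Bernstein's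
inequality. A union bound over the blocks and over the coordinates at the level in the statement
would spend the whole `δ` on the estimation. Half of it is saved by keeping the conditional
variances random: the variances of the coordinates that belong to one action add up to the bound
that Bernstein's inequality uses for each single one, so that the sum of the squared errors can be
bounded at a level larger by the factor `4 / 3` (`exists_prob_le_half_estimation`). This needs
`2 L ≤ T`, two signals, and a bound below the diameter of the feasible set; the other cases are
trivial.
-/

set_option linter.unusedSectionVars false

/-! ### Projections onto closed convex sets -/

section NearestPoint

variable {E : Type*} [NormedAddCommGroup E] [InnerProductSpace ℝ E] [FiniteDimensional ℝ E]
  {K : Set E}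

theorem nearestPoint_spec (hne : K.Nonempty) (hcl : IsClosed K) (x : E) :
    nearestPoint K x ∈ K ∧ ∀ z ∈ K, ‖x - nearestPoint K x‖ ≤ ‖x - z‖ := by
  have hex : ∃ y, y ∈ K ∧ ∀ z ∈ K, ‖x - y‖ ≤ ‖x - z‖ := by
    have := FiniteDimensional.proper ℝ E
    obtain ⟨y, hy, hxy⟩ := hcl.exists_infDist_eq_dist hne x
    refine ⟨y, hy, fun z hz => ?_⟩
    rw [← dist_eq_norm, ← dist_eq_norm, ← hxy]
    exact Metric.infDist_le_dist_of_mem hz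
  exact Classical.epsilon_spec hex

theorem nearestPoint_mem (hne : K.Nonempty) (hcl : IsClosed K) (x : E) : nearestPoint K x ∈ K :=
  (nearestPoint_spec hne hcl x).1

theorem inner_sub_nearestPoint_nonpos (hne : K.Nonempty) (hcl : IsClosed K) (hconv : Convex ℝ K)
    (x : E) {z : E} (hz : z ∈ K) : inner ℝ (x - nearestPoint K x) (z - nearestPoint K x) ≤ 0 := by
  obtain ⟨hmem, hle⟩ := nearestPoint_spec hne hcl x
  have : Nonempty K := hne.to_subtype
  refine (norm_eq_iInf_iff_real_inner_le_zero hconv hmem).1 (le_antisymm ?_ ?_) z hz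
  · exact le_ciInf fun w => hle w w.2
  · exact ciInf_le ⟨0, by rintro _ ⟨w, rfl⟩; positivity⟩ (⟨_, hmem⟩ : K)

/-- Projecting onto a convex set does not increase the distance to its points. -/
theorem norm_nearestPoint_sub_le (hne : K.Nonempty) (hcl : IsClosed K) (hconv : Convex ℝ K)
    (x : E) {z : E} (hz : z ∈ K) : ‖nearestPoint K x - z‖ ≤ ‖x - z‖ := by
  have h := inner_sub_nearestPoint_nonpos hne hcl hconv x hz
  have h2 : ‖x - z‖ ^ 2 = ‖x - nearestPoint K x‖ ^ 2
      - 2 * inner ℝ (x - nearestPoint K x) (z - nearestPoint K x)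
      + ‖nearestPoint K x - z‖ ^ 2 := by
    rw [norm_sub_rev (nearestPoint K x) z, ← norm_sub_sq_real]
    congr 2
    abel
  refine le_of_sq_le_sq ?_ (norm_nonneg _)
  nlinarith [sq_nonneg ‖x - nearestPoint K x‖]

end NearestPoint

/-! ### Polytopes -/

section Polytope

variable {E : Type*} [NormedAddCommGroup E] [NormedSpace ℝ E]

theorem IsPolytope.convex {P : Set E} (hP : IsPolytope P) : Convex ℝ P := by
  obtain ⟨-, s, rfl⟩ := hP
  intro x hx y hy a b ha hb hab z hz
  have h1 := mul_le_mul_of_nonneg_left (hx z hz) ha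
  have h2 := mul_le_mul_of_nonneg_left (hy z hz) hb
  have h3 : a * z.2 + b * z.2 = z.2 := by rw [← add_mul, hab, one_mul]
  simp only [map_add, map_smul, smul_eq_mul]
  linarith

theorem IsPolytope.isClosed [FiniteDimensional ℝ E] {P : Set E} (hP : IsPolytope P) :
    IsClosed P := by
  obtain ⟨-, s, rfl⟩ := hP
  simp only [Set.ofPred_forall]
  exact isClosed_biInter fun z _ =>
    isClosed_le z.1.continuous_of_finiteDimensional continuous_const

theorem IsPolytope.isCompact [FiniteDimensional ℝ E] {P : Set E} (hP : IsPolytope P) :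
    IsCompact P := by
  have := FiniteDimensional.proper ℝ E
  exact Metric.isCompact_of_isClosed_isBounded hP.isClosed hP.1

theorem IsPolytope.iInter {ι : Type*} [Fintype ι] [Nonempty ι] {P : ι → Set E}
    (hP : ∀ i, IsPolytope (P i)) : IsPolytope (⋂ i, P i) := by
  classical
  refine ⟨(hP (Classical.arbitrary ι)).1.subset (Set.iInter_subset _ _), ?_⟩
  choose s hs using fun i => (hP i).2
  refine ⟨Finset.univ.biUnion s, ?_⟩
  ext x
  simp only [Set.mem_iInter, Set.mem_ofPred_eq, Finset.mem_biUnion, Finset.mem_univ, true_and,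
    forall_exists_index]
  constructor
  · intro h z i hz
    have := h i
    rw [hs i] at this
    exact this z hz
  · intro h i
    rw [hs i]
    exact fun z hz => h z i hz

/-- An extreme point of a polytope is determined by the set of the inequalities that are equalities
at this point, so that there are finitely many of them. -/
theorem IsPolytope.finite_extremePoints {P : Set E} (hP : IsPolytope P) :
    (P.extremePoints ℝ).Finite := by
  classical
  obtain ⟨-, s, rfl⟩ := hP
  refine Set.Finite.of_finite_image (f := fun x => s.filter fun z => z.1 x = z.2)
    (s.powerset.finite_toSet.subset ?_) ?_
  · rintro _ ⟨x, -, rfl⟩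
    exact Finset.mem_coe.2 (Finset.mem_powerset.2 (Finset.filter_subset _ _))
  intro x hx y hy hxy
  by_contra hne
  have hx1 := hx.1
  have hy1 := hy.1
  -- a step small enough for the inequalities that are strict at `x` to survive
  have hε : ∀ᶠ ε in nhdsWithin (0 : ℝ) (Set.Ioi 0), ∀ z ∈ s, z.1 (x - ε • (y - x)) ≤ z.2 ∧
      z.1 (x + ε • (y - x)) ≤ z.2 := by
    rw [Filter.eventually_all_finset]
    intro z hz
    by_cases hzx : z.1 x = z.2
    · have hzy : z.1 y = z.2 := by
        have : z ∈ s.filter fun z => z.1 x = z.2 := by simp [hz, hzx]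
        rw [show (s.filter fun z => z.1 x = z.2) = s.filter fun z => z.1 y = z.2 from hxy] at this
        exact (Finset.mem_filter.1 this).2
      filter_upwards with ε
      simp [hzx, hzy]
    · have hlt : z.1 x < z.2 := lt_of_le_of_ne (hx1 z hz) hzx
      refine Filter.Eventually.filter_mono nhdsWithin_le_nhds (Filter.Eventually.and ?_ ?_)
      · have : Filter.Tendsto (fun ε : ℝ => z.1 x - ε * (z.1 y - z.1 x)) (nhds 0)
            (nhds (z.1 x - 0 * (z.1 y - z.1 x))) := by
          refine Continuous.tendsto (by fun_prop) 0
        rw [zero_mul, sub_zero] at this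
        filter_upwards [this.eventually (gt_mem_nhds hlt)] with ε hε
        simpa using hε.le
      · have : Filter.Tendsto (fun ε : ℝ => z.1 x + ε * (z.1 y - z.1 x)) (nhds 0)
            (nhds (z.1 x + 0 * (z.1 y - z.1 x))) := by
          refine Continuous.tendsto (by fun_prop) 0
        rw [zero_mul, add_zero] at this
        filter_upwards [this.eventually (gt_mem_nhds hlt)] with ε hε
        simpa using hε.le
  obtain ⟨ε, hε1, hε0⟩ := (hε.and self_mem_nhdsWithin).exists
  have hopen : x ∈ openSegment ℝ (x - ε • (y - x)) (x + ε • (y - x)) := by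
    refine ⟨1 / 2, 1 / 2, by norm_num, by norm_num, by norm_num, ?_⟩
    module
  have heq := hx.2 (fun z hz => (hε1 z hz).1) (fun z hz => (hε1 z hz).2) hopen
  have : ε • (y - x) = 0 := by simpa using heq
  rcases smul_eq_zero.1 this with h | h
  · exact absurd h (ne_of_gt hε0)
  · exact hne (sub_eq_zero.1 h).symm

theorem IsPolytope.convexHull_extremePoints [FiniteDimensional ℝ E] {P : Set E}
    (hP : IsPolytope P) : convexHull ℝ (P.extremePoints ℝ) = P := by
  have := closure_convexHull_extremePoints hP.isCompact hP.convex
  rwa [(hP.finite_extremePoints.isClosed_convexHull (𝕜 := ℝ)).closure_eq] at this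

end Polytope

/-! ### Set-valued linear maps -/

section SetLinear

variable {E V ι : Type*} [AddCommGroup E] [Module ℝ E] [AddCommGroup V] [Module ℝ V]
  {f : E → Set V} {P : Set E}

theorem IsSetLinearOn.mono {Q : Set E} (h : IsSetLinearOn f P) (hQP : Q ⊆ P) :
    IsSetLinearOn f Q :=
  fun x hx y hy => h x (hQP hx) y (hQP hy)

/-- A set-valued linear map with nonempty values commutes with convex combinations of arbitrarily
many points. -/
theorem IsSetLinearOn.mem_sum_iff (hf : IsSetLinearOn f P) (hP : Convex ℝ P)
    (hne : ∀ x ∈ P, (f x).Nonempty) (t : Finset ι) (w : ι → ℝ) (x : ι → E)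
    (hw : ∀ i ∈ t, 0 ≤ w i) (hw1 : ∑ i ∈ t, w i = 1) (hx : ∀ i ∈ t, x i ∈ P) (v : V) :
    v ∈ f (∑ i ∈ t, w i • x i) ↔
      ∃ z : ι → V, (∀ i ∈ t, z i ∈ f (x i)) ∧ v = ∑ i ∈ t, w i • z i := by
  classical
  induction t using Finset.induction_on generalizing w v with
  | empty => simp at hw1
  | insert a t ha ih =>
    rw [Finset.sum_insert ha] at hw1 ⊢
    have hwa : 0 ≤ w a := hw a (Finset.mem_insert_self _ _)
    have hwt : ∀ i ∈ t, 0 ≤ w i := fun i hi => hw i (Finset.mem_insert_of_mem hi)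
    have hxt : ∀ i ∈ t, x i ∈ P := fun i hi => hx i (Finset.mem_insert_of_mem hi)
    have hxa : x a ∈ P := hx a (Finset.mem_insert_self _ _)
    by_cases h1 : w a = 1
    · have h0 : ∀ i ∈ t, w i = 0 := by
        rw [h1, add_eq_left] at hw1
        exact (Finset.sum_eq_zero_iff_of_nonneg hwt).1 hw1
      have hz : ∀ y : ι → E, ∑ i ∈ t, w i • y i = 0 := fun y =>
        Finset.sum_eq_zero fun i hi => by rw [h0 i hi, zero_smul]
      have hz' : ∀ y : ι → V, ∑ i ∈ t, w i • y i = 0 := fun y =>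
        Finset.sum_eq_zero fun i hi => by rw [h0 i hi, zero_smul]
      simp only [hz, h1, one_smul, add_zero, Finset.sum_insert ha, hz']
      constructor
      · intro hv
        choose! g hg using hne
        refine ⟨fun i => if i = a then v else g (x i), fun i hi => ?_, by simp⟩
        dsimp only
        split_ifs with hia
        · rwa [hia]
        · exact hg _ (hx i hi)
      · rintro ⟨z, hz1, rfl⟩
        exact hz1 a (Finset.mem_insert_self _ _)
    · have hlt : w a < 1 := lt_of_le_of_ne
        (by linarith [Finset.sum_nonneg hwt]) h1
      have hpos : 0 < 1 - w a := by linarith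
      have hsum : ∑ i ∈ t, w i / (1 - w a) = 1 := by
        rw [← Finset.sum_div, div_eq_one_iff_eq hpos.ne']
        linarith
      have hw' : ∀ i ∈ t, 0 ≤ w i / (1 - w a) := fun i hi => div_nonneg (hwt i hi) hpos.le
      have hy : ∀ y : ι → E,
          ∑ i ∈ t, w i • y i = (1 - w a) • ∑ i ∈ t, (w i / (1 - w a)) • y i := by
        intro y
        rw [Finset.smul_sum]
        refine Finset.sum_congr rfl fun i _ => ?_
        rw [smul_smul, mul_div_cancel₀ _ hpos.ne']
      rw [hy x, hf _ hxa _ (hP.sum_mem hw' hsum hxt) _ hwa hlt.le]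
      have hy' : ∀ y : ι → V,
          ∑ i ∈ t, w i • y i = (1 - w a) • ∑ i ∈ t, (w i / (1 - w a)) • y i := by
        intro y
        rw [Finset.smul_sum]
        refine Finset.sum_congr rfl fun i _ => ?_
        rw [smul_smul, mul_div_cancel₀ _ hpos.ne']
      constructor
      · rintro ⟨_, ⟨u, hu, rfl⟩, _, ⟨u', hu', rfl⟩, rfl⟩
        obtain ⟨z, hz, rfl⟩ := (ih _ hw' hsum hxt u').1 hu'
        have hne' : ∀ i ∈ t, i ≠ a := fun i hi h => ha (h ▸ hi)
        refine ⟨fun i => if i = a then u else z i, fun i hi => ?_, ?_⟩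
        · dsimp only
          split_ifs with hia
          · rwa [hia]
          · exact hz i ((Finset.mem_insert.1 hi).resolve_left hia)
        · rw [Finset.sum_insert ha]
          dsimp only
          rw [if_pos rfl, ← hy']
          congr 1
          exact Finset.sum_congr rfl fun i hi => by rw [if_neg (hne' i hi)]
      · rintro ⟨z, hz, rfl⟩
        rw [Finset.sum_insert ha, hy']
        exact Set.add_mem_add (Set.smul_mem_smul_set (hz a (Finset.mem_insert_self _ _)))
          (Set.smul_mem_smul_set ((ih _ hw' hsum hxt _).2
            ⟨z, fun i hi => hz i (Finset.mem_insert_of_mem hi), rfl⟩))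

end SetLinear

/-! ### Gluing Lipschitz maps -/

/-- A map on a convex set that is `K`-Lipschitz on each piece of a finite closed cover is
`K`-Lipschitz: the points `z` of a segment `[x, y]` with `dist (f x) (f z) ≤ K * dist x z` form a
closed set, and each of them can be passed inside one of the pieces. -/
theorem lipschitzOnWith_of_finite_closed_cover {E F : Type*} [NormedAddCommGroup E]
    [NormedSpace ℝ E] [NormedAddCommGroup F] {f : E → F} {X : Set E} {K : NNReal}
    (hX : Convex ℝ X) {𝒬 : Set (Set E)} (hfin : 𝒬.Finite) (hcl : ∀ Q ∈ 𝒬, IsClosed Q)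
    (hcover : ⋃₀ 𝒬 = X) (hlip : ∀ Q ∈ 𝒬, LipschitzOnWith K f Q) : LipschitzOnWith K f X := by
  have hcont : ContinuousOn f X := by
    rw [← hcover, Set.sUnion_eq_iUnion]
    have : Finite 𝒬 := hfin
    exact (locallyFinite_of_finite _).continuousOn_iUnion (fun Q => hcl Q Q.2)
      fun Q => (hlip Q Q.2).continuousOn
  refine LipschitzOnWith.of_dist_le_mul fun x hx y hy => ?_
  have hmem : ∀ t ∈ Set.Icc (0 : ℝ) 1, AffineMap.lineMap x y t ∈ X := fun t ht =>
    hX.lineMap_mem hx hy ht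
  have hlc : Continuous (AffineMap.lineMap x y : ℝ → E) := AffineMap.lineMap_continuous
  have hgc : ContinuousOn (fun t : ℝ => f (AffineMap.lineMap x y t)) (Set.Icc 0 1) :=
    hcont.comp hlc.continuousOn hmem
  set s : Set ℝ := {t | dist (f x) (f (AffineMap.lineMap x y t)) ≤ K * (t * dist x y)} with hs
  have hsub : Set.Icc (0 : ℝ) 1 ⊆ s := by
    refine IsClosed.Icc_subset_of_forall_exists_gt ?_ ?_ ?_
    · rw [Set.inter_comm]
      have hd : ContinuousOn (fun t : ℝ => dist (f x) (f (AffineMap.lineMap x y t)))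
          (Set.Icc 0 1) := continuous_dist.comp_continuousOn (continuousOn_const.prodMk hgc)
      exact isClosed_Icc.isClosed_le hd (Continuous.continuousOn (by fun_prop))
    · simp [hs]
    · rintro t ⟨hts, ht⟩ u hu
      have hev : ∀ᶠ v in nhdsWithin t (Set.Ioi t), v ∈ Set.Ioc t u ∧ v ∈ Set.Icc (0 : ℝ) 1 := by
        filter_upwards [Ioc_mem_nhdsGT hu, Ioc_mem_nhdsGT ht.2] with v hv hv'
        exact ⟨hv, ht.1.trans hv'.1.le, hv'.2⟩
      have hex : ∃ Q ∈ 𝒬, ∃ᶠ v in nhdsWithin t (Set.Ioi t), AffineMap.lineMap x y v ∈ Q := by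
        by_contra! hcon
        obtain ⟨v, hv, hv'⟩ := (((Filter.eventually_all_finite hfin).2 hcon).and hev).exists
        have := hmem v hv'.2
        rw [← hcover] at this
        obtain ⟨Q, hQ, hvQ⟩ := this
        exact hv Q hQ hvQ
      obtain ⟨Q, hQ, hfreq⟩ := hex
      have htQ : AffineMap.lineMap x y t ∈ Q :=
        (hcl Q hQ).mem_of_frequently_of_tendsto hfreq
          ((hlc.tendsto t).mono_left nhdsWithin_le_nhds)
      obtain ⟨v, hvQ, hv, hv01⟩ := (hfreq.and_eventually hev).exists
      refine ⟨v, ?_, hv⟩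
      have h1 := (hlip Q hQ).dist_le_mul _ htQ _ hvQ
      rw [dist_lineMap_lineMap, Real.dist_eq, abs_sub_comm, abs_of_pos (sub_pos.2 hv.1)] at h1
      calc dist (f x) (f (AffineMap.lineMap x y v))
          ≤ dist (f x) (f (AffineMap.lineMap x y t)) + dist (f (AffineMap.lineMap x y t))
            (f (AffineMap.lineMap x y v)) := dist_triangle _ _ _
        _ ≤ K * (t * dist x y) + K * ((v - t) * dist x y) := add_le_add hts h1
        _ = K * (v * dist x y) := by ring
  simpa [hs] using hsub (Set.right_mem_Icc.2 zero_le_one)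

/-! ### The minimax theorem for matrices -/

section Minimax

variable {X Y : Type*} [Fintype X] [Fintype Y]

/-- Von Neumann's minimax theorem: if each mixed action `y` of the second player has a reply against
which he gets at most `v`, then one mixed action of the first player does it against all `y`.
Otherwise the compact convex set of the vectors `x M` could be separated strictly from the orthant
of the vectors with coordinates at most `v`. -/
theorem exists_forall_sum_mul_le_of_minimax [Nonempty X] (M : X → Y → ℝ) (v : ℝ)
    (h : ∀ y ∈ stdSimplex ℝ Y, ∃ x ∈ stdSimplex ℝ X, ∑ b, y b * ∑ a, x a * M a b ≤ v) :
    ∃ x ∈ stdSimplex ℝ X, ∀ b, ∑ a, x a * M a b ≤ v := by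
  classical
  by_contra! hcon
  let g : (X → ℝ) →ₗ[ℝ] (Y → ℝ) := (Matrix.of M).vecMulLinear
  have hg : ∀ x b, g x b = ∑ a, x a * M a b := fun x b => by
    simp [g, Matrix.vecMul, dotProduct]
  have hgc : Continuous g := g.continuous_of_finiteDimensional
  obtain ⟨φ, s, t, hs, hst, ht⟩ := geometric_hahn_banach_compact_closed
    (s := g '' stdSimplex ℝ X) (t := {w : Y → ℝ | ∀ b, w b ≤ v})
    ((convex_stdSimplex ℝ X).linear_image g) ((isCompact_stdSimplex ℝ X).image hgc)
    (by
      intro w hw w' hw' a b ha hb hab i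
      have h1 := mul_le_mul_of_nonneg_left (hw i) ha
      have h2 := mul_le_mul_of_nonneg_left (hw' i) hb
      have h3 : a * v + b * v = v := by rw [← add_mul, hab, one_mul]
      simp only [Pi.add_apply, Pi.smul_apply, smul_eq_mul]
      linarith)
    (by
      simp only [Set.ofPred_forall]
      exact isClosed_iInter fun b => isClosed_le (continuous_apply b) continuous_const)
    (by
      rw [Set.disjoint_left]
      rintro _ ⟨x, hx, rfl⟩ hx'
      obtain ⟨b, hb⟩ := hcon x hx
      have := hx' b
      rw [hg] at this
      exact absurd this (not_le.2 hb))
  set c : Y → ℝ := fun b => -φ (Pi.single b 1) with hc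
  have hφ : ∀ w : Y → ℝ, φ w = -∑ b, c b * w b := by
    intro w
    conv_lhs => rw [pi_eq_sum_univ' w]
    simp [map_sum, hc, mul_comm]
  have hc0 : ∀ b, 0 ≤ c b := by
    intro b
    by_contra! hneg
    -- `φ` is bounded below on the orthant, but not along the direction `-b`
    have hlin : ∀ r : ℝ, 0 ≤ r → t < -∑ b, c b * v + r * c b := by
      intro r hr
      have := ht (fun b' => v - if b' = b then r else 0) (fun b' => by
        dsimp only; split_ifs <;> linarith)
      rw [hφ] at this
      simp only [mul_sub, Finset.sum_sub_distrib, mul_ite, mul_zero, Finset.sum_ite_eq',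
        Finset.mem_univ, if_true] at this
      linarith
    have h0 := hlin 0 le_rfl
    have h1 := hlin ((-∑ b, c b * v - t) / (-c b)) (div_nonneg (by linarith) (by linarith))
    have : (-∑ b, c b * v - t) / (-c b) * c b = -(-∑ b, c b * v - t) := by
      rw [div_neg, neg_mul, div_mul_cancel₀ _ hneg.ne]
    linarith
  have hv := ht (fun _ => v) (fun _ => le_rfl)
  rw [hφ, ← Finset.sum_mul] at hv
  have hX : ∀ x ∈ stdSimplex ℝ X, -s < ∑ b, c b * ∑ a, x a * M a b := by
    intro x hx
    have := hs _ ⟨x, hx, rfl⟩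
    rw [hφ] at this
    simp only [hg] at this
    linarith
  have hpos : 0 < ∑ b, c b := by
    refine lt_of_le_of_ne (Finset.sum_nonneg fun b _ => hc0 b) fun h0 => ?_
    have hz := (Finset.sum_eq_zero_iff_of_nonneg fun b _ => hc0 b).1 h0.symm
    obtain ⟨a⟩ := ‹Nonempty X›
    have := hX _ (single_mem_stdSimplex ℝ a)
    rw [Finset.sum_eq_zero fun b _ => by rw [hz b (Finset.mem_univ b), zero_mul]] at this
    rw [← h0] at hv
    linarith
  obtain ⟨x, hx, hle⟩ := h (fun b => c b / ∑ b, c b) ⟨fun b => div_nonneg (hc0 b) hpos.le, by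
    rw [← Finset.sum_div, div_self hpos.ne']⟩
  have h1 : ∑ b, c b / (∑ b, c b) * ∑ a, x a * M a b
      = (∑ b, c b * ∑ a, x a * M a b) / ∑ b, c b := by
    rw [Finset.sum_div]
    exact Finset.sum_congr rfl fun b _ => by ring
  rw [h1, div_le_iff₀ hpos] at hle
  have := hX x hx
  linarith

end Minimax

/-! ### Sequential experiments -/

section Sequential

variable {X : Type*}

theorem Fin.snoc_castLE_castSucc {t : ℕ} (h : Fin t → X) (x : X) (i : Fin t)
    (hi : ((i.castSucc : Fin (t + 1)) : ℕ) ≤ t + 1) (s : Fin i) :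
    Fin.snoc (α := fun _ => X) h x (Fin.castLE hi s) = h (Fin.castLE i.isLt.le s) := by
  have : (Fin.castLE hi s : Fin (t + 1)) = Fin.castSucc (Fin.castLE i.isLt.le s) := by
    ext; simp
  rw [this, Fin.snoc_castSucc]

theorem Fin.snoc_castLE_last {t : ℕ} (h : Fin t → X) (x : X)
    (hi : ((Fin.last t : Fin (t + 1)) : ℕ) ≤ t + 1) (s : Fin t) :
    Fin.snoc (α := fun _ => X) h x (Fin.castLE hi s) = h s := by
  have : (Fin.castLE hi s : Fin (t + 1)) = Fin.castSucc s := by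
    ext; simp
  rw [this, Fin.snoc_castSucc]

theorem sum_univ_snoc {M : Type*} [AddCommMonoid M] {t : ℕ}
    (f : (t : ℕ) → (Fin t → X) → X → M) (h : Fin t → X) (x : X) :
    ∑ s : Fin (t + 1), f s (fun r => Fin.snoc (α := fun _ => X) h x (Fin.castLE s.isLt.le r))
        (Fin.snoc (α := fun _ => X) h x s)
      = ∑ s : Fin t, f s (fun r => h (Fin.castLE s.isLt.le r)) (h s) + f t h x := by
  rw [Fin.sum_univ_castSucc]
  congr 1
  · refine Finset.sum_congr rfl fun i _ => ?_
    simp only [Fin.snoc_castSucc]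
    congr 1
    funext r
    exact Fin.snoc_castLE_castSucc h x i _ r
  · simp only [Fin.snoc_last]
    congr 1
    funext r
    exact Fin.snoc_castLE_last h x _ r

theorem prod_univ_snoc {t : ℕ} (f : (t : ℕ) → (Fin t → X) → X → ℝ) (h : Fin t → X) (x : X) :
    ∏ s : Fin (t + 1), f s (fun r => Fin.snoc (α := fun _ => X) h x (Fin.castLE s.isLt.le r))
        (Fin.snoc (α := fun _ => X) h x s)
      = (∏ s : Fin t, f s (fun r => h (Fin.castLE s.isLt.le r)) (h s)) * f t h x := by
  rw [Fin.prod_univ_castSucc]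
  congr 1
  · refine Finset.prod_congr rfl fun i _ => ?_
    simp only [Fin.snoc_castSucc]
    congr 1
    funext r
    exact Fin.snoc_castLE_castSucc h x i _ r
  · simp only [Fin.snoc_last]
    congr 1
    funext r
    exact Fin.snoc_castLE_last h x _ r

/-- The expectation of a supermartingale does not exceed its initial value; `q t h x` is the
probability of the outcome `x` in round `t` after the history `h`. -/
theorem sum_prod_mul_le_of_supermartingale [Fintype X] (q : (t : ℕ) → (Fin t → X) → X → ℝ)
    (hq : ∀ t h x, 0 ≤ q t h x) (W : (t : ℕ) → (Fin t → X) → ℝ) {w : ℝ} (hw : ∀ h, W 0 h ≤ w)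
    (hW : ∀ t h, ∑ x, q t h x * W (t + 1) (Fin.snoc (α := fun _ => X) h x) ≤ W t h) (T : ℕ) :
    ∑ ω : Fin T → X, (∏ t : Fin T, q t (fun r => ω (Fin.castLE t.isLt.le r)) (ω t)) * W T ω
      ≤ w := by
  induction T with
  | zero => simpa using hw _
  | succ T ih =>
    rw [← (Fin.snocEquiv fun _ => X).sum_comp, Fintype.sum_prod_type_right]
    refine le_trans (Finset.sum_le_sum fun h _ => ?_) ih
    have : ∀ x : X, (∏ t : Fin (T + 1), q t
          (fun r => (Fin.snocEquiv fun _ => X) (x, h) (Fin.castLE t.isLt.le r))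
          ((Fin.snocEquiv fun _ => X) (x, h) t)) * W (T + 1) ((Fin.snocEquiv fun _ => X) (x, h))
        = (∏ t : Fin T, q t (fun r => h (Fin.castLE t.isLt.le r)) (h t)) *
          (q T h x * W (T + 1) (Fin.snoc (α := fun _ => X) h x)) := by
      intro x
      rw [← mul_assoc, ← prod_univ_snoc]
      rfl
    simp only [this]
    rw [← Finset.mul_sum]
    exact mul_le_mul_of_nonneg_left (hW T h) (Finset.prod_nonneg fun t _ => hq _ _ _)

end Sequential

/-! ### Exponential inequalities -/

theorem Real.cosh_le_of_sq_le {x p q α β : ℝ} (hα : 0 ≤ α) (hβ : 0 ≤ β) (hαβ : α + β = 1)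
    (h : x ^ 2 ≤ α * p ^ 2 + β * q ^ 2) : Real.cosh x ≤ α * Real.cosh p + β * Real.cosh q := by
  refine hasSum_le (fun n => ?_) (Real.hasSum_cosh x)
    (((Real.hasSum_cosh p).mul_left α).add ((Real.hasSum_cosh q).mul_left β))
  have h1 : (x ^ 2) ^ n ≤ α * (p ^ 2) ^ n + β * (q ^ 2) ^ n :=
    (pow_le_pow_left₀ (sq_nonneg x) h n).trans
      ((convexOn_pow n).2 (sq_nonneg p) (sq_nonneg q) hα hβ hαβ)
  rw [pow_mul, pow_mul, pow_mul, ← mul_div_assoc, ← mul_div_assoc, ← add_div]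
  exact div_le_div_of_nonneg_right h1 (by positivity)

/-- The increment of `cosh ‖·‖` under a centered bounded perturbation. As `cosh ∘ √` is convex,
`cosh ‖y + D‖` is bounded by the affine function of `⟪y, D⟫` that interpolates between the two
collinear positions `‖y‖ ± c`. -/
theorem sum_mul_cosh_norm_add_le {X V : Type*} [Fintype X] [NormedAddCommGroup V]
    [InnerProductSpace ℝ V] (q : X → ℝ) (hq : q ∈ stdSimplex ℝ X) (D : X → V)
    (hD : ∑ x, q x • D x = 0) {c : ℝ} (hc : ∀ x, ‖D x‖ ≤ c) (y : V) :
    ∑ x, q x * Real.cosh ‖y + D x‖ ≤ Real.cosh c * Real.cosh ‖y‖ := by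
  have hq0 := hq.1
  have hq1 := hq.2
  obtain ⟨x₀⟩ : Nonempty X := by
    by_contra hX
    rw [not_nonempty_iff] at hX
    simp at hq1
  have hc0 : 0 ≤ c := (norm_nonneg _).trans (hc x₀)
  rcases eq_or_ne (‖y‖ * c) 0 with h0 | h0
  · have key : ∀ x, Real.cosh ‖y + D x‖ ≤ Real.cosh c * Real.cosh ‖y‖ := by
      intro x
      rcases mul_eq_zero.1 h0 with hy | hc'
      · rw [hy, Real.cosh_zero, mul_one, norm_eq_zero.1 hy, zero_add, Real.cosh_le_cosh,
          abs_of_nonneg (norm_nonneg _), abs_of_nonneg hc0]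
        exact hc x
      · have : D x = 0 := norm_le_zero_iff.1 (hc' ▸ hc x)
        rw [this, add_zero, hc', Real.cosh_zero, one_mul]
    calc ∑ x, q x * Real.cosh ‖y + D x‖ ≤ ∑ x, q x * (Real.cosh c * Real.cosh ‖y‖) :=
          Finset.sum_le_sum fun x _ => mul_le_mul_of_nonneg_left (key x) (hq0 x)
      _ = Real.cosh c * Real.cosh ‖y‖ := by rw [← Finset.sum_mul, hq1, one_mul]
  have hac : 0 < ‖y‖ * c := lt_of_le_of_ne (by positivity) h0.symm
  have key : ∀ x, Real.cosh ‖y + D x‖ ≤ Real.cosh c * Real.cosh ‖y‖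
      + inner ℝ y (D x) * (Real.sinh c * Real.sinh ‖y‖ / (‖y‖ * c)) := by
    intro x
    set δ := inner ℝ y (D x) / (‖y‖ * c) with hδ
    have hin : inner ℝ y (D x) = δ * (‖y‖ * c) := by rw [hδ, div_mul_cancel₀ _ h0]
    have habs : |δ| ≤ 1 := by
      rw [hδ, abs_div, abs_of_pos hac, div_le_one hac]
      exact (abs_real_inner_le_norm _ _).trans
        (mul_le_mul_of_nonneg_left (hc x) (norm_nonneg _))
    obtain ⟨hδ1, hδ2⟩ := abs_le.1 habs
    have h1 : Real.cosh ‖y + D x‖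
        ≤ (1 + δ) / 2 * Real.cosh (‖y‖ + c) + (1 - δ) / 2 * Real.cosh (‖y‖ - c) := by
      refine Real.cosh_le_of_sq_le (by linarith) (by linarith) (by ring) ?_
      rw [norm_add_sq_real, hin]
      nlinarith [pow_le_pow_left₀ (norm_nonneg _) (hc x) 2]
    have h2 : inner ℝ y (D x) * (Real.sinh c * Real.sinh ‖y‖ / (‖y‖ * c))
        = δ * (Real.sinh c * Real.sinh ‖y‖) := by
      rw [hδ]; ring
    rw [h2]
    refine h1.trans (le_of_eq ?_)
    rw [Real.cosh_add, Real.cosh_sub]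
    ring
  calc ∑ x, q x * Real.cosh ‖y + D x‖
      ≤ ∑ x, q x * (Real.cosh c * Real.cosh ‖y‖
        + inner ℝ y (D x) * (Real.sinh c * Real.sinh ‖y‖ / (‖y‖ * c))) :=
        Finset.sum_le_sum fun x _ => mul_le_mul_of_nonneg_left (key x) (hq0 x)
    _ = Real.cosh c * Real.cosh ‖y‖
        + inner ℝ y (∑ x, q x • D x) * (Real.sinh c * Real.sinh ‖y‖ / (‖y‖ * c)) := by
        simp only [mul_add, Finset.sum_add_distrib, inner_sum, inner_smul_right, Finset.sum_mul]
        rw [← Finset.sum_mul, ← Finset.sum_mul, hq1, one_mul]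
        simp only [Finset.sum_mul, mul_assoc]
    _ = Real.cosh c * Real.cosh ‖y‖ := by rw [hD, inner_zero_right, zero_mul, add_zero]

theorem Real.exp_sub_one_sub_le {x : ℝ} (hx : |x| < 3) :
    Real.exp x - 1 - x ≤ x ^ 2 / 2 / (1 - |x| / 3) := by
  have hr : |x| / 3 < 1 := by linarith
  have hg := (hasSum_geometric_of_lt_one (by positivity) hr).mul_left (x ^ 2 / 2)
  have he : HasSum (fun n : ℕ => x ^ (n + 2) / (n + 2).factorial) (Real.exp x - 1 - x) := by
    have hexp : HasSum (fun n : ℕ => x ^ n / n.factorial) (Real.exp x) := by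
      rw [Real.exp_eq_exp_ℝ]
      exact NormedSpace.expSeries_div_hasSum_exp x
    have := (hasSum_nat_add_iff' 2).2 hexp
    simpa [Finset.sum_range_succ, sub_sub] using this
  rw [div_eq_mul_inv]
  refine hasSum_le (fun n => ?_) he hg
  have hf : (2 : ℝ) * 3 ^ n ≤ ((n + 2).factorial : ℝ) := by
    have : ∀ n : ℕ, 2 * 3 ^ n ≤ (n + 2).factorial := by
      intro n
      induction n with
      | zero => simp
      | succ k ih =>
        rw [show k + 1 + 2 = (k + 2) + 1 by ring, Nat.factorial_succ, pow_succ]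
        nlinarith
    exact_mod_cast this n
  calc x ^ (n + 2) / (n + 2).factorial ≤ |x| ^ (n + 2) / (n + 2).factorial := by
        rw [← abs_pow]
        exact div_le_div_of_nonneg_right (le_abs_self _) (by positivity)
    _ ≤ |x| ^ (n + 2) / (2 * 3 ^ n) := div_le_div_of_nonneg_left (by positivity) (by positivity) hf
    _ = x ^ 2 / 2 * (|x| / 3) ^ n := by
        rw [pow_add, sq_abs, div_pow]
        field_simp

/-! ### Probabilities of events -/

namespace MonitoringGame

variable {I J S : Type*} [Fintype I] [Fintype J] [Fintype S] {d : ℕ}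
  {G : MonitoringGame I J S d} {π : (t : ℕ) → (Fin t → I × S) → I → ℝ}
  {τ : (t : ℕ) → (Fin t → I × J × S) → J → ℝ}

/-- The part of a history of the play that the first player observes. -/
def observed {t : ℕ} (h : Fin t → I × J × S) : Fin t → I × S := fun s => ((h s).1, (h s).2.2)

/-- The probability of the outcome `x` of round `t` after the history `h`. -/
def stepProb (G : MonitoringGame I J S d) (π : (t : ℕ) → (Fin t → I × S) → I → ℝ)
    (τ : (t : ℕ) → (Fin t → I × J × S) → J → ℝ) (t : ℕ) (h : Fin t → I × J × S)
    (x : I × J × S) : ℝ :=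
  π t (observed h) x.1 * τ t h x.2.1 * G.H x.1 x.2.1 x.2.2

theorem playProb_eq_prod (T : ℕ) (ω : Fin T → I × J × S) :
    G.playProb π τ T ω
      = ∏ t : Fin T, G.stepProb π τ t (fun r => ω (Fin.castLE t.isLt.le r)) (ω t) := rfl

theorem stepProb_nonneg (hπ : ∀ t o, π t o ∈ stdSimplex ℝ I) (hτ : IsOpponentStrategy τ) (t : ℕ)
    (h : Fin t → I × J × S) (x : I × J × S) : 0 ≤ G.stepProb π τ t h x :=
  mul_nonneg (mul_nonneg ((hπ _ _).1 _) ((hτ _ _).1 _)) ((G.H_mem _ _).1 _)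

theorem sum_stepProb_mul (t : ℕ) (h : Fin t → I × J × S) (f : I × J × S → ℝ) :
    ∑ x, G.stepProb π τ t h x * f x
      = ∑ j, τ t h j * ∑ i, π t (observed h) i * ∑ s, G.H i j s * f (i, j, s) := by
  simp only [Fintype.sum_prod_type, stepProb, Finset.mul_sum]
  rw [Finset.sum_comm]
  refine Finset.sum_congr rfl fun j _ => Finset.sum_congr rfl fun i _ =>
    Finset.sum_congr rfl fun s _ => ?_
  ring

theorem stepProb_mem (hπ : ∀ t o, π t o ∈ stdSimplex ℝ I) (hτ : IsOpponentStrategy τ) (t : ℕ)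
    (h : Fin t → I × J × S) : G.stepProb π τ t h ∈ stdSimplex ℝ (I × J × S) := by
  refine ⟨stepProb_nonneg hπ hτ t h, ?_⟩
  have := sum_stepProb_mul (G := G) (π := π) (τ := τ) t h fun _ => 1
  simp only [mul_one] at this
  simp [this, (G.H_mem _ _).2, (hπ _ _).2, (hτ _ _).2]

theorem playProb_nonneg (hπ : ∀ t o, π t o ∈ stdSimplex ℝ I) (hτ : IsOpponentStrategy τ) (T : ℕ)
    (ω : Fin T → I × J × S) : 0 ≤ G.playProb π τ T ω := by
  rw [playProb_eq_prod]
  exact Finset.prod_nonneg fun t _ => stepProb_nonneg hπ hτ _ _ _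

theorem sum_playProb (hπ : ∀ t o, π t o ∈ stdSimplex ℝ I) (hτ : IsOpponentStrategy τ) (T : ℕ) :
    ∑ ω, G.playProb π τ T ω = 1 := by
  refine le_antisymm ?_ ?_
  · have := sum_prod_mul_le_of_supermartingale (G.stepProb π τ) (stepProb_nonneg hπ hτ)
      (fun _ _ => 1) (w := 1) (fun _ => le_rfl)
      (fun t h => by simp [(stepProb_mem hπ hτ t h).2]) T
    simpa [playProb_eq_prod] using this
  · have := sum_prod_mul_le_of_supermartingale (G.stepProb π τ) (stepProb_nonneg hπ hτ)
      (fun _ _ => -1) (w := -1) (fun _ => le_rfl)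
      (fun t h => by simp [(stepProb_mem hπ hτ t h).2]) T
    simp only [mul_neg, mul_one, Finset.sum_neg_distrib] at this
    exact neg_le_neg_iff.1 this

theorem prob_mono (hπ : ∀ t o, π t o ∈ stdSimplex ℝ I) (hτ : IsOpponentStrategy τ) {T : ℕ}
    {E F : Set (Fin T → I × J × S)} (hEF : E ⊆ F) : G.prob π τ T E ≤ G.prob π τ T F :=
  Finset.sum_le_sum fun ω _ =>
    Set.indicator_le_indicator_of_subset hEF (playProb_nonneg hπ hτ T) ω

theorem prob_empty (T : ℕ) : G.prob π τ T ∅ = 0 := by simp [prob]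

theorem prob_union_le (hπ : ∀ t o, π t o ∈ stdSimplex ℝ I) (hτ : IsOpponentStrategy τ) {T : ℕ}
    (E F : Set (Fin T → I × J × S)) :
    G.prob π τ T (E ∪ F) ≤ G.prob π τ T E + G.prob π τ T F := by
  classical
  rw [prob, prob, prob, ← Finset.sum_add_distrib]
  refine Finset.sum_le_sum fun ω _ => ?_
  have := playProb_nonneg (G := G) hπ hτ T ω
  simp only [Set.indicator_apply, Set.mem_union]
  split_ifs <;> simp_all

theorem prob_biUnion_le (hπ : ∀ t o, π t o ∈ stdSimplex ℝ I) (hτ : IsOpponentStrategy τ) {T : ℕ}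
    {ι : Type*} (s : Finset ι) (E : ι → Set (Fin T → I × J × S)) {p : ℝ}
    (hp : ∀ i ∈ s, G.prob π τ T (E i) ≤ p) : G.prob π τ T (⋃ i ∈ s, E i) ≤ s.card * p := by
  classical
  induction s using Finset.induction_on with
  | empty => simp [prob_empty]
  | insert a s ha ih =>
    rw [Finset.set_biUnion_insert, Finset.card_insert_of_notMem ha]
    refine (prob_union_le hπ hτ _ _).trans ?_
    have h1 := hp a (Finset.mem_insert_self _ _)
    have h2 := ih fun i hi => hp i (Finset.mem_insert_of_mem hi)
    push_cast
    linarith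

theorem one_sub_le_prob_of_compl (hπ : ∀ t o, π t o ∈ stdSimplex ℝ I) (hτ : IsOpponentStrategy τ)
    {T : ℕ} {E F : Set (Fin T → I × J × S)} {δ : ℝ} (hF : G.prob π τ T F ≤ δ)
    (h : ∀ ω, ω ∉ F → ω ∈ E) : 1 - δ ≤ G.prob π τ T E := by
  have h1 : G.prob π τ T Set.univ = 1 := by simp [prob, sum_playProb hπ hτ]
  have h2 : G.prob π τ T Set.univ ≤ G.prob π τ T (F ∪ E) :=
    prob_mono hπ hτ fun ω _ => by
      by_cases hω : ω ∈ F
      · exact Or.inl hω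
      · exact Or.inr (h ω hω)
  have h3 := prob_union_le (G := G) hπ hτ F E
  linarith

theorem prob_le_of_supermartingale (hπ : ∀ t o, π t o ∈ stdSimplex ℝ I)
    (hτ : IsOpponentStrategy τ) (W : (t : ℕ) → (Fin t → I × J × S) → ℝ) {w a : ℝ} (ha : 0 < a)
    (hw : ∀ h, W 0 h ≤ w) (hW0 : ∀ t h, 0 ≤ W t h)
    (hW : ∀ t h, ∑ x, G.stepProb π τ t h x * W (t + 1) (Fin.snoc (α := fun _ => I × J × S) h x)
      ≤ W t h) (T : ℕ) : G.prob π τ T {ω | a ≤ W T ω} ≤ w / a := by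
  classical
  rw [le_div_iff₀ ha]
  refine le_trans ?_ (sum_prod_mul_le_of_supermartingale (G.stepProb π τ) (stepProb_nonneg hπ hτ)
    W hw hW T)
  rw [prob, Finset.sum_mul]
  refine Finset.sum_le_sum fun ω _ => ?_
  rw [← playProb_eq_prod]
  have h0 := playProb_nonneg (G := G) hπ hτ T ω
  simp only [Set.indicator_apply, Set.mem_ofPred_eq]
  split_ifs with h
  · exact mul_le_mul_of_nonneg_left h h0
  · simpa using mul_nonneg h0 (hW0 T ω)

/-- The Azuma–Hoeffding inequality for bounded martingale differences with values in a Hilbert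
space, with constants that do not depend on the dimension. -/
theorem prob_norm_sum_ge_le (hπ : ∀ t o, π t o ∈ stdSimplex ℝ I) (hτ : IsOpponentStrategy τ)
    {V : Type*} [NormedAddCommGroup V] [InnerProductSpace ℝ V]
    (D : (t : ℕ) → (Fin t → I × J × S) → I × J × S → V) {c : ℝ} (hc : 0 < c)
    (hDc : ∀ t h x, ‖D t h x‖ ≤ c) (hD : ∀ t h, ∑ x, G.stepProb π τ t h x • D t h x = 0)
    {T : ℕ} (hT : 0 < T) {u : ℝ} (hu : 0 ≤ u) :
    G.prob π τ T {ω | u ≤ ‖∑ t : Fin T, D t (fun r => ω (Fin.castLE t.isLt.le r)) (ω t)‖}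
      ≤ 2 * Real.exp (-(u ^ 2 / (2 * c ^ 2 * T))) := by
  have hT' : (0 : ℝ) < T := by exact_mod_cast hT
  set η : ℝ := u / (c ^ 2 * T) with hη
  have hη0 : 0 ≤ η := by positivity
  let M : (t : ℕ) → (Fin t → I × J × S) → V := fun t h =>
    ∑ s : Fin t, D s (fun r => h (Fin.castLE s.isLt.le r)) (h s)
  have hsnoc : ∀ t h x, M (t + 1) (Fin.snoc (α := fun _ => I × J × S) h x)
      = M t h + D t h x := fun t h x => sum_univ_snoc D h x
  have hcosh : 0 < Real.cosh (η * c) := Real.cosh_pos _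
  have hmain := prob_le_of_supermartingale (G := G) hπ hτ
    (fun t h => Real.cosh ‖η • M t h‖ / Real.cosh (η * c) ^ t) (w := 1)
    (a := Real.cosh (η * u) / Real.cosh (η * c) ^ T) (by positivity)
    (fun h => by simp [M]) (fun t h => by positivity) (fun t h => by
      have h1 := sum_mul_cosh_norm_add_le (G.stepProb π τ t h) (stepProb_mem hπ hτ t h)
        (fun x => η • D t h x) (by
          rw [← smul_zero η, ← hD t h, Finset.smul_sum]
          exact Finset.sum_congr rfl fun x _ => smul_comm _ _ _)
        (c := η * c) (fun x => by
          rw [norm_smul, Real.norm_of_nonneg hη0]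
          exact mul_le_mul_of_nonneg_left (hDc t h x) hη0) (η • M t h)
      simp only [hsnoc, smul_add, ← mul_div_assoc]
      rw [← Finset.sum_div, div_le_div_iff₀ (by positivity) (by positivity), pow_succ]
      calc _ ≤ Real.cosh (η * c) * Real.cosh ‖η • M t h‖ * Real.cosh (η * c) ^ t :=
            mul_le_mul_of_nonneg_right h1 (by positivity)
        _ = _ := by ring) T
  refine (prob_mono hπ hτ fun ω hω => ?_).trans (hmain.trans ?_)
  · simp only [Set.mem_ofPred_eq] at hω ⊢
    refine div_le_div_of_nonneg_right ?_ (by positivity)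
    rw [Real.cosh_le_cosh, abs_of_nonneg (by positivity), abs_of_nonneg (by positivity), norm_smul,
      Real.norm_of_nonneg hη0]
    exact mul_le_mul_of_nonneg_left hω hη0
  · rw [one_div_div, div_le_iff₀ (Real.cosh_pos _)]
    have h1 : Real.cosh (η * c) ^ T ≤ Real.exp ((η * c) ^ 2 / 2 * T) := by
      rw [mul_comm _ (T : ℝ), Real.exp_nat_mul]
      exact pow_le_pow_left₀ hcosh.le (Real.cosh_le_exp_half_sq _) T
    have h2 : Real.exp (η * u) ≤ 2 * Real.cosh (η * u) := by
      rw [Real.cosh_eq]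
      linarith [Real.exp_pos (-(η * u))]
    have h3 : (η * c) ^ 2 / 2 * T = -(u ^ 2 / (2 * c ^ 2 * T)) + η * u := by
      rw [hη]
      field_simp
      ring
    rw [h3, Real.exp_add] at h1
    calc _ ≤ _ := h1
      _ ≤ Real.exp (-(u ^ 2 / (2 * c ^ 2 * T))) * (2 * Real.cosh (η * u)) :=
        mul_le_mul_of_nonneg_left h2 (Real.exp_pos _).le
      _ = _ := by ring

/-- An exponential inequality of Bernstein type for the importance-weighted estimator of the
probability of the signal `z.2` under the action `z.1`, on the rounds that satisfy `A`. The
deviations on both sides are covered since `η` may be negative. The bound `κ * ∑ H(z.1, J_t)(z.2)`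
on the conditional variances is kept random. -/
theorem prob_le_sum_estimator_sub_le [DecidableEq I] [DecidableEq S]
    (hπ : ∀ t o, π t o ∈ stdSimplex ℝ I) (hτ : IsOpponentStrategy τ) (z : I × S) {η κ : ℝ}
    (hp : ∀ t o, 0 < π t o z.1) (hκ : ∀ t o, π t o z.1 *
      (Real.exp (η / π t o z.1) - 1 - η / π t o z.1) ≤ κ)
    (A : ℕ → Prop) [DecidablePred A] (T : ℕ) (l : ℝ) :
    G.prob π τ T {ω | l ≤ ∑ t : Fin T, if A t then
        η * ((if (ω t).2.2 = z.2 ∧ (ω t).1 = z.1 then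
          (π t (observed fun r => ω (Fin.castLE t.isLt.le r)) (ω t).1)⁻¹ else 0)
            - G.H z.1 (ω t).2.1 z.2)
          - κ * G.H z.1 (ω t).2.1 z.2 else 0}
      ≤ Real.exp (-l) := by
  let D : (t : ℕ) → (Fin t → I × J × S) → I × J × S → ℝ := fun t h x =>
    if A t then
      η * ((if x.2.2 = z.2 ∧ x.1 = z.1 then (π t (observed h) x.1)⁻¹ else 0)
            - G.H z.1 x.2.1 z.2) - κ * G.H z.1 x.2.1 z.2 else 0
  have hmain := prob_le_of_supermartingale (G := G) hπ hτ
    (fun t h => Real.exp (∑ s : Fin t, D s (fun r => h (Fin.castLE s.isLt.le r)) (h s)))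
    (w := 1) (a := Real.exp l) (Real.exp_pos _) (fun h => by simp) (fun t h => (Real.exp_pos _).le)
    (fun t h => by
      simp only [sum_univ_snoc D h, Real.exp_add]
      simp only [mul_left_comm _ (Real.exp (∑ s : Fin t, D s _ (h s))), ← Finset.mul_sum]
      refine mul_le_of_le_one_right (Real.exp_pos _).le ?_
      by_cases hA : A t
      swap
      · simp [D, hA, (stepProb_mem (G := G) hπ hτ t h).2]
      rw [sum_stepProb_mul]
      have hj : ∀ j, ∑ i, π t (observed h) i * ∑ s, G.H i j s * Real.exp (D t h (i, j, s)) ≤ 1 := by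
        intro j
        set p := π t (observed h) z.1 with hpdef
        have hp0 : 0 < p := hp t _
        set H := G.H z.1 j z.2 with hH
        have hH0 : 0 ≤ H := (G.H_mem _ _).1 _
        have hexp : ∀ i s, Real.exp (D t h (i, j, s)) = Real.exp (-((η + κ) * H)) *
            (1 + if i = z.1 then if s = z.2 then Real.exp (η / p) - 1 else 0 else 0) := by
          intro i s
          by_cases hi : i = z.1
          · by_cases hs : s = z.2
            · subst hi hs
              simp only [D, hA, if_true, and_self, add_sub_cancel, ← Real.exp_add]
              congr 1
              rw [← hpdef, ← hH]
              ring
            · simp only [D, hA, if_true, hs, hi, false_and, if_false, add_zero, mul_one]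
              congr 1
              rw [← hH]
              ring
          · simp only [D, hA, if_true, hi, and_false, if_false, add_zero, mul_one]
            congr 1
            rw [← hH]
            ring
        have hsum : ∑ i, π t (observed h) i * ∑ s, G.H i j s * Real.exp (D t h (i, j, s))
            = Real.exp (-((η + κ) * H)) * (1 + H * (p * (Real.exp (η / p) - 1))) := by
          simp only [hexp, mul_left_comm _ (Real.exp (-((η + κ) * H))), ← Finset.mul_sum]
          congr 1
          have : ∀ i, ∑ s, G.H i j s *
              (1 + if i = z.1 then if s = z.2 then Real.exp (η / p) - 1 else 0 else 0)
              = 1 + if i = z.1 then H * (Real.exp (η / p) - 1) else 0 := by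
            intro i
            simp only [mul_add, mul_one, Finset.sum_add_distrib, (G.H_mem i j).2]
            by_cases hi : i = z.1
            · subst hi
              simp [hH]
            · simp [hi]
          simp only [this]
          simp only [mul_add, mul_one, Finset.sum_add_distrib, (hπ _ _).2]
          simp only [mul_ite, mul_zero, Finset.sum_ite_eq', Finset.mem_univ, if_true, ← hpdef]
          ring
        rw [hsum, Real.exp_neg, inv_mul_le_iff₀ (Real.exp_pos _), mul_one]
        have h1 : p * (Real.exp (η / p) - 1) ≤ η + κ := by
          have := hκ t (observed h)
          rw [← hpdef] at this
          have h2 : p * (η / p) = η := mul_div_cancel₀ _ hp0.ne'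
          linarith
        have h2 := mul_le_mul_of_nonneg_left h1 hH0
        have h3 := Real.add_one_le_exp ((η + κ) * H)
        linarith
      calc _ ≤ ∑ j, τ t h j * 1 :=
            Finset.sum_le_sum fun j _ => mul_le_mul_of_nonneg_left (hj j) ((hτ t h).1 j)
        _ = 1 := by simp [(hτ t h).2]) T
  refine (prob_mono hπ hτ fun ω hω => ?_).trans (hmain.trans (le_of_eq ?_))
  · exact Real.exp_le_exp.2 hω
  · rw [Real.exp_neg, one_div]

end MonitoringGame

/-! ### Payoffs and signals -/

theorem EuclideanSpace.sum_abs_le_sqrt_card_mul_norm {ι : Type*} [Fintype ι]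
    (v : EuclideanSpace ℝ ι) : ∑ i, |v i| ≤ √(Fintype.card ι) * ‖v‖ := by
  have h := Real.sum_mul_le_sqrt_mul_sqrt Finset.univ (fun _ : ι => (1 : ℝ)) fun i => |v i|
  simpa [EuclideanSpace.norm_eq] using h

namespace MonitoringGame

section Payoff

variable {I J S : Type*} [Fintype I] [Fintype J] [Fintype S] {d : ℕ}
  (G : MonitoringGame I J S d)

theorem norm_r_le (i : I) (j : J) : ‖G.r i j‖ ≤ G.payoffBound :=
  le_ciSup (f := fun z : I × J => ‖G.r z.1 z.2‖) (Set.finite_range _).bddAbove (i, j)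

theorem payoffBound_nonneg : 0 ≤ G.payoffBound := Real.iSup_nonneg fun _ => norm_nonneg _

theorem norm_payoff_le (p : I → ℝ) (q : J → ℝ) :
    ‖G.payoff p q‖ ≤ (∑ i, |p i|) * (∑ j, |q j|) * G.payoffBound := by
  rw [payoff, Finset.sum_mul_sum, Finset.sum_mul]
  refine norm_sum_le_of_le _ fun i _ => ?_
  rw [Finset.sum_mul]
  refine norm_sum_le_of_le _ fun j _ => ?_
  rw [norm_smul, Real.norm_eq_abs, abs_mul]
  exact mul_le_mul_of_nonneg_left (G.norm_r_le i j) (by positivity)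

theorem norm_payoff_le_of_mem {p : I → ℝ} {q : J → ℝ} (hp : p ∈ stdSimplex ℝ I)
    (hq : q ∈ stdSimplex ℝ J) : ‖G.payoff p q‖ ≤ G.payoffBound := by
  refine (G.norm_payoff_le p q).trans (le_of_eq ?_)
  simp only [abs_of_nonneg (hp.1 _), abs_of_nonneg (hq.1 _), hp.2, hq.2, one_mul]

/-- The map `(p, q) ↦ payoff p q` as a bilinear map. -/
def payoffBilinear : (I → ℝ) →ₗ[ℝ] (J → ℝ) →ₗ[ℝ] EuclideanSpace ℝ (Fin d) :=
  LinearMap.mk₂ ℝ G.payoff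
    (fun p p' q => by simp [payoff, add_mul, add_smul, Finset.sum_add_distrib])
    (fun c p q => by simp [payoff, Finset.smul_sum, smul_smul, mul_assoc])
    (fun p q q' => by simp [payoff, mul_add, add_smul, Finset.sum_add_distrib])
    (fun c p q => by simp [payoff, Finset.smul_sum, smul_smul, mul_left_comm])

theorem payoffBilinear_apply (p : I → ℝ) (q : J → ℝ) : G.payoffBilinear p q = G.payoff p q := rfl

theorem payoff_sum_left {ι : Type*} (t : Finset ι) (w : ι → ℝ) (p : ι → I → ℝ) (q : J → ℝ) :
    G.payoff (∑ a ∈ t, w a • p a) q = ∑ a ∈ t, w a • G.payoff (p a) q := by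
  simp [← payoffBilinear_apply, map_sum, LinearMap.sum_apply]

theorem payoff_sum_right {ι : Type*} (t : Finset ι) (w : ι → ℝ) (p : I → ℝ) (q : ι → J → ℝ) :
    G.payoff p (∑ a ∈ t, w a • q a) = ∑ a ∈ t, w a • G.payoff p (q a) := by
  simp [← payoffBilinear_apply, map_sum]

theorem payoff_sub_left (p p' : I → ℝ) (q : J → ℝ) :
    G.payoff (p - p') q = G.payoff p q - G.payoff p' q := by
  simp [← payoffBilinear_apply]

/-- The map `q ↦ signals q` as a linear map. -/
def signalsLinear : (J → ℝ) →ₗ[ℝ] EuclideanSpace ℝ (I × S) where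
  toFun := G.signals
  map_add' q q' := by
    ext z
    simp [signals, add_mul, Finset.sum_add_distrib]
  map_smul' c q := by
    ext z
    simp [signals, Finset.mul_sum, mul_assoc]

theorem coe_signalsLinear : ⇑G.signalsLinear = G.signals := rfl

theorem convex_feasible : Convex ℝ G.feasible :=
  (convex_stdSimplex ℝ J).linear_image G.signalsLinear

theorem isClosed_feasible : IsClosed G.feasible :=
  ((isCompact_stdSimplex ℝ J).image G.signalsLinear.continuous_of_finiteDimensional).isClosed

theorem feasible_nonempty [Nonempty J] : G.feasible.Nonempty := by
  classical
  exact ⟨_, _, single_mem_stdSimplex ℝ (Classical.arbitrary J), rfl⟩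

theorem fiber_nonempty {σ : EuclideanSpace ℝ (I × S)} (hσ : σ ∈ G.feasible) :
    (G.fiber σ).Nonempty := hσ

theorem mbar_nonempty (p : I → ℝ) {σ : EuclideanSpace ℝ (I × S)} (hσ : σ ∈ G.feasible) :
    (G.mbar p σ).Nonempty := by
  obtain ⟨q, hq, rfl⟩ := hσ
  exact ⟨_, q, hq, rfl, rfl⟩

theorem norm_le_of_mem_mbar {p : I → ℝ} (hp : p ∈ stdSimplex ℝ I) {σ : EuclideanSpace ℝ (I × S)}
    {v : EuclideanSpace ℝ (Fin d)} (hv : v ∈ G.mbar p σ) : ‖v‖ ≤ G.payoffBound := by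
  obtain ⟨q, hq, -, rfl⟩ := hv
  exact G.norm_payoff_le_of_mem hp hq

/-- The map `mbar p` is concave with respect to the inclusion of sets. -/
theorem sum_mem_mbar {ι : Type*} (t : Finset ι) (w : ι → ℝ) (hw : ∀ i ∈ t, 0 ≤ w i)
    (hw1 : ∑ i ∈ t, w i = 1) (p : I → ℝ) (σ : ι → EuclideanSpace ℝ (I × S))
    (v : ι → EuclideanSpace ℝ (Fin d)) (hv : ∀ i ∈ t, v i ∈ G.mbar p (σ i)) :
    ∑ i ∈ t, w i • v i ∈ G.mbar p (∑ i ∈ t, w i • σ i) := by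
  choose! q hq hσ hv using hv
  refine ⟨∑ i ∈ t, w i • q i, (convex_stdSimplex ℝ J).sum_mem hw hw1 hq, ?_, ?_⟩
  · rw [← coe_signalsLinear, map_sum]
    exact Finset.sum_congr rfl fun i hi => by rw [map_smul, coe_signalsLinear, hσ i hi]
  · rw [payoff_sum_right]
    exact Finset.sum_congr rfl fun i hi => by rw [hv i hi]

theorem convex_mbar (p : I → ℝ) (σ : EuclideanSpace ℝ (I × S)) : Convex ℝ (G.mbar p σ) := by
  rintro _ ⟨q, hq, hσ, rfl⟩ _ ⟨q', hq', hσ', rfl⟩ a b ha hb hab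
  refine ⟨a • q + b • q', convex_stdSimplex ℝ J hq hq' ha hb hab, ?_, ?_⟩
  · rw [← coe_signalsLinear, map_add, map_smul, map_smul, coe_signalsLinear, hσ, hσ', ← add_smul,
      hab, one_smul]
  · simp [← payoffBilinear_apply]

end Payoff

/-! ### The triangulation and the barycentric coordinates -/

section Triangulation

theorem _root_.Geometry.SimplicialComplex.eq_weights_of_sum_eq {E : Type*} [AddCommGroup E]
    [Module ℝ E] (K : Geometry.SimplicialComplex ℝ E) {s t : Finset E} (hs : s ∈ K.faces)
    (ht : t ∈ K.faces) {w w' : E → ℝ} (hw : ∀ y ∈ s, 0 ≤ w y) (hw1 : ∑ y ∈ s, w y = 1)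
    (hw' : ∀ y ∈ t, 0 ≤ w' y) (hw1' : ∑ y ∈ t, w' y = 1)
    (h : ∑ y ∈ s, w y • y = ∑ y ∈ t, w' y • y) {y : E} (hy : y ∈ s) (hyt : y ∉ t) : w y = 0 := by
  classical
  have h1 : ∑ y ∈ s, w y • y ∈ convexHull ℝ ((s ∩ t : Finset E) : Set E) := by
    rw [Finset.coe_inter]
    refine K.inter_subset_convexHull hs ht ⟨?_, ?_⟩
    · exact Finset.mem_convexHull'.2 ⟨w, hw, hw1, rfl⟩
    · exact Finset.mem_convexHull'.2 ⟨w', hw', hw1', h.symm⟩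
  obtain ⟨v, hv, hv1, hv2⟩ := Finset.mem_convexHull'.1 h1
  have hsum : ∑ y ∈ s, (if y ∈ t then v y else 0) • y = ∑ y ∈ s ∩ t, v y • y := by
    rw [← Finset.filter_mem_eq_inter, Finset.sum_filter]
    exact Finset.sum_congr rfl fun y _ => by split_ifs <;> simp
  have hind := (affineIndependent_iff.1 (K.indep hs)) Finset.univ
    (fun y => w y - if (y : E) ∈ t then v y else 0)
    (by
      rw [Finset.univ_eq_attach, Finset.sum_attach s fun y => w y - if y ∈ t then v y else 0,
        Finset.sum_sub_distrib, hw1, ← Finset.sum_filter, Finset.filter_mem_eq_inter, hv1,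
        sub_self])
    (by
      rw [Finset.univ_eq_attach,
        Finset.sum_attach s fun y => (w y - if y ∈ t then v y else 0) • y]
      simp only [sub_smul]
      rw [Finset.sum_sub_distrib, hsum, hv2, sub_self])
    ⟨y, hy⟩ (Finset.mem_univ _)
  simpa [hyt] using hind

theorem _root_.Finset.sum_coe_smul_eq_sum_dite {E V : Type*} [AddCommGroup V] [Module ℝ V]
    [DecidableEq E] {s B : Finset E} (hsB : s ⊆ B) (w : B → ℝ) (f : E → V)
    (hw : ∀ b, w b ≠ 0 → (b : E) ∈ s) :
    ∑ b : B, w b • f b = ∑ y ∈ s, (if hy : y ∈ B then w ⟨y, hy⟩ else 0) • f y := by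
  rw [Finset.sum_subset hsB (fun y hy hys => ?_), ← Finset.sum_coe_sort B]
  · exact Finset.sum_congr rfl fun b _ => by rw [dif_pos b.2]
  · rw [dif_pos hy, not_imp_comm.1 (hw ⟨y, hy⟩) hys, zero_smul]

variable {I J S : Type*} [Fintype I] [Fintype J] [Fintype S] {d : ℕ}
  {G : MonitoringGame I J S d} {B : Finset (EuclideanSpace ℝ (I × S))}
  {Φ : EuclideanSpace ℝ (I × S) → EuclideanSpace ℝ B}

theorem IsSignalTriangulation.mem_stdSimplex (h : G.IsSignalTriangulation B Φ)
    {σ : EuclideanSpace ℝ (I × S)} (hσ : σ ∈ G.feasible) :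
    (fun b => Φ σ b) ∈ stdSimplex ℝ B := by
  obtain ⟨K, -, -, -, -, h⟩ := h
  exact (h σ hσ).1

theorem IsSignalTriangulation.subset_feasible (h : G.IsSignalTriangulation B Φ) :
    (B : Set (EuclideanSpace ℝ (I × S))) ⊆ G.feasible := by
  obtain ⟨K, -, hK, hB, -⟩ := h
  intro b hb
  rw [← hB] at hb
  rw [← hK]
  exact K.subset_space hb (by simp)

theorem IsSignalTriangulation.nonempty [Nonempty J] (h : G.IsSignalTriangulation B Φ) :
    Nonempty B := by
  obtain ⟨σ, hσ⟩ := G.feasible_nonempty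
  by_contra hB
  rw [not_nonempty_iff] at hB
  simpa using (h.mem_stdSimplex hσ).2

/-- The barycentric coordinates of a point of a simplex of the triangulation vanish outside of this
simplex, so that `Φ` is the inverse of a linear injection on each simplex. -/
theorem IsSignalTriangulation.lipschitz (h : G.IsSignalTriangulation B Φ) :
    ∃ κ : NNReal, LipschitzOnWith κ Φ G.feasible := by
  classical
  obtain ⟨K, hfin, hK, hB, -, hΦ⟩ := h
  have hsB : ∀ s ∈ K.faces, s ⊆ B := fun s hs y hy => by
    have : y ∈ K.vertices := K.down_closed hs (by simpa using hy) (by simp)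
    rw [hB] at this
    exact this
  have hsupp : ∀ s ∈ K.faces, ∀ σ ∈ convexHull ℝ (s : Set (EuclideanSpace ℝ (I × S))),
      ∀ b : B, (b : EuclideanSpace ℝ (I × S)) ∉ s → Φ σ b = 0 := by
    intro s hs σ hσ b hb
    have hσF : σ ∈ G.feasible := hK ▸ K.convexHull_subset_space hs hσ
    obtain ⟨h1, h2, t, ht, htΦ⟩ := hΦ σ hσF
    obtain ⟨w, hw, hw1, hw2⟩ := Finset.mem_convexHull'.1 hσ
    by_contra hne
    refine hne ?_
    have := K.eq_weights_of_sum_eq ht hs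
      (w := fun y => if hy : y ∈ B then Φ σ ⟨y, hy⟩ else 0) (w' := w)
      (fun y _ => by dsimp only; split_ifs; exacts [h1.1 _, le_rfl])
      (by
        have := Finset.sum_coe_smul_eq_sum_dite (hsB t ht) (fun b => Φ σ b) (fun _ => (1 : ℝ)) htΦ
        simp only [smul_eq_mul, mul_one] at this
        rw [← this]
        exact h1.2) hw hw1
      (by
        rw [hw2, ← Finset.sum_coe_smul_eq_sum_dite (hsB t ht) (fun b => Φ σ b) (fun y => y) htΦ,
          h2]) (htΦ b hne) hb
    simpa using this
  have hlip : ∀ s ∈ K.faces, ∃ κ : NNReal,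
      LipschitzOnWith κ Φ (convexHull ℝ (s : Set (EuclideanSpace ℝ (I × S)))) := by
    intro s hs
    let U : Submodule ℝ (EuclideanSpace ℝ B) :=
      { carrier := {v | ∀ b : B, (b : EuclideanSpace ℝ (I × S)) ∉ s → v b = 0}
        add_mem' := fun {v w} hv hw b hb => by simp [hv b hb, hw b hb]
        zero_mem' := fun b _ => rfl
        smul_mem' := fun c v hv b hb => by simp [hv b hb] }
    let g : U →ₗ[ℝ] EuclideanSpace ℝ (I × S) × ℝ :=
      { toFun := fun v => (∑ b : B, (v : EuclideanSpace ℝ B) b • (b : EuclideanSpace ℝ (I × S)),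
          ∑ b : B, (v : EuclideanSpace ℝ B) b)
        map_add' := fun v w => by simp [add_smul, Finset.sum_add_distrib]
        map_smul' := fun c v => by simp [Finset.smul_sum, Finset.mul_sum, smul_smul] }
    have hg : LinearMap.ker g = ⊥ := by
      rw [LinearMap.ker_eq_bot']
      rintro ⟨v, hv⟩ h0
      have hv' : ∀ b : B, v b ≠ 0 → (b : EuclideanSpace ℝ (I × S)) ∈ s := fun b hb => by
        by_contra hbs
        exact hb (hv b hbs)
      obtain ⟨h01, h02⟩ := Prod.mk.injEq _ _ _ _ ▸ h0
      have h03 := Finset.sum_coe_smul_eq_sum_dite (hsB s hs) (fun b => v b) (fun y => y) hv'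
      have h04 := Finset.sum_coe_smul_eq_sum_dite (hsB s hs) (fun b => v b) (fun _ => (1 : ℝ)) hv'
      simp only [smul_eq_mul, mul_one] at h04
      have hind := affineIndependent_iff.1 (K.indep hs) Finset.univ
        (fun y => if hy : (y : EuclideanSpace ℝ (I × S)) ∈ B then v ⟨y, hy⟩ else 0)
        (by
          rw [Finset.univ_eq_attach, Finset.sum_attach s fun y =>
            if hy : y ∈ B then v ⟨y, hy⟩ else 0, ← h04]
          exact h02)
        (by
          rw [Finset.univ_eq_attach, Finset.sum_attach s fun y =>
            (if hy : y ∈ B then v ⟨y, hy⟩ else 0) • y, ← h03]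
          exact h01)
      ext b
      by_cases hb : (b : EuclideanSpace ℝ (I × S)) ∈ s
      · simpa using hind ⟨b, hb⟩ (Finset.mem_univ _)
      · exact hv b hb
    obtain ⟨κ, -, hκ⟩ := g.exists_antilipschitzWith hg
    refine ⟨κ, LipschitzOnWith.of_dist_le_mul fun x hx y hy => ?_⟩
    have hxF : x ∈ G.feasible := hK ▸ K.convexHull_subset_space hs hx
    have hyF : y ∈ G.feasible := hK ▸ K.convexHull_subset_space hs hy
    have hgΦ : ∀ x (hxF : x ∈ G.feasible)
        (hx : x ∈ convexHull ℝ (s : Set (EuclideanSpace ℝ (I × S)))),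
        g ⟨Φ x, fun b hb => hsupp s hs x hx b hb⟩ = (x, 1) := fun x hxF hx =>
      Prod.ext (hΦ x hxF).2.1 (hΦ x hxF).1.2
    have := hκ.le_mul_dist ⟨Φ x, fun b hb => hsupp s hs x hx b hb⟩
      ⟨Φ y, fun b hb => hsupp s hs y hy b hb⟩
    rw [hgΦ x hxF hx, hgΦ y hyF hy, Prod.dist_eq, dist_self, max_eq_left dist_nonneg] at this
    exact this
  choose! κ hκ using hlip
  refine ⟨hfin.toFinset.sup κ, lipschitzOnWith_of_finite_closed_cover G.convex_feasible
    (𝒬 := (fun s : Finset (EuclideanSpace ℝ (I × S)) => convexHull ℝ (s : Set _)) '' K.faces)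
    (hfin.image _) ?_ ?_ ?_⟩
  · rintro _ ⟨s, -, rfl⟩
    exact s.finite_toSet.isClosed_convexHull (𝕜 := ℝ)
  · rw [← hK, Set.sUnion_image]
    rfl
  · rintro _ ⟨s, hs, rfl⟩
    exact (hκ s hs).weaken (Finset.le_sup (f := κ) (hfin.mem_toFinset.2 hs))

/-- A mixed action compatible with `σ` is the average, with the barycentric coordinates of `σ` as
weights, of mixed actions compatible with the vertices. -/
theorem IsSignalTriangulation.exists_fiber_decomposition (h : G.IsSignalTriangulation B Φ)
    {q : J → ℝ} (hq : q ∈ stdSimplex ℝ J) :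
    ∃ z : B → J → ℝ, (∀ b : B, z b ∈ G.fiber b) ∧ q = ∑ b, Φ (G.signals q) b • z b := by
  classical
  have hBF := h.subset_feasible
  obtain ⟨K, hfin, hK, hB, hlin, hΦ⟩ := h
  have hσ : G.signals q ∈ G.feasible := ⟨q, hq, rfl⟩
  obtain ⟨h1, h2, s, hs, hsΦ⟩ := hΦ _ hσ
  set t : Finset B := Finset.univ.filter fun b => (b : EuclideanSpace ℝ (I × S)) ∈ s with ht
  have h0 : ∀ b, b ∉ t → Φ (G.signals q) b = 0 := fun b hb => by
    by_contra hne
    exact hb (by simp [ht, hsΦ b hne])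
  have ht1 : ∑ b ∈ t, Φ (G.signals q) b = 1 := by
    rw [Finset.sum_subset (Finset.subset_univ t) fun b _ hb => h0 b hb]
    exact h1.2
  have ht2 : ∑ b ∈ t, Φ (G.signals q) b • (b : EuclideanSpace ℝ (I × S)) = G.signals q := by
    rw [Finset.sum_subset (Finset.subset_univ t) fun b _ hb => by rw [h0 b hb, zero_smul]]
    exact h2
  obtain ⟨z, hz, hqz⟩ := ((hlin s hs).mem_sum_iff (convex_convexHull ℝ _)
    (fun x hx => G.fiber_nonempty (hK ▸ K.convexHull_subset_space hs hx)) t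
    (fun b => Φ (G.signals q) b) (fun b => (b : EuclideanSpace ℝ (I × S))) (fun b _ => h1.1 b) ht1
    (fun b hb => subset_convexHull ℝ _ (Finset.mem_filter.1 hb).2) q).1
    (by rw [ht2]; exact ⟨hq, rfl⟩)
  choose! g hg using fun b : B => G.fiber_nonempty (hBF b.2)
  refine ⟨fun b => if b ∈ t then z b else g b, fun b => ?_, ?_⟩
  · dsimp only
    split_ifs with hb
    exacts [hz b hb, hg b]
  · conv_lhs => rw [hqz]
    rw [Finset.sum_subset (Finset.subset_univ t) fun b _ hb => by rw [h0 b hb, zero_smul]]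
    refine Finset.sum_congr rfl fun b _ => ?_
    dsimp only
    split_ifs with hb
    · rfl
    · rw [h0 b hb, zero_smul, zero_smul]

end Triangulation

end MonitoringGame

namespace MonitoringGame

variable {I J S : Type*} [Fintype I] [Fintype J] [Fintype S] {d : ℕ}
  {G : MonitoringGame I J S d} {B : Finset (EuclideanSpace ℝ (I × S))}
  {Φ : EuclideanSpace ℝ (I × S) → EuclideanSpace ℝ B} {A : Finset (I → ℝ)}
  {C : Set (EuclideanSpace ℝ (Fin d))}

/-! ### Vertices of the decomposition of the set of mixed actions -/

/-- The common refinement of the polytopal decompositions for the individual `b ∈ B`. -/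
theorem exists_isActionVertexSet (hB : Nonempty B) (hlin : G.IsBiPiecewiseLinear B) :
    ∃ A : Finset (I → ℝ), G.IsActionVertexSet B A := by
  classical
  choose 𝒬 hfin hpoly hcov hlin using fun b : B => hlin b b.2
  set ℛ : Set (Set (I → ℝ)) := (fun c : B → Set (I → ℝ) => ⋂ b, c b) '' Set.univ.pi 𝒬 with hℛ
  have hℛfin : ℛ.Finite := (Set.Finite.pi fun b => hfin b).image _
  have hℛpoly : ∀ P ∈ ℛ, IsPolytope P := by
    rintro _ ⟨c, hc, rfl⟩
    exact IsPolytope.iInter fun b => hpoly b _ (hc b trivial)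
  have hAfin : (⋃ P ∈ ℛ, P.extremePoints ℝ).Finite :=
    hℛfin.biUnion fun P hP => (hℛpoly P hP).finite_extremePoints
  refine ⟨hAfin.toFinset, ℛ, hℛfin, hℛpoly, ?_, ?_, by simp⟩
  · ext p
    constructor
    · rintro ⟨_, ⟨c, hc, rfl⟩, hp⟩
      have b := Classical.arbitrary B
      rw [← hcov b]
      exact ⟨c b, hc b trivial, Set.mem_iInter.1 hp b⟩
    · intro hp
      have : ∀ b, ∃ P ∈ 𝒬 b, p ∈ P := fun b => by
        rw [← hcov b] at hp
        exact hp
      choose c hc hpc using this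
      exact ⟨_, ⟨c, fun b _ => hc b, rfl⟩, Set.mem_iInter.2 hpc⟩
  · rintro b hb _ ⟨c, hc, rfl⟩
    exact (hlin ⟨b, hb⟩ _ (hc ⟨b, hb⟩ trivial)).mono (Set.iInter_subset _ _)

theorem IsActionVertexSet.subset_stdSimplex (hA : G.IsActionVertexSet B A) {a : I → ℝ}
    (ha : a ∈ A) : a ∈ stdSimplex ℝ I := by
  obtain ⟨𝒬, -, -, hcov, -, hA⟩ := hA
  have : a ∈ (A : Set (I → ℝ)) := ha
  rw [hA] at this
  simp only [Set.mem_iUnion] at this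
  obtain ⟨P, hP, ha⟩ := this
  rw [← hcov]
  exact ⟨P, hP, ha.1⟩

/-- Every mixed action `p` is an average `∑ a, x a • a` of elements of `A` such that `mbar p b`
contains (and even equals) the corresponding average of the sets `mbar a b`. -/
theorem IsActionVertexSet.exists_weights (hA : G.IsActionVertexSet B A)
    (hB : (B : Set (EuclideanSpace ℝ (I × S))) ⊆ G.feasible) {p : I → ℝ}
    (hp : p ∈ stdSimplex ℝ I) :
    ∃ x ∈ stdSimplex ℝ A, ∀ b ∈ B, ∀ z : A → EuclideanSpace ℝ (Fin d),
      (∀ a : A, z a ∈ G.mbar a b) → ∑ a, x a • z a ∈ G.mbar p b := by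
  classical
  obtain ⟨𝒬, -, hpoly, hcov, hlin, hA⟩ := hA
  rw [← hcov] at hp
  obtain ⟨P, hP, hpP⟩ := hp
  have hext : (P.extremePoints ℝ) ⊆ A := by
    rw [hA]
    exact Set.subset_biUnion_of_mem hP
  set t : Finset (I → ℝ) := A.filter (· ∈ P.extremePoints ℝ) with ht
  have htcoe : (t : Set (I → ℝ)) = P.extremePoints ℝ := by
    ext a
    simp only [ht, Finset.coe_filter, Set.mem_ofPred_eq, and_iff_right_iff_imp]
    exact fun h => hext h
  have htA : t ⊆ A := Finset.filter_subset _ _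
  rw [← (hpoly P hP).convexHull_extremePoints, ← htcoe] at hpP
  obtain ⟨w, hw, hw1, rfl⟩ := Finset.mem_convexHull'.1 hpP
  have hsum : ∀ {V : Type} [AddCommGroup V] [Module ℝ V] (z : A → V) (z' : (I → ℝ) → V),
      (∀ a : A, z a = z' a) →
      ∑ a : A, (if (a : I → ℝ) ∈ t then w a else 0) • z a = ∑ a ∈ t, w a • z' a := by
    intro V _ _ z z' hz
    simp only [hz]
    rw [Finset.sum_coe_sort A fun a => (if a ∈ t then w a else 0) • z' a,
      ← Finset.sum_subset htA fun a _ ha => by rw [if_neg ha, zero_smul]]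
    exact Finset.sum_congr rfl fun a ha => by rw [if_pos ha]
  refine ⟨fun a => if (a : I → ℝ) ∈ t then w a else 0, ⟨fun a => ?_, ?_⟩, fun b hb z hz => ?_⟩
  · dsimp only
    split_ifs with h
    exacts [hw _ h, le_rfl]
  · simpa [hw1] using hsum (fun _ => (1 : ℝ)) (fun _ => 1) fun _ => rfl
  · obtain ⟨z', hzA⟩ : ∃ z' : (I → ℝ) → EuclideanSpace ℝ (Fin d), ∀ a : A, z a = z' a :=
      ⟨fun a => if h : a ∈ A then z ⟨a, h⟩ else 0, fun a => by simp⟩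
    have hz' : ∀ a ∈ t, z' a ∈ G.mbar a b := fun a ha => hzA ⟨a, htA ha⟩ ▸ hz ⟨a, htA ha⟩
    have hPt : ∀ a ∈ t, a ∈ P := fun a ha => by
      have : a ∈ (t : Set (I → ℝ)) := ha
      rw [htcoe] at this
      exact this.1
    have key := ((hlin b hb P hP).mem_sum_iff (hpoly P hP).convex
      (fun x _ => G.mbar_nonempty x (hB hb)) t w (fun a => a) hw hw1 hPt
      (∑ a ∈ t, w a • z' a)).2 ⟨z', hz', rfl⟩
    rw [hsum z z' hzA]
    exact key

theorem IsActionVertexSet.nonempty [Nonempty I] (hA : G.IsActionVertexSet B A)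
    (hB : (B : Set (EuclideanSpace ℝ (I × S))) ⊆ G.feasible) : Nonempty A := by
  classical
  obtain ⟨x, hx, -⟩ := hA.exists_weights hB (single_mem_stdSimplex ℝ (Classical.arbitrary I))
  by_contra h
  rw [not_nonempty_iff] at h
  simpa using hx.2

/-! ### The lifted game -/

section ProductDist

variable {X Y : Type*} [Fintype X] [Fintype Y]

theorem productDist_mem_stdSimplex {x : X → ℝ} {y : Y → ℝ} (hx : x ∈ stdSimplex ℝ X)
    (hy : y ∈ stdSimplex ℝ Y) : (fun z => productDist x y z) ∈ stdSimplex ℝ (X × Y) := by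
  refine ⟨fun z => mul_nonneg (hx.1 _) (hy.1 _), ?_⟩
  rw [Fintype.sum_prod_type]
  simp only [productDist, ← Finset.mul_sum, hy.2, mul_one, hx.2]

theorem inner_productDist (g : EuclideanSpace ℝ (X × Y)) (x : X → ℝ) (y : Y → ℝ) :
    inner ℝ g (productDist x y) = ∑ b, y b * ∑ a, x a * g (a, b) := by
  simp only [PiLp.inner_apply, Fintype.sum_prod_type, productDist, Finset.mul_sum]
  rw [Finset.sum_comm]
  refine Finset.sum_congr rfl fun b _ => Finset.sum_congr rfl fun a _ => ?_
  simp only [RCLike.inner_apply, conj_trivial]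
  ring

theorem norm_sub_sq_le_two_of_mem_stdSimplex {Z : Type*} [Fintype Z] {u v : EuclideanSpace ℝ Z}
    (hu : (fun z => u z) ∈ stdSimplex ℝ Z) (hv : (fun z => v z) ∈ stdSimplex ℝ Z) :
    ‖u - v‖ ^ 2 ≤ 2 := by
  have key : ∀ w : EuclideanSpace ℝ Z, (fun z => w z) ∈ stdSimplex ℝ Z → ‖w‖ ^ 2 ≤ 1 := by
    intro w hw
    rw [EuclideanSpace.norm_sq_eq, ← hw.2]
    refine Finset.sum_le_sum fun z _ => ?_
    have h0 := hw.1 z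
    have h1 : w z ≤ 1 := by
      have := Finset.single_le_sum (f := fun z => w z) (fun z _ => hw.1 z) (Finset.mem_univ z)
      rw [← hw.2]
      exact this
    rw [Real.norm_of_nonneg h0]
    nlinarith
  have hin : 0 ≤ inner ℝ u v := by
    rw [PiLp.inner_apply]
    exact Finset.sum_nonneg fun z _ => mul_nonneg (hv.1 z) (hu.1 z)
  rw [norm_sub_sq_real]
  linarith [key u hu, key v hv]

theorem bddAbove_inner_productDist (g : EuclideanSpace ℝ (X × Y)) (x : X → ℝ) :
    BddAbove (Set.range fun y : stdSimplex ℝ Y => inner ℝ g (productDist x (y : Y → ℝ))) := by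
  have := isCompact_iff_compactSpace.1 (isCompact_stdSimplex ℝ Y)
  refine (isCompact_range ?_).bddAbove
  simp only [inner_productDist]
  exact continuous_finsetSum _ fun b _ =>
    ((continuous_apply b).comp continuous_subtype_val).mul continuous_const

/-- A mixed action of the first player that minimizes the worst case exists. -/
theorem exists_isMinOn_iSup_inner_productDist [Nonempty X] (g : EuclideanSpace ℝ (X × Y)) :
    ∃ x ∈ stdSimplex ℝ X, IsMinOn (fun x : X → ℝ => ⨆ y : stdSimplex ℝ Y,
      inner ℝ g (productDist x (y : Y → ℝ))) (stdSimplex ℝ X) x := by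
  classical
  refine LowerSemicontinuousOn.exists_isMinOn
    ⟨_, single_mem_stdSimplex ℝ (Classical.arbitrary X)⟩ (isCompact_stdSimplex ℝ X) ?_
  refine (lowerSemicontinuous_ciSup (bddAbove_inner_productDist g)
    fun y => Continuous.lowerSemicontinuous ?_).lowerSemicontinuousOn _
  simp only [inner_productDist]
  fun_prop

end ProductDist

theorem isClosed_liftedTarget (hC : IsClosed C) : IsClosed (G.liftedTarget C A B) := by
  have : G.liftedTarget C A B = {μ | (fun ab => μ ab) ∈ stdSimplex ℝ (A × B)} ∩
      ⋂ z ∈ {z : A × B → EuclideanSpace ℝ (Fin d) | ∀ ab, z ab ∈ G.mbar ab.1 ab.2},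
        {μ | ∑ ab, μ ab • z ab ∈ C} := by
    ext μ
    simp only [liftedTarget, lifted, Set.mem_ofPred_eq, Set.mem_inter_iff, Set.mem_iInter]
    refine and_congr_right fun _ => ⟨fun h z hz => h ⟨z, hz, rfl⟩, ?_⟩
    rintro h _ ⟨z, hz, rfl⟩
    exact h z hz
  rw [this]
  refine IsClosed.inter ?_ (isClosed_biInter fun z _ => ?_)
  · exact (isClosed_stdSimplex ℝ (A × B)).preimage (by fun_prop)
  · exact hC.preimage (by fun_prop)

theorem convex_liftedTarget (hC : Convex ℝ C) : Convex ℝ (G.liftedTarget C A B) := by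
  rintro μ ⟨hμ, hμC⟩ μ' ⟨hμ', hμC'⟩ a b ha hb hab
  refine ⟨convex_stdSimplex ℝ (A × B) hμ hμ' ha hb hab, ?_⟩
  rintro _ ⟨z, hz, rfl⟩
  have := hC (hμC ⟨z, hz, rfl⟩) (hμC' ⟨z, hz, rfl⟩) ha hb hab
  simpa [add_smul, Finset.sum_add_distrib, Finset.smul_sum, smul_smul] using this

/-- Condition (APM) transfers to the lifted game: the first player has a reply to each mixed action
`y ∈ Δ(B)`. -/
theorem exists_productDist_mem_liftedTarget (hAPM : G.APM C) (hA : G.IsActionVertexSet B A)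
    (hB : (B : Set (EuclideanSpace ℝ (I × S))) ⊆ G.feasible) {y : B → ℝ}
    (hy : y ∈ stdSimplex ℝ B) :
    ∃ x ∈ stdSimplex ℝ A, productDist x y ∈ G.liftedTarget C A B := by
  have hσ : ∑ b, y b • (b : EuclideanSpace ℝ (I × S)) ∈ G.feasible :=
    G.convex_feasible.sum_mem (fun b _ => hy.1 b) hy.2 fun b _ => hB b.2
  obtain ⟨p, hp, hpC⟩ := hAPM _ hσ
  obtain ⟨x, hx, hxp⟩ := hA.exists_weights hB hp
  refine ⟨x, hx, productDist_mem_stdSimplex hx hy, ?_⟩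
  rintro _ ⟨z, hz, rfl⟩
  refine hpC ?_
  have h1 : ∑ ab : A × B, productDist x y ab • z ab
      = ∑ b, y b • ∑ a, x a • z (a, b) := by
    rw [Fintype.sum_prod_type_right]
    simp only [productDist, Finset.smul_sum, smul_smul, mul_comm]
  rw [h1]
  exact G.sum_mem_mbar Finset.univ y (fun b _ => hy.1 b) hy.2 p _ _
    fun b _ => hxp b b.2 _ fun a => hz (a, b)

theorem liftedTarget_nonempty [Nonempty J] (hAPM : G.APM C) (hA : G.IsActionVertexSet B A)
    (hBΦ : G.IsSignalTriangulation B Φ) : (G.liftedTarget C A B).Nonempty := by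
  classical
  have := hBΦ.nonempty
  obtain ⟨x, -, h⟩ := exists_productDist_mem_liftedTarget hAPM hA hBΦ.subset_feasible
    (single_mem_stdSimplex ℝ (Classical.arbitrary B))
  exact ⟨_, h⟩

/-- The set `lifted μ` is a Lipschitz function of `μ`. -/
theorem exists_mem_lifted_norm_sub_le (hA : G.IsActionVertexSet B A)
    {μ : EuclideanSpace ℝ (A × B)} {v : EuclideanSpace ℝ (Fin d)} (hv : v ∈ G.lifted A B μ)
    (μ' : EuclideanSpace ℝ (A × B)) :
    ∃ v' ∈ G.lifted A B μ',
      ‖v - v'‖ ≤ G.payoffBound * √((A.card : ℝ) * B.card) * ‖μ - μ'‖ := by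
  obtain ⟨z, hz, rfl⟩ := hv
  refine ⟨_, ⟨z, hz, rfl⟩, ?_⟩
  rw [← Finset.sum_sub_distrib]
  calc ‖∑ ab, (μ ab • z ab - μ' ab • z ab)‖
      ≤ ∑ ab, |(μ - μ') ab| * G.payoffBound := by
        refine norm_sum_le_of_le _ fun ab _ => ?_
        rw [← sub_smul, norm_smul]
        exact mul_le_mul_of_nonneg_left
          (G.norm_le_of_mem_mbar (hA.subset_stdSimplex ab.1.2) (hz ab)) (abs_nonneg _)
    _ ≤ √(Fintype.card (A × B)) * ‖μ - μ'‖ * G.payoffBound := by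
        rw [← Finset.sum_mul]
        exact mul_le_mul_of_nonneg_right (EuclideanSpace.sum_abs_le_sqrt_card_mul_norm _)
          G.payoffBound_nonneg
    _ = _ := by
        rw [Fintype.card_prod, Fintype.card_coe, Fintype.card_coe]
        push_cast
        ring

/-! ### Blackwell's strategy -/

theorem exists_isRobustBlackwell [Nonempty A] : ∃ Ψ, G.IsRobustBlackwell C A B Ψ := by
  choose Ψ h1 h2 using fun l : List ((A → ℝ) × (B → ℝ)) =>
    exists_isMinOn_iSup_inner_productDist
      (averageDist l - nearestPoint (G.liftedTarget C A B) (averageDist l))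
  exact ⟨Ψ, fun l _ => ⟨h1 l, fun _ => h2 l⟩⟩

variable {Ψ : List ((A → ℝ) × (B → ℝ)) → A → ℝ}

/-- Blackwell's condition. It follows from the minimax theorem, since the first player has a reply
to each `y` for which `x ⊗ y` lies in the target set. -/
theorem IsRobustBlackwell.inner_nonpos [Nonempty I] [Nonempty J]
    (hΨ : G.IsRobustBlackwell C A B Ψ)
    (hclosed : IsClosed C) (hconvex : Convex ℝ C) (hAPM : G.APM C)
    (hA : G.IsActionVertexSet B A) (hBΦ : G.IsSignalTriangulation B Φ)
    {l : List ((A → ℝ) × (B → ℝ))} (hl : ∀ z ∈ l, z.1 ∈ stdSimplex ℝ A ∧ z.2 ∈ stdSimplex ℝ B)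
    (hne : l ≠ []) {y : B → ℝ} (hy : y ∈ stdSimplex ℝ B) :
    inner ℝ (averageDist l - nearestPoint (G.liftedTarget C A B) (averageDist l))
      (productDist (Ψ l) y - nearestPoint (G.liftedTarget C A B) (averageDist l)) ≤ 0 := by
  set c := nearestPoint (G.liftedTarget C A B) (averageDist l) with hc
  set g := averageDist l - c with hg
  have := hA.nonempty hBΦ.subset_feasible
  have hmm : ∃ x ∈ stdSimplex ℝ A, ∀ b : B, ∑ a, x a * g (a, b) ≤ inner ℝ g c := by
    refine exists_forall_sum_mul_le_of_minimax (fun a b => g (a, b)) _ fun y hy => ?_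
    obtain ⟨x, hx, hxy⟩ := exists_productDist_mem_liftedTarget hAPM hA hBΦ.subset_feasible hy
    refine ⟨x, hx, ?_⟩
    rw [← inner_productDist]
    have := inner_sub_nearestPoint_nonpos (liftedTarget_nonempty hAPM hA hBΦ)
      (isClosed_liftedTarget hclosed) (convex_liftedTarget hconvex) (averageDist l) hxy
    rw [← hc, ← hg, inner_sub_right] at this
    linarith
  obtain ⟨x, hx, hxb⟩ := hmm
  have hx' : (⨆ y : stdSimplex ℝ B, inner ℝ g (productDist x (y : B → ℝ))) ≤ inner ℝ g c := by
    have : Nonempty (stdSimplex ℝ B) := ⟨⟨y, hy⟩⟩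
    refine ciSup_le fun ⟨y, hy⟩ => ?_
    rw [inner_productDist]
    calc ∑ b, y b * ∑ a, x a * g (a, b) ≤ ∑ b, y b * inner ℝ g c :=
          Finset.sum_le_sum fun b _ => mul_le_mul_of_nonneg_left (hxb b) (hy.1 b)
      _ = inner ℝ g c := by rw [← Finset.sum_mul, hy.2, one_mul]
  have h1 := ((hΨ l hl).2 hne) hx
  have h2 := le_ciSup (bddAbove_inner_productDist g (Ψ l)) ⟨y, hy⟩
  rw [inner_sub_right]
  have h3 : inner ℝ g (productDist (Ψ l) y) ≤ inner ℝ g c := h2.trans (le_trans h1 hx')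
  linarith

theorem averageDist_append_singleton {X Y : Type*} (l : List ((X → ℝ) × (Y → ℝ))) (x : X → ℝ)
    (y : Y → ℝ) : ((l.length : ℝ) + 1) • averageDist (l ++ [(x, y)])
      = (l.length : ℝ) • averageDist l + productDist x y := by
  have h1 : (l.length : ℝ) + 1 ≠ 0 := by positivity
  simp only [averageDist, List.length_append, List.length_singleton, List.map_append,
    List.map_cons, List.map_nil, List.sum_append, List.sum_cons, List.sum_nil, add_zero,
    Nat.cast_add, Nat.cast_one]
  rw [smul_inv_smul₀ h1]
  congr 1
  rcases eq_or_ne l [] with rfl | hl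
  · simp
  · rw [smul_inv_smul₀]
    exact_mod_cast (List.length_pos_iff.2 hl).ne'

/-- Blackwell's theorem: along a sequence generated by the strategy, the distance of the average
to the target set is at most `√(2 / n)`. -/
theorem IsRobustBlackwell.sq_mul_norm_sq_le [Nonempty I] [Nonempty J]
    (hΨ : G.IsRobustBlackwell C A B Ψ)
    (hclosed : IsClosed C) (hconvex : Convex ℝ C) (hAPM : G.APM C)
    (hA : G.IsActionVertexSet B A) (hBΦ : G.IsSignalTriangulation B Φ)
    (l : ℕ → List ((A → ℝ) × (B → ℝ))) (y : ℕ → B → ℝ) (hy : ∀ n, y n ∈ stdSimplex ℝ B)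
    (h0 : l 0 = []) (hl : ∀ n, l (n + 1) = l n ++ [(Ψ (l n), y n)]) (n : ℕ) :
    (l n).length = n ∧ (∀ z ∈ l n, z.1 ∈ stdSimplex ℝ A ∧ z.2 ∈ stdSimplex ℝ B) ∧
      (n : ℝ) ^ 2 * ‖averageDist (l n) -
        nearestPoint (G.liftedTarget C A B) (averageDist (l n))‖ ^ 2 ≤ 2 * n := by
  induction n with
  | zero => simp [h0]
  | succ n ih =>
    obtain ⟨hlen, hmem, hn⟩ := ih
    have hθ := (hΨ (l n) hmem).1
    have hTne := liftedTarget_nonempty (A := A) hAPM hA hBΦ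
    have hTcl := isClosed_liftedTarget (G := G) (A := A) (B := B) hclosed
    refine ⟨by rw [hl, List.length_append, hlen, List.length_singleton], ?_, ?_⟩
    · intro z hz
      rw [hl, List.mem_append, List.mem_singleton] at hz
      rcases hz with hz | rfl
      exacts [hmem z hz, ⟨hθ, hy n⟩]
    have havg := averageDist_append_singleton (l n) (Ψ (l n)) (y n)
    rw [← hl, hlen] at havg
    set ν := averageDist (l n)
    set ν' := averageDist (l (n + 1))
    set c := nearestPoint (G.liftedTarget C A B) ν with hc
    set e := productDist (Ψ (l n)) (y n)
    have hcT : c ∈ G.liftedTarget C A B := nearestPoint_mem hTne hTcl ν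
    have h1 : ‖ν' - nearestPoint (G.liftedTarget C A B) ν'‖ ≤ ‖ν' - c‖ :=
      (nearestPoint_spec hTne hTcl ν').2 c hcT
    have h2 : ((n : ℝ) + 1) • (ν' - c) = (n : ℝ) • (ν - c) + (e - c) := by
      rw [smul_sub, havg, add_smul, one_smul, smul_sub]
      abel
    have h3 : ((n : ℝ) + 1) ^ 2 * ‖ν' - c‖ ^ 2 = (n : ℝ) ^ 2 * ‖ν - c‖ ^ 2
        + 2 * (n * inner ℝ (ν - c) (e - c)) + ‖e - c‖ ^ 2 := by
      rw [← abs_of_nonneg (show (0 : ℝ) ≤ (n : ℝ) + 1 by positivity), ← Real.norm_eq_abs,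
        ← mul_pow, ← norm_smul, h2, norm_add_sq_real, norm_smul, Real.norm_natCast,
        real_inner_smul_left, mul_pow]
    have h4 : ‖e - c‖ ^ 2 ≤ 2 :=
      norm_sub_sq_le_two_of_mem_stdSimplex (productDist_mem_stdSimplex hθ (hy n)) hcT.1
    have h5 : (n : ℝ) * inner ℝ (ν - c) (e - c) ≤ 0 := by
      rcases Nat.eq_zero_or_pos n with rfl | hn0
      · simp
      · refine mul_nonpos_of_nonneg_of_nonpos (by positivity) ?_
        refine hΨ.inner_nonpos hclosed hconvex hAPM hA hBΦ hmem ?_ (hy n)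
        rw [← List.length_pos_iff, hlen]
        exact hn0
    have h6 := pow_le_pow_left₀ (norm_nonneg _) h1 2
    have h7 := mul_le_mul_of_nonneg_left h6 (sq_nonneg ((n : ℝ) + 1))
    push_cast
    linarith

end MonitoringGame

theorem Convex.exists_sum_smul_eq {V ι : Type*} [AddCommGroup V] [Module ℝ V] {K : Set V}
    (hK : Convex ℝ K) (hne : K.Nonempty) (t : Finset ι) (w : ι → ℝ) (hw : ∀ i ∈ t, 0 ≤ w i)
    (v : ι → V) (hv : ∀ i ∈ t, v i ∈ K) :
    ∃ z ∈ K, (∑ i ∈ t, w i) • z = ∑ i ∈ t, w i • v i := by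
  rcases (Finset.sum_nonneg hw).eq_or_lt with h0 | hpos
  · obtain ⟨z, hz⟩ := hne
    refine ⟨z, hz, ?_⟩
    rw [← h0, zero_smul, Finset.sum_eq_zero]
    intro i hi
    rw [(Finset.sum_eq_zero_iff_of_nonneg hw).1 h0.symm i hi, zero_smul]
  · refine ⟨t.centerMass w v, hK.centerMass_mem hw hpos hv, ?_⟩
    rw [Finset.centerMass, smul_inv_smul₀ hpos.ne']

namespace MonitoringGame

variable {I J S : Type*} [Fintype I] [Fintype J] [Fintype S] [Nonempty I] [Nonempty J] {d : ℕ}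
  {G : MonitoringGame I J S d} {B : Finset (EuclideanSpace ℝ (I × S))}
  {Φ : EuclideanSpace ℝ (I × S) → EuclideanSpace ℝ B} {A : Finset (I → ℝ)}
  {C : Set (EuclideanSpace ℝ (Fin d))} {Ψ : List ((A → ℝ) × (B → ℝ)) → A → ℝ}

theorem sum_smul_mem_stdSimplex (hA : G.IsActionVertexSet B A) {θ : A → ℝ}
    (hθ : θ ∈ stdSimplex ℝ A) : ∑ a, θ a • (a : I → ℝ) ∈ stdSimplex ℝ I :=
  (convex_stdSimplex ℝ I).sum_mem (fun a _ => hθ.1 a) hθ.2 fun a _ => hA.subset_stdSimplex a.2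

/-- The payoffs of the mixed actions `θ_n` against `q_n` are close to `C` on average, if the
strategy observes sufficiently precise approximations `y_n` of the barycentric coordinates of the
signals of `q_n`: with `y_n` in the place of these coordinates the average payoff would be an
element of the set `lifted ν`. -/
theorem infDist_average_payoff_le (hΨ : G.IsRobustBlackwell C A B Ψ)
    (hclosed : IsClosed C) (hconvex : Convex ℝ C) (hAPM : G.APM C)
    (hA : G.IsActionVertexSet B A) (hBΦ : G.IsSignalTriangulation B Φ)
    (l : ℕ → List ((A → ℝ) × (B → ℝ))) (y : ℕ → B → ℝ) (hy : ∀ n, y n ∈ stdSimplex ℝ B)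
    (h0 : l 0 = []) (hl : ∀ n, l (n + 1) = l n ++ [(Ψ (l n), y n)]) (q : ℕ → J → ℝ)
    {N : ℕ} (hN : 0 < N) (hq : ∀ n < N, q n ∈ stdSimplex ℝ J) {e : ℝ}
    (he : ∀ n < N, ∑ b, |Φ (G.signals (q n)) b - y n b| ≤ e) :
    Metric.infDist ((N : ℝ)⁻¹ • ∑ n ∈ Finset.range N,
        G.payoff (∑ a, Ψ (l n) a • (a : I → ℝ)) (q n)) C
      ≤ G.payoffBound * e + G.payoffBound * √((A.card : ℝ) * B.card) * √(2 / N) := by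
  have hN' : (0 : ℝ) < N := by exact_mod_cast hN
  have hbw := hΨ.sq_mul_norm_sq_le hclosed hconvex hAPM hA hBΦ l y hy h0 hl
  have hθ : ∀ n, Ψ (l n) ∈ stdSimplex ℝ A := fun n => (hΨ (l n) (hbw n).2.1).1
  have havg : ∀ n : ℕ, (n : ℝ) • averageDist (l n)
      = ∑ m ∈ Finset.range n, productDist (Ψ (l m)) (y m) := by
    intro n
    induction n with
    | zero => simp
    | succ n ih =>
      have := averageDist_append_singleton (l n) (Ψ (l n)) (y n)
      rw [← hl, (hbw n).1] at this
      rw [Finset.sum_range_succ, ← ih, ← this, Nat.cast_succ]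
  choose! z hz hqz using fun n hn => hBΦ.exists_fiber_decomposition (hq n hn)
  have hv : ∀ n < N, ∀ (a : A) (b : B), G.payoff a (z n b) ∈ G.mbar a b := fun n hn a b =>
    ⟨z n b, (hz n hn b).1, (hz n hn b).2, rfl⟩
  have hmem : (N : ℝ)⁻¹ • ∑ n ∈ Finset.range N, ∑ a, ∑ b, (Ψ (l n) a * y n b) •
      G.payoff (a : I → ℝ) (z n b) ∈ G.lifted A B (averageDist (l N)) := by
    have hex : ∀ ab : A × B, ∃ w ∈ G.mbar ab.1 ab.2,
        averageDist (l N) ab • w = (N : ℝ)⁻¹ • ∑ n ∈ Finset.range N,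
          (Ψ (l n) ab.1 * y n ab.2) • G.payoff (ab.1 : I → ℝ) (z n ab.2) := by
      intro ab
      obtain ⟨w, hw, hsum⟩ := (G.convex_mbar ab.1 ab.2).exists_sum_smul_eq
        (G.mbar_nonempty _ (hBΦ.subset_feasible ab.2.2)) (Finset.range N)
        (fun n => Ψ (l n) ab.1 * y n ab.2)
        (fun n _ => mul_nonneg ((hθ n).1 _) ((hy n).1 _))
        (fun n => G.payoff (ab.1 : I → ℝ) (z n ab.2)) (fun n hn => hv n (Finset.mem_range.1 hn) _ _)
      refine ⟨w, hw, ?_⟩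
      rw [← hsum, smul_smul]
      congr 1
      have := congrArg (fun u : EuclideanSpace ℝ (A × B) => u ab) (havg N)
      simp only [PiLp.smul_apply, smul_eq_mul, WithLp.ofLp_sum, Finset.sum_apply] at this
      rw [eq_inv_mul_iff_mul_eq₀ hN'.ne', this]
      rfl
    choose w hw hsum using hex
    refine ⟨w, hw, ?_⟩
    simp only [hsum]
    rw [← Finset.smul_sum, Finset.sum_comm (t := Finset.range N)]
    simp only [Fintype.sum_prod_type]
  obtain ⟨v', hv', hdist⟩ := exists_mem_lifted_norm_sub_le hA hmem
    (nearestPoint (G.liftedTarget C A B) (averageDist (l N)))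
  have hTne := liftedTarget_nonempty (A := A) hAPM hA hBΦ
  have hTcl := isClosed_liftedTarget (G := G) (A := A) (B := B) hclosed
  have hv'C : v' ∈ C := (nearestPoint_mem hTne hTcl _).2 hv'
  have hrate : ‖averageDist (l N) - nearestPoint (G.liftedTarget C A B) (averageDist (l N))‖
      ≤ √(2 / N) := by
    refine Real.le_sqrt_of_sq_le ?_
    rw [le_div_iff₀ hN']
    have := (hbw N).2.2
    rw [sq (N : ℝ), mul_assoc, mul_comm (2 : ℝ)] at this
    have := le_of_mul_le_mul_left this hN'
    linarith
  refine (Metric.infDist_le_dist_of_mem hv'C).trans ?_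
  rw [dist_eq_norm]
  have hpay : ∀ n < N, G.payoff (∑ a, Ψ (l n) a • (a : I → ℝ)) (q n) = ∑ a, ∑ b,
      (Ψ (l n) a * Φ (G.signals (q n)) b) • G.payoff (a : I → ℝ) (z n b) := by
    intro n hn
    rw [payoff_sum_left]
    refine Finset.sum_congr rfl fun a _ => ?_
    conv_lhs => rw [hqz n hn]
    rw [payoff_sum_right, Finset.smul_sum]
    exact Finset.sum_congr rfl fun b _ => by rw [smul_smul]
  have hclose : ‖(N : ℝ)⁻¹ • ∑ n ∈ Finset.range N,
      G.payoff (∑ a, Ψ (l n) a • (a : I → ℝ)) (q n) - (N : ℝ)⁻¹ • ∑ n ∈ Finset.range N,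
      ∑ a, ∑ b, (Ψ (l n) a * y n b) • G.payoff (a : I → ℝ) (z n b)‖ ≤ G.payoffBound * e := by
    rw [← smul_sub, ← Finset.sum_sub_distrib, norm_smul, norm_inv, Real.norm_natCast,
      inv_mul_le_iff₀ hN']
    have : ∀ n ∈ Finset.range N, ‖G.payoff (∑ a, Ψ (l n) a • (a : I → ℝ)) (q n)
        - ∑ a, ∑ b, (Ψ (l n) a * y n b) • G.payoff (a : I → ℝ) (z n b)‖
        ≤ G.payoffBound * e := by
      intro n hn
      rw [hpay n (Finset.mem_range.1 hn), ← Finset.sum_sub_distrib]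
      calc _ ≤ ∑ a : A, Ψ (l n) a * (e * G.payoffBound) := by
            refine norm_sum_le_of_le _ fun a _ => ?_
            rw [← Finset.sum_sub_distrib]
            calc _ ≤ ∑ b : B, Ψ (l n) a * (|Φ (G.signals (q n)) b - y n b| * G.payoffBound) := by
                  refine norm_sum_le_of_le _ fun b _ => ?_
                  rw [← sub_smul, ← mul_sub, norm_smul, norm_mul, mul_assoc,
                    Real.norm_of_nonneg ((hθ n).1 a)]
                  exact mul_le_mul_of_nonneg_left (mul_le_mul_of_nonneg_left
                    (G.norm_le_of_mem_mbar (hA.subset_stdSimplex a.2)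
                      (hv n (Finset.mem_range.1 hn) a b))
                    (norm_nonneg _)) ((hθ n).1 a)
              _ ≤ _ := by
                  rw [← Finset.mul_sum, ← Finset.sum_mul]
                  exact mul_le_mul_of_nonneg_left (mul_le_mul_of_nonneg_right
                    (he n (Finset.mem_range.1 hn)) G.payoffBound_nonneg) ((hθ n).1 a)
        _ = G.payoffBound * e := by
            rw [← Finset.sum_mul, (hθ n).2, one_mul, mul_comm]
    refine (norm_sum_le_of_le _ this).trans (le_of_eq ?_)
    rw [Finset.sum_const, Finset.card_range, nsmul_eq_mul]
  refine (norm_sub_le_norm_sub_add_norm_sub _ _ _).trans (add_le_add hclose (hdist.trans ?_))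
  exact mul_le_mul_of_nonneg_left hrate (mul_nonneg G.payoffBound_nonneg (Real.sqrt_nonneg _))

/-! ### Blocks of rounds -/

theorem sum_univ_castLE {M : Type*} [AddCommMonoid M] {t T : ℕ} (h : t ≤ T) (f : Fin T → M)
    (hf : ∀ s : Fin T, t ≤ s → f s = 0) : ∑ s : Fin t, f (Fin.castLE h s) = ∑ s, f s := by
  have : ∑ s : Fin t, f (Fin.castLE h s) = ∑ s ∈ Finset.univ.map (Fin.castLEEmb h), f s := by
    rw [Finset.sum_map]
    rfl
  rw [this]
  refine Finset.sum_subset (Finset.subset_univ _) fun s _ hs => hf s ?_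
  by_contra! hlt
  exact hs (Finset.mem_map.2 ⟨⟨s, hlt⟩, Finset.mem_univ _, rfl⟩)

/-- The rounds of block `n`. -/
def block (L T n : ℕ) : Finset (Fin T) := Finset.univ.filter fun s => (s : ℕ) / L = n

theorem mem_block {L T n : ℕ} {s : Fin T} : s ∈ block L T n ↔ (s : ℕ) / L = n := by
  simp [block]

theorem div_eq_iff_mem_Ico {L s n : ℕ} (hL : 0 < L) :
    s / L = n ↔ n * L ≤ s ∧ s < (n + 1) * L := by
  rw [← Nat.le_div_iff_mul_le hL, ← Nat.div_lt_iff_lt_mul hL]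
  omega

theorem card_block {L T n : ℕ} (hL : 0 < L) (hn : n < T / L) : (block L T n).card = L := by
  have h1 : (n + 1) * L ≤ T := (Nat.le_div_iff_mul_le hL).1 hn
  have : (block L T n).map Fin.valEmbedding = Finset.Ico (n * L) ((n + 1) * L) := by
    ext s
    simp only [Finset.mem_map, mem_block, Fin.valEmbedding_apply, Finset.mem_Ico]
    constructor
    · rintro ⟨s, hs, rfl⟩
      exact (div_eq_iff_mem_Ico hL).1 hs
    · rintro ⟨h2, h3⟩
      exact ⟨⟨s, h3.trans_le h1⟩, (div_eq_iff_mem_Ico hL).2 ⟨h2, h3⟩, rfl⟩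
  rw [← Finset.card_map Fin.valEmbedding, this, Nat.card_Ico, add_mul, one_mul,
    Nat.add_sub_cancel_left]

theorem sum_block {M : Type*} [AddCommMonoid M] (L T N : ℕ) (f : Fin T → M) :
    ∑ n ∈ Finset.range N, ∑ s ∈ block L T n, f s
      = ∑ s ∈ Finset.univ.filter (fun s : Fin T => (s : ℕ) / L < N), f s := by
  rw [← Finset.sum_fiberwise_of_maps_to (g := fun s : Fin T => (s : ℕ) / L)
    (t := Finset.range N) (fun s hs => by simpa using hs)]
  refine Finset.sum_congr rfl fun n hn => Finset.sum_congr ?_ fun _ _ => rfl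
  ext s
  simp only [mem_block, Finset.mem_filter, Finset.mem_univ, true_and]
  exact ⟨fun h => ⟨h ▸ Finset.mem_range.1 hn, h⟩, fun h => h.2⟩

theorem card_filter_div_lt {L T : ℕ} (hL : 0 < L) :
    (Finset.univ.filter fun s : Fin T => (s : ℕ) / L < T / L).card = T / L * L := by
  have := sum_block L T (T / L) fun _ => 1
  rw [Finset.card_eq_sum_ones, ← this, Finset.sum_congr rfl fun n hn => by
    rw [← Finset.card_eq_sum_ones, card_block hL (Finset.mem_range.1 hn)]]
  simp

/-- The empirical distribution of the actions of the second player in block `n`. -/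
noncomputable def empirical (L : ℕ) {T : ℕ} (ω : Fin T → I × J × S) (n : ℕ) : J → ℝ := by
  classical exact ∑ s ∈ block L T n, (L : ℝ)⁻¹ • Pi.single (ω s).2.1 1

theorem empirical_mem {L T n : ℕ} (hL : 0 < L) (hn : n < T / L) (ω : Fin T → I × J × S) :
    empirical L ω n ∈ stdSimplex ℝ J := by
  classical
  refine (convex_stdSimplex ℝ J).sum_mem (fun s _ => by positivity) ?_
    fun s _ => ?_
  · rw [Finset.sum_const, card_block hL hn, nsmul_eq_mul, mul_inv_cancel₀]
    exact_mod_cast hL.ne'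
  · convert! single_mem_stdSimplex ℝ (ω s).2.1

theorem payoff_empirical [DecidableEq J] (L : ℕ) {T : ℕ} (ω : Fin T → I × J × S) (n : ℕ)
    (p : I → ℝ) : G.payoff p (empirical L ω n)
      = (L : ℝ)⁻¹ • ∑ s ∈ block L T n, G.payoff p (Pi.single (ω s).2.1 1) := by
  rw [empirical, payoff_sum_right, Finset.smul_sum]
  refine Finset.sum_congr rfl fun s _ => ?_
  congr!

theorem signals_empirical (L : ℕ) {T : ℕ} (ω : Fin T → I × J × S) (n : ℕ) (z : I × S) :
    G.signals (empirical L ω n) z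
      = (L : ℝ)⁻¹ * ∑ s ∈ block L T n, G.H z.1 (ω s).2.1 z.2 := by
  classical
  rw [empirical, ← coe_signalsLinear, map_sum, WithLp.ofLp_sum, Finset.sum_apply, Finset.mul_sum]
  refine Finset.sum_congr rfl fun s _ => ?_
  rw [map_smul, PiLp.smul_apply, smul_eq_mul, coe_signalsLinear]
  simp [signals, Pi.single_apply]

/-! ### The play of the block strategy -/

section Play

variable [DecidableEq I] [DecidableEq S]

/-- The history of the first `n` blocks depends only on the rounds of these blocks. -/
theorem blockHistory_castLE {L : ℕ} (hL : 0 < L) (γ : ℝ) {t T : ℕ} (h : t ≤ T)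
    (o : Fin T → I × S) {n : ℕ} (hn : n * L ≤ t) :
    G.blockHistory A B Φ Ψ L γ (fun s : Fin t => o (Fin.castLE h s)) n
      = G.blockHistory A B Φ Ψ L γ o n := by
  induction n with
  | zero => rfl
  | succ n ih =>
    have ih := ih ((Nat.mul_le_mul_right L n.le_succ).trans hn)
    simp only [blockHistory, ih]
    have hest : ∀ p : I → ℝ, estimate L p (fun s : Fin t => o (Fin.castLE h s)) n
        = estimate L p o n := by
      intro p
      ext z
      simp only [estimate]
      congr 1
      refine sum_univ_castLE h (fun s : Fin T => if (s : ℕ) / L = n ∧ (o s).2 = z.2 ∧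
        (o s).1 = z.1 then (p (o s).1)⁻¹ else 0) fun s hs => if_neg fun hs' => ?_
      have h1 : (s : ℕ) < (n + 1) * L := ((div_eq_iff_mem_Ico hL).1 hs'.1).2
      omega
    simp only [hest]

/-- The mixed action used in block `n`. -/
noncomputable def blockAction (G : MonitoringGame I J S d) (A : Finset (I → ℝ))
    (B : Finset (EuclideanSpace ℝ (I × S))) (Φ : EuclideanSpace ℝ (I × S) → EuclideanSpace ℝ B)
    (Ψ : List ((A → ℝ) × (B → ℝ)) → A → ℝ) (L : ℕ) (γ : ℝ) {T : ℕ} (o : Fin T → I × S) (n : ℕ) :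
    I → ℝ :=
  explore A γ (Ψ (G.blockHistory A B Φ Ψ L γ o n))

theorem blockStrategy_castLE {L : ℕ} (hL : 0 < L) (γ : ℝ) {T : ℕ} (t : Fin T)
    (ω : Fin T → I × J × S) : G.blockStrategy A B Φ Ψ L γ t
      (observed fun s => ω (Fin.castLE t.isLt.le s))
      = G.blockAction A B Φ Ψ L γ (observed ω) (t / L) := by
  rw [blockStrategy, blockAction]
  congr 2
  exact blockHistory_castLE hL γ t.isLt.le (observed ω) (Nat.div_mul_le_self _ _)

theorem explore_mem (hA : G.IsActionVertexSet B A) {θ : A → ℝ} (hθ : θ ∈ stdSimplex ℝ A) {γ : ℝ}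
    (hγ0 : 0 ≤ γ) (hγ1 : γ ≤ 1) : explore A γ θ ∈ stdSimplex ℝ I := by
  have hx := sum_smul_mem_stdSimplex hA hθ
  have hu : (fun _ : I => (Fintype.card I : ℝ)⁻¹) ∈ stdSimplex ℝ I :=
    ⟨fun _ => by positivity, by simp⟩
  have := convex_stdSimplex ℝ I hx hu (sub_nonneg.2 hγ1) hγ0 (by ring)
  convert! this using 1
  ext i
  simp [explore, Finset.sum_apply]

theorem le_explore (hA : G.IsActionVertexSet B A) {θ : A → ℝ} (hθ : θ ∈ stdSimplex ℝ A) {γ : ℝ}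
    (hγ1 : γ ≤ 1) (i : I) : γ * (Fintype.card I : ℝ)⁻¹ ≤ explore A γ θ i := by
  have hx := (sum_smul_mem_stdSimplex hA hθ).1 i
  simp only [Finset.sum_apply, Pi.smul_apply, smul_eq_mul] at hx
  have := mul_nonneg (sub_nonneg.2 hγ1) hx
  rw [explore]
  linarith

theorem norm_payoff_explore_sub_le (hA : G.IsActionVertexSet B A) {θ : A → ℝ}
    (hθ : θ ∈ stdSimplex ℝ A) {γ : ℝ} (hγ0 : 0 ≤ γ) {q : J → ℝ} (hq : q ∈ stdSimplex ℝ J) :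
    ‖G.payoff (explore A γ θ) q - G.payoff (∑ a, θ a • (a : I → ℝ)) q‖
      ≤ 2 * γ * G.payoffBound := by
  have hx := sum_smul_mem_stdSimplex hA hθ
  rw [← payoff_sub_left]
  refine (G.norm_payoff_le _ _).trans (mul_le_mul_of_nonneg_right ?_ G.payoffBound_nonneg)
  simp only [abs_of_nonneg (hq.1 _), hq.2, mul_one]
  calc _ ≤ ∑ i, (γ * (∑ a, θ a • (a : I → ℝ)) i + γ * (Fintype.card I : ℝ)⁻¹) := by
        refine Finset.sum_le_sum fun i _ => ?_
        have h0 := mul_nonneg hγ0 (hx.1 i)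
        have h1 : 0 ≤ γ * (Fintype.card I : ℝ)⁻¹ := by positivity
        have h2 : (explore A γ θ - ∑ a, θ a • (a : I → ℝ)) i
            = γ * (Fintype.card I : ℝ)⁻¹ - γ * (∑ a, θ a • (a : I → ℝ)) i := by
          simp only [explore, Pi.sub_apply, Finset.sum_apply, Pi.smul_apply, smul_eq_mul]
          ring
        rw [h2, abs_le]
        constructor <;> linarith
    _ = 2 * γ := by
        rw [Finset.sum_add_distrib, ← Finset.mul_sum, hx.2]
        have : (Fintype.card I : ℝ) ≠ 0 := by exact_mod_cast Fintype.card_ne_zero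
        simp only [Finset.sum_const, Finset.card_univ, nsmul_eq_mul]
        field_simp
        ring

theorem blockHistory_spec (hΨ : G.IsRobustBlackwell C A B Ψ) (hBΦ : G.IsSignalTriangulation B Φ)
    (L : ℕ) (γ : ℝ) {t : ℕ} (o : Fin t → I × S) (n : ℕ) :
    ∀ z ∈ G.blockHistory A B Φ Ψ L γ o n, z.1 ∈ stdSimplex ℝ A ∧ z.2 ∈ stdSimplex ℝ B := by
  induction n with
  | zero => simp [blockHistory]
  | succ n ih =>
    intro z hz
    simp only [blockHistory, List.mem_append, List.mem_singleton] at hz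
    rcases hz with hz | rfl
    · exact ih z hz
    · exact ⟨(hΨ _ ih).1,
        hBΦ.mem_stdSimplex (nearestPoint_mem G.feasible_nonempty G.isClosed_feasible _)⟩

/-- The deviation of the payoff in round `t` from its conditional expectation given the past and
the action of the second player. -/
noncomputable def payoffDeviation [DecidableEq J] (G : MonitoringGame I J S d)
    (π : (t : ℕ) → (Fin t → I × S) → I → ℝ) (t : ℕ) (h : Fin t → I × J × S) (x : I × J × S) :
    EuclideanSpace ℝ (Fin d) :=
  G.r x.1 x.2.1 - G.payoff (π t (observed h)) (Pi.single x.2.1 1)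

/-- The average payoff differs from the average over the complete blocks of the payoffs of `θ_n`
by the martingale part, the payoffs of the incomplete block, and the effect of the exploration. -/
theorem norm_average_sub_le [DecidableEq J] (hΨ : G.IsRobustBlackwell C A B Ψ)
    (hA : G.IsActionVertexSet B A) (hBΦ : G.IsSignalTriangulation B Φ) {L T : ℕ} (hL : 0 < L)
    (hLT : L ≤ T) {γ : ℝ} (hγ0 : 0 ≤ γ) (hγ1 : γ ≤ 1) (ω : Fin T → I × J × S) :
    ‖(T : ℝ)⁻¹ • ∑ t, G.r (ω t).1 (ω t).2.1 - ((T / L : ℕ) : ℝ)⁻¹ •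
        ∑ n ∈ Finset.range (T / L), G.payoff (∑ a,
          Ψ (G.blockHistory A B Φ Ψ L γ (observed ω) n) a • (a : I → ℝ)) (empirical L ω n)‖
      ≤ (T : ℝ)⁻¹ * ‖∑ t : Fin T, G.payoffDeviation (G.blockStrategy A B Φ Ψ L γ) t
          (fun s => ω (Fin.castLE t.isLt.le s)) (ω t)‖
        + 2 * L / T * G.payoffBound + 2 * γ * G.payoffBound := by
  set N := T / L with hN
  set R := G.payoffBound with hR
  have hN0 : 0 < N := Nat.div_pos hLT hL
  have hNr : (0 : ℝ) < N := by exact_mod_cast hN0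
  have hLr : (0 : ℝ) < L := by exact_mod_cast hL
  have hTr : (0 : ℝ) < T := by exact_mod_cast hL.trans_le hLT
  have hθ : ∀ n, Ψ (G.blockHistory A B Φ Ψ L γ (observed ω) n) ∈ stdSimplex ℝ A := fun n =>
    (hΨ _ (blockHistory_spec hΨ hBΦ L γ (observed ω) n)).1
  set p := G.blockAction A B Φ Ψ L γ (observed ω) with hp
  have hpmem : ∀ n, p n ∈ stdSimplex ℝ I := fun n => explore_mem hA (hθ n) hγ0 hγ1
  set v : Fin T → EuclideanSpace ℝ (Fin d) := fun t =>
    G.payoff (p (t / L)) (Pi.single (ω t).2.1 1) with hv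
  have hvR : ∀ t, ‖v t‖ ≤ R := fun t =>
    G.norm_payoff_le_of_mem (hpmem _) (single_mem_stdSimplex ℝ _)
  have hsplit : ∑ t, G.r (ω t).1 (ω t).2.1 = (∑ t : Fin T, G.payoffDeviation
      (G.blockStrategy A B Φ Ψ L γ) t (fun s => ω (Fin.castLE t.isLt.le s)) (ω t)) + ∑ t, v t := by
    rw [← Finset.sum_add_distrib]
    refine Finset.sum_congr rfl fun t _ => ?_
    rw [payoffDeviation, blockStrategy_castLE hL γ t ω, ← hp, sub_add_cancel]
  set F : Finset (Fin T) := Finset.univ.filter fun s : Fin T => (s : ℕ) / L < N with hF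
  have hFcard : (F.card : ℝ) = N * L := by
    rw [hF, card_filter_div_lt hL]
    push_cast
    rfl
  have hFc : ((Fᶜ).card : ℝ) = T - N * L := by
    rw [Finset.card_compl, Nat.cast_sub (Finset.card_le_univ F), hFcard, Fintype.card_fin]
  have hblocks : ∑ s ∈ F, v s
      = (L : ℝ) • ∑ n ∈ Finset.range N, G.payoff (p n) (empirical L ω n) := by
    rw [hF, ← sum_block, Finset.smul_sum]
    refine Finset.sum_congr rfl fun n _ => ?_
    rw [payoff_empirical, smul_inv_smul₀ hLr.ne']
    refine Finset.sum_congr rfl fun s hs => ?_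
    rw [hv]
    dsimp only
    rw [mem_block.1 hs]
  have hNLT : (N : ℝ) * L ≤ T := by exact_mod_cast Nat.div_mul_le_self T L
  have hTNL : (T : ℝ) < (N + 1) * L := by
    have : T < (N + 1) * L := by
      rw [mul_comm]
      exact Nat.lt_mul_div_succ T hL
    exact_mod_cast this
  -- the rounds outside of the complete blocks
  have hinc : ‖(T : ℝ)⁻¹ • ∑ t, v t - (N : ℝ)⁻¹ •
      ∑ n ∈ Finset.range N, G.payoff (p n) (empirical L ω n)‖ ≤ 2 * L / T * R := by
    have h1 : (N : ℝ)⁻¹ • ∑ n ∈ Finset.range N, G.payoff (p n) (empirical L ω n)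
        = ((N : ℝ) * L)⁻¹ • ∑ s ∈ F, v s := by
      rw [hblocks, smul_smul, mul_inv, mul_assoc, inv_mul_cancel₀ hLr.ne', mul_one]
    have h2 : ‖∑ s ∈ F, v s‖ ≤ N * L * R := by
      refine (norm_sum_le_of_le _ fun s _ => hvR s).trans (le_of_eq ?_)
      rw [Finset.sum_const, nsmul_eq_mul, hFcard]
    have h3 : ‖∑ s ∈ Fᶜ, v s‖ ≤ (T - N * L) * R := by
      refine (norm_sum_le_of_le _ fun s _ => hvR s).trans (le_of_eq ?_)
      rw [Finset.sum_const, nsmul_eq_mul, hFc]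
    have h4 : (T : ℝ)⁻¹ ≤ ((N : ℝ) * L)⁻¹ := inv_anti₀ (by positivity) hNLT
    have h5 : (T : ℝ)⁻¹ • ∑ t, v t - ((N : ℝ) * L)⁻¹ • ∑ s ∈ F, v s
        = (T : ℝ)⁻¹ • ∑ s ∈ Fᶜ, v s - (((N : ℝ) * L)⁻¹ - (T : ℝ)⁻¹) • ∑ s ∈ F, v s := by
      rw [← Finset.sum_add_sum_compl F v]
      module
    rw [h1, h5]
    refine (norm_sub_le _ _).trans ?_
    rw [norm_smul, norm_smul, norm_inv, Real.norm_natCast, Real.norm_of_nonneg (sub_nonneg.2 h4)]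
    calc _ ≤ (T : ℝ)⁻¹ * ((T - N * L) * R) + (((N : ℝ) * L)⁻¹ - (T : ℝ)⁻¹) * (N * L * R) :=
          add_le_add (mul_le_mul_of_nonneg_left h3 (by positivity))
            (mul_le_mul_of_nonneg_left h2 (sub_nonneg.2 h4))
      _ = 2 * (T - N * L) / T * R := by
          field_simp
          ring
      _ ≤ 2 * L / T * R := by
          refine mul_le_mul_of_nonneg_right (div_le_div_of_nonneg_right ?_ hTr.le)
            G.payoffBound_nonneg
          linarith
  have hexp : ‖(N : ℝ)⁻¹ • ∑ n ∈ Finset.range N, G.payoff (p n) (empirical L ω n)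
      - (N : ℝ)⁻¹ • ∑ n ∈ Finset.range N, G.payoff (∑ a,
          Ψ (G.blockHistory A B Φ Ψ L γ (observed ω) n) a • (a : I → ℝ)) (empirical L ω n)‖
      ≤ 2 * γ * R := by
    rw [← smul_sub, ← Finset.sum_sub_distrib, norm_smul, norm_inv, Real.norm_natCast,
      inv_mul_le_iff₀ hNr]
    refine (norm_sum_le_of_le _ fun n hn => norm_payoff_explore_sub_le hA (hθ n) hγ0
      (empirical_mem hL (Finset.mem_range.1 hn) ω)).trans (le_of_eq ?_)
    rw [Finset.sum_const, Finset.card_range, nsmul_eq_mul]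
  rw [hsplit, smul_add, add_sub_assoc, add_assoc]
  refine (norm_add_le _ _).trans (add_le_add ?_ ?_)
  · rw [norm_smul, norm_inv, Real.norm_natCast]
  · exact (norm_sub_le_norm_sub_add_norm_sub _ _ _).trans (add_le_add hinc hexp)

end Play

end MonitoringGame

/-! ### Precision of the estimation of the signals -/

/-- Parameters for the exponential inequality at the level `4 / 3 * l`: the resulting bound on the
deviation of a coordinate is `a + D * s`, where `s` is its share of the total variance `b`. Here
`a = 4 / 3 * (D + E)` and `x = 2 * D + E`, with `E` proportional to `D ^ 2`. If `x ≤ 1`, then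
`E ≤ D / 3`, which gives the last conclusion: the sum of the squares of `n` deviations whose shares
`s` have the sum `1` is at most `n * x ^ 2`, as if the level were `l`. -/
theorem exists_bernstein_parameters {b L l x : ℝ} (hb : 0 < b) (hL : 0 < L) (hl : 0 < l)
    (hx : x = √(2 * (b / L) * l) + 1 / 3 * (b / L) * l) (hx1 : x ≤ 1) :
    ∃ η D a : ℝ, 0 < η ∧ 0 ≤ D ∧ 0 ≤ a ∧ 4 / 3 * l = η * L * a ∧
      (∀ p : ℝ, 0 < p → p⁻¹ ≤ b → ∀ ε : ℝ, |ε| = 1 →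
        p * (Real.exp (ε * η / p) - 1 - ε * η / p) ≤ η * D) ∧
      ∀ n : ℝ, 2 ≤ n → n * a ^ 2 + 2 * a * D + D ^ 2 ≤ n * x ^ 2 := by
  set D : ℝ := √(b * l / (2 * L)) with hD
  have hDpos : 0 < D := Real.sqrt_pos.2 (by positivity)
  have hD2 : D ^ 2 = b * l / (2 * L) := Real.sq_sqrt (by positivity)
  set E : ℝ := b * l / (3 * L) with hE
  have hEpos : 0 < E := by positivity
  have hED : E = 2 / 3 * D ^ 2 := by
    rw [hD2, hE]
    field_simp
  have hxDE : x = 2 * D + E := by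
    rw [hx, show 2 * (b / L) * l = (2 * D) ^ 2 by rw [mul_pow, hD2]; field_simp,
      Real.sqrt_sq (by positivity), hE]
    congr 1
    field_simp
  have hD1 : D ≤ 1 / 2 := by linarith
  have hE3 : E ≤ D / 3 := by
    rw [hED]
    nlinarith
  set η : ℝ := l / ((D + E) * L) with hη
  have hηpos : 0 < η := by positivity
  have hηb : η * b / 3 = E / (D + E) := by
    rw [hη, hE]
    field_simp
  refine ⟨η, D, 4 / 3 * (D + E), hηpos, hDpos.le, by positivity, ?_, ?_, ?_⟩
  · rw [hη]
    field_simp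
  · intro p hp hpb ε hε
    have habs : |ε * η / p| = η / p := by
      rw [abs_div, abs_mul, hε, one_mul, abs_of_pos hηpos, abs_of_pos hp]
    have hle : η / p ≤ η * b := by
      rw [div_eq_mul_inv]
      exact mul_le_mul_of_nonneg_left hpb hηpos.le
    have hlt : η * b / 3 < 1 := by
      rw [hηb, div_lt_one (by positivity)]
      linarith
    have hsq : (ε * η / p) ^ 2 = (η / p) ^ 2 := by rw [← sq_abs, habs]
    have h1 := Real.exp_sub_one_sub_le (x := ε * η / p) (by rw [habs]; linarith)
    rw [habs, hsq] at h1
    have h2 : 1 - η * b / 3 = D / (D + E) := by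
      rw [hηb]
      field_simp
      ring
    have h3 : D / (D + E) ≤ 1 - η / p / 3 := by
      rw [← h2]
      linarith
    calc _ ≤ p * ((η / p) ^ 2 / 2 / (1 - η / p / 3)) := mul_le_mul_of_nonneg_left h1 hp.le
      _ ≤ p * ((η / p) ^ 2 / 2 / (D / (D + E))) := by gcongr
      _ = η * (η / p) * ((D + E) / (2 * D)) := by
        field_simp
      _ ≤ η * (η * b) * ((D + E) / (2 * D)) := by gcongr
      _ = η * D := by
        have : b * l = D ^ 2 * (2 * L) := by
          rw [hD2]
          field_simp
        have h4 : η * b * (D + E) = D ^ 2 * 2 := by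
          rw [hη]
          field_simp
          linarith
        rw [mul_assoc, ← mul_div_assoc, h4]
        field_simp
  · intro n hn
    rw [hxDE]
    have h1 : (4 / 3 * (D + E)) ^ 2 ≤ (2 * D + E) ^ 2 :=
      pow_le_pow_left₀ (by positivity) (by linarith) 2
    have h2 : 2 * (4 / 3 * (D + E)) ^ 2 + 2 * (4 / 3 * (D + E)) * D + D ^ 2
        ≤ 2 * (2 * D + E) ^ 2 := by
      nlinarith [mul_nonneg hDpos.le (sub_nonneg.2 hE3), mul_nonneg hEpos.le (sub_nonneg.2 hE3)]
    nlinarith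

namespace MonitoringGame

variable {I J S : Type*} [Fintype I] [Fintype J] [Fintype S] [Nonempty I] [Nonempty J] {d : ℕ}
  {G : MonitoringGame I J S d} {B : Finset (EuclideanSpace ℝ (I × S))}
  {Φ : EuclideanSpace ℝ (I × S) → EuclideanSpace ℝ B} {A : Finset (I → ℝ)}
  {C : Set (EuclideanSpace ℝ (Fin d))} {Ψ : List ((A → ℝ) × (B → ℝ)) → A → ℝ}

theorem signals_row_mem {q : J → ℝ} (hq : q ∈ stdSimplex ℝ J) (i : I) :
    (fun s => G.signals q (i, s)) ∈ stdSimplex ℝ S := by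
  refine ⟨fun s => Finset.sum_nonneg fun j _ => mul_nonneg (hq.1 j) ((G.H_mem i j).1 s), ?_⟩
  simp only [signals]
  rw [Finset.sum_comm]
  simp [← Finset.mul_sum, (G.H_mem i _).2, hq.2]

theorem norm_sub_le_sqrt_two_mul_card {σ σ' : EuclideanSpace ℝ (I × S)} (hσ : σ ∈ G.feasible)
    (hσ' : σ' ∈ G.feasible) : ‖σ - σ'‖ ≤ √(2 * Fintype.card I) := by
  obtain ⟨q, hq, rfl⟩ := hσ
  obtain ⟨q', hq', rfl⟩ := hσ'
  refine Real.le_sqrt_of_sq_le ?_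
  rw [EuclideanSpace.norm_sq_eq, Fintype.sum_prod_type]
  calc _ ≤ ∑ _i : I, (2 : ℝ) := by
        refine Finset.sum_le_sum fun i _ => ?_
        have := norm_sub_sq_le_two_of_mem_stdSimplex
          (u := WithLp.toLp 2 fun s => G.signals q (i, s))
          (v := WithLp.toLp 2 fun s => G.signals q' (i, s)) (signals_row_mem hq i)
          (signals_row_mem hq' i)
        rw [EuclideanSpace.norm_sq_eq] at this
        exact this
    _ = 2 * Fintype.card I := by simp [mul_comm]

/-- With a single signal nothing has to be estimated. -/
theorem eq_of_mem_feasible_of_card_eq_one (hS : Fintype.card S = 1)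
    {σ σ' : EuclideanSpace ℝ (I × S)} (hσ : σ ∈ G.feasible) (hσ' : σ' ∈ G.feasible) : σ = σ' := by
  obtain ⟨s₀, hs₀⟩ := Fintype.card_eq_one_iff.1 hS
  have key : ∀ σ ∈ G.feasible, ∀ z, σ z = 1 := by
    rintro _ ⟨q, hq, rfl⟩ ⟨i, s⟩
    have := (signals_row_mem (G := G) hq i).2
    rwa [Fintype.sum_eq_single s fun s' hs' => absurd ((hs₀ s').trans (hs₀ s).symm) hs'] at this
  ext z
  rw [key σ hσ, key σ' hσ']

section Play

variable [DecidableEq I] [DecidableEq S]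

theorem blockStrategy_mem (hΨ : G.IsRobustBlackwell C A B Ψ) (hA : G.IsActionVertexSet B A)
    (hBΦ : G.IsSignalTriangulation B Φ) {γ : ℝ} (hγ0 : 0 ≤ γ) (hγ1 : γ ≤ 1) (L t : ℕ)
    (o : Fin t → I × S) : G.blockStrategy A B Φ Ψ L γ t o ∈ stdSimplex ℝ I :=
  explore_mem hA (hΨ _ (blockHistory_spec hΨ hBΦ L γ o _)).1 hγ0 hγ1

theorem inv_blockStrategy_le (hΨ : G.IsRobustBlackwell C A B Ψ) (hA : G.IsActionVertexSet B A)
    (hBΦ : G.IsSignalTriangulation B Φ) {γ : ℝ} (hγ0 : 0 < γ) (hγ1 : γ ≤ 1) (L t : ℕ)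
    (o : Fin t → I × S) (i : I) : 0 < G.blockStrategy A B Φ Ψ L γ t o i ∧
      (G.blockStrategy A B Φ Ψ L γ t o i)⁻¹ ≤ Fintype.card I / γ := by
  have h := le_explore hA (hΨ _ (blockHistory_spec hΨ hBΦ L γ o (t / L))).1 hγ1 i
  have hpos : 0 < γ * (Fintype.card I : ℝ)⁻¹ := by
    have : (0 : ℝ) < Fintype.card I := by exact_mod_cast Fintype.card_pos
    positivity
  refine ⟨hpos.trans_le h, (inv_anti₀ hpos h).trans (le_of_eq ?_)⟩
  rw [mul_inv, inv_inv, mul_comm, div_eq_mul_inv]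

/-- The centered sum in the exponential inequality, in terms of the estimate of block `n`. -/
theorem sum_estimator_eq {L : ℕ} (hL : 0 < L) (γ : ℝ) {T : ℕ} (ω : Fin T → I × J × S) (n : ℕ)
    (z : I × S) (η κ : ℝ) :
    (∑ t : Fin T, if (t : ℕ) / L = n then
        η * ((if (ω t).2.2 = z.2 ∧ (ω t).1 = z.1 then (G.blockStrategy A B Φ Ψ L γ t
          (observed fun r => ω (Fin.castLE t.isLt.le r)) (ω t).1)⁻¹ else 0)
            - G.H z.1 (ω t).2.1 z.2)
          - κ * G.H z.1 (ω t).2.1 z.2 else 0)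
      = L * (η * (estimate L (G.blockAction A B Φ Ψ L γ (observed ω) n) (observed ω) n z
          - G.signals (empirical L ω n) z) - κ * G.signals (empirical L ω n) z) := by
  have hLr : (L : ℝ) ≠ 0 := by exact_mod_cast hL.ne'
  have h1 : (L : ℝ) * estimate L (G.blockAction A B Φ Ψ L γ (observed ω) n) (observed ω) n z
      = ∑ t ∈ block L T n, if (ω t).2.2 = z.2 ∧ (ω t).1 = z.1 then
        (G.blockStrategy A B Φ Ψ L γ t (observed fun r => ω (Fin.castLE t.isLt.le r))
          (ω t).1)⁻¹ else 0 := by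
    simp only [estimate]
    rw [mul_inv_cancel_left₀ hLr, block, Finset.sum_filter]
    refine Finset.sum_congr rfl fun t _ => ?_
    rw [blockStrategy_castLE hL]
    by_cases ht : (t : ℕ) / L = n
    · simp only [ht, true_and, if_true]
      rfl
    · simp [ht]
  have h2 : (L : ℝ) * G.signals (empirical L ω n) z
      = ∑ t ∈ block L T n, G.H z.1 (ω t).2.1 z.2 := by
    rw [signals_empirical, mul_inv_cancel_left₀ hLr]
  rw [← Finset.sum_filter]
  change ∑ t ∈ block L T n, _ = _
  rw [Finset.sum_sub_distrib, ← Finset.mul_sum, ← Finset.mul_sum, Finset.sum_sub_distrib, ← h1,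
    ← h2]
  ring

/-- With probability at least `1 - δ / 2` all the blocks provide precise estimates of the signals.
Only half of `δ` is spent although each coordinate is bounded as in Bernstein's inequality. If
there is a single signal or if the bound exceeds the diameter of the set of feasible signals, then
there is nothing to prove. Otherwise the level is enlarged by the factor `4 / 3`, which pays for
the factor `1 / 2`; this is possible since the conditional variances of the coordinates that belong
to the same action have the sum, and not only the maximum, that enters Bernstein's bound. -/
theorem exists_prob_le_half_estimation (hΨ : G.IsRobustBlackwell C A B Ψ)
    (hA : G.IsActionVertexSet B A) (hBΦ : G.IsSignalTriangulation B Φ) [Nonempty S]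
    {L T : ℕ} (hL : 0 < L) (hLT : 2 * L ≤ T) {γ : ℝ} (hγ0 : 0 < γ) (hγ1 : γ ≤ 1) {δ : ℝ}
    (hδ0 : 0 < δ) (hδ1 : δ < 1) {τ : (t : ℕ) → (Fin t → I × J × S) → J → ℝ}
    (hτ : IsOpponentStrategy τ) {l x : ℝ}
    (hl : l = Real.log (2 * Fintype.card I * Fintype.card S * T / (L * δ)))
    (hx : x = √(2 * (Fintype.card I / γ / L) * l) + 1 / 3 * (Fintype.card I / γ / L) * l) :
    ∃ F : Set (Fin T → I × J × S), G.prob (G.blockStrategy A B Φ Ψ L γ) τ T F ≤ δ / 2 ∧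
      ∀ ω, ω ∉ F → ∀ n < T / L,
        ‖G.signals (empirical L ω n) - nearestPoint G.feasible
          (estimate L (G.blockAction A B Φ Ψ L γ (observed ω) n) (observed ω) n)‖
          ≤ √((Fintype.card I : ℝ) * Fintype.card S) * x := by
  have hLr : (0 : ℝ) < L := by exact_mod_cast hL
  have hTL : (2 : ℝ) * L ≤ T := by exact_mod_cast hLT
  have hTr : (0 : ℝ) < T := by linarith
  have hI : (1 : ℝ) ≤ Fintype.card I := by exact_mod_cast Fintype.card_pos
  have hS : (1 : ℝ) ≤ Fintype.card S := by exact_mod_cast Fintype.card_pos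
  have hne := G.feasible_nonempty
  have hcl := G.isClosed_feasible
  have hratio : 2 ≤ T / (L * δ) := by
    rw [le_div_iff₀ (by positivity)]
    nlinarith
  have harg : 2 * (Fintype.card I : ℝ) * Fintype.card S * T / (L * δ)
      = 2 * Fintype.card I * Fintype.card S * (T / (L * δ)) := by ring
  have hIS : 1 ≤ (Fintype.card I : ℝ) * Fintype.card S := by nlinarith
  have hlpos : 0 < l := by
    rw [hl, harg]
    refine Real.log_pos ?_
    nlinarith
  have hx0 : 0 ≤ x := by
    rw [hx]
    positivity
  have hσmem : ∀ (ω : Fin T → I × J × S), ∀ n < T / L,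
      G.signals (empirical L ω n) ∈ G.feasible := fun ω n hn => ⟨_, empirical_mem hL hn ω, rfl⟩
  rcases eq_or_ne (Fintype.card S) 1 with hS1 | hS1
  · refine ⟨∅, by rw [prob_empty]; linarith, fun ω _ n hn => ?_⟩
    rw [eq_of_mem_feasible_of_card_eq_one hS1 (hσmem ω n hn) (nearestPoint_mem hne hcl _),
      sub_self, norm_zero]
    positivity
  have hS2 : (2 : ℝ) ≤ Fintype.card S := by
    have : 2 ≤ Fintype.card S := by
      have : 0 < Fintype.card S := Fintype.card_pos
      omega
    exact_mod_cast this
  rcases le_or_gt 1 x with hx1 | hx1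
  · refine ⟨∅, by rw [prob_empty]; linarith, fun ω _ n hn => ?_⟩
    refine (norm_sub_le_sqrt_two_mul_card (hσmem ω n hn) (nearestPoint_mem hne hcl _)).trans ?_
    calc √(2 * (Fintype.card I : ℝ)) ≤ √((Fintype.card I : ℝ) * Fintype.card S) :=
          Real.sqrt_le_sqrt (by nlinarith)
      _ ≤ _ := le_mul_of_one_le_right (Real.sqrt_nonneg _) hx1
  obtain ⟨η, D, a, hη, hD, ha, hla, hκ, hquad⟩ := exists_bernstein_parameters
    (b := Fintype.card I / γ) (by positivity) hLr hlpos hx hx1.le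
  set π := G.blockStrategy A B Φ Ψ L γ with hπdef
  have hπ : ∀ t o, π t o ∈ stdSimplex ℝ I := blockStrategy_mem hΨ hA hBΦ hγ0.le hγ1 L
  have hπinv := inv_blockStrategy_le (Φ := Φ) hΨ hA hBΦ hγ0 hγ1 L
  set E : ℕ × (I × S) × Bool → Set (Fin T → I × J × S) := fun m =>
    {ω | 4 / 3 * l ≤ ∑ t : Fin T, if (t : ℕ) / L = m.1 then
        ((if m.2.2 then 1 else -1) * η) * ((if (ω t).2.2 = m.2.1.2 ∧ (ω t).1 = m.2.1.1 then
          (π t (observed fun r => ω (Fin.castLE t.isLt.le r)) (ω t).1)⁻¹ else 0)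
            - G.H m.2.1.1 (ω t).2.1 m.2.1.2)
          - (η * D) * G.H m.2.1.1 (ω t).2.1 m.2.1.2 else 0} with hE
  refine ⟨⋃ m ∈ Finset.range (T / L) ×ˢ (Finset.univ : Finset ((I × S) × Bool)), E m, ?_, ?_⟩
  · refine (prob_biUnion_le hπ hτ _ E (p := Real.exp (-(4 / 3 * l))) fun m _ => ?_).trans ?_
    · refine prob_le_sum_estimator_sub_le hπ hτ m.2.1 (fun t o => (hπinv t o _).1)
        (fun t o => hκ _ (hπinv t o _).1 (hπinv t o _).2 _ ?_) (fun t => t / L = m.1) T _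
      split_ifs <;> simp
    · have h8 : Real.exp (-(l / 3)) ≤ 1 / 2 := by
        have : 3 * Real.log 2 ≤ l := by
          rw [hl, harg, show 3 * Real.log 2 = Real.log (2 ^ 3) by
            rw [Real.log_pow]; norm_num]
          refine Real.log_le_log (by norm_num) ?_
          have h2 : 2 ≤ (Fintype.card I : ℝ) * Fintype.card S := by nlinarith
          nlinarith
        rw [show (1 : ℝ) / 2 = Real.exp (-Real.log 2) by
          rw [Real.exp_neg, Real.exp_log (by norm_num), one_div]]
        exact Real.exp_le_exp.2 (by linarith)
      have hexp : Real.exp (-l) = L * δ / (2 * Fintype.card I * Fintype.card S * T) := by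
        rw [hl, Real.exp_neg, Real.exp_log (by positivity), inv_div]
      have hN : ((T / L : ℕ) : ℝ) * L ≤ T := by exact_mod_cast Nat.div_mul_le_self T L
      have hcard : (((Finset.range (T / L)) ×ˢ
          (Finset.univ : Finset ((I × S) × Bool))).card : ℝ)
          = ((T / L : ℕ) : ℝ) * (Fintype.card I * Fintype.card S * 2) := by
        rw [Finset.card_product, Finset.card_range, Finset.card_univ, Fintype.card_prod,
          Fintype.card_prod, Fintype.card_bool]
        push_cast
        ring
      rw [hcard, show -(4 / 3 * l) = -l + -(l / 3) by ring, Real.exp_add, hexp]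
      calc _ ≤ ((T / L : ℕ) : ℝ) * (Fintype.card I * Fintype.card S * 2) *
            (L * δ / (2 * Fintype.card I * Fintype.card S * T) * (1 / 2)) := by gcongr
        _ = (((T / L : ℕ) : ℝ) * L) / T * (δ / 2) := by
            field_simp
        _ ≤ 1 * (δ / 2) := by
            refine mul_le_mul_of_nonneg_right ?_ (by positivity)
            rwa [div_le_one hTr]
        _ = δ / 2 := one_mul _
  · intro ω hω n hn
    simp only [Set.mem_iUnion, not_exists] at hω
    set σ := G.signals (empirical L ω n) with hσ
    set σ' := estimate L (G.blockAction A B Φ Ψ L γ (observed ω) n) (observed ω) n with hσ'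
    have hrow : ∀ i, (fun s => σ (i, s)) ∈ stdSimplex ℝ S := fun i =>
      signals_row_mem (empirical_mem hL hn ω) i
    have hcoord : ∀ z, |σ' z - σ z| ≤ a + D * σ z := by
      intro z
      have hm : ∀ ε : Bool, (n, z, ε) ∈
          Finset.range (T / L) ×ˢ (Finset.univ : Finset ((I × S) × Bool)) := fun ε => by
        simp [hn]
      have hpm : ∀ ε : Bool, (if ε then 1 else -1) * (σ' z - σ z) ≤ a + D * σ z := by
        intro ε
        have h1 := hω (n, z, ε) (hm ε)
        simp only [hE, Set.mem_ofPred_eq, not_le] at h1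
        rw [hπdef, sum_estimator_eq hL, hla, ← hσ, ← hσ'] at h1
        have h2 : (L * η) * ((if ε then 1 else -1) * (σ' z - σ z)) < (L * η) * (a + D * σ z) := by
          linarith
        exact (lt_of_mul_lt_mul_left h2 (by positivity)).le
      rw [abs_le]
      have h1 := hpm true
      have h2 := hpm false
      simp only [if_true, one_mul] at h1
      simp only [Bool.false_eq_true, if_false, neg_mul, one_mul] at h2
      constructor <;> linarith
    rw [norm_sub_rev]
    refine (norm_nearestPoint_sub_le hne hcl G.convex_feasible σ' (hσmem ω n hn)).trans ?_
    refine le_of_sq_le_sq ?_ (by positivity)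
    rw [EuclideanSpace.norm_sq_eq, Fintype.sum_prod_type, mul_pow, Real.sq_sqrt (by positivity)]
    calc _ ≤ ∑ _i : I, (Fintype.card S * x ^ 2 : ℝ) := by
          refine Finset.sum_le_sum fun i _ => ?_
          calc _ ≤ ∑ s, (a ^ 2 + 2 * a * D * σ (i, s) + D ^ 2 * σ (i, s)) := by
                refine Finset.sum_le_sum fun s _ => ?_
                have h0 := (hrow i).1 s
                have h1 : σ (i, s) ≤ 1 := by
                  have := Finset.single_le_sum (f := fun s => σ (i, s))
                    (fun s _ => (hrow i).1 s) (Finset.mem_univ s)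
                  rw [(hrow i).2] at this
                  exact this
                rw [PiLp.sub_apply, Real.norm_eq_abs]
                refine (pow_le_pow_left₀ (abs_nonneg _) (hcoord (i, s)) 2).trans ?_
                have h2 : σ (i, s) ^ 2 ≤ σ (i, s) := by
                  rw [sq]
                  exact mul_le_of_le_one_left h0 h1
                nlinarith [mul_le_mul_of_nonneg_left h2 (sq_nonneg D)]
            _ = Fintype.card S * a ^ 2 + 2 * a * D + D ^ 2 := by
                rw [Finset.sum_add_distrib, Finset.sum_add_distrib, ← Finset.mul_sum,
                  ← Finset.mul_sum, (hrow i).2]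
                simp
            _ ≤ _ := hquad _ hS2
      _ = _ := by
          rw [Finset.sum_const, Finset.card_univ, nsmul_eq_mul]
          ring

/-! ### The high-probability bound -/

theorem payoff_single_right [DecidableEq J] (p : I → ℝ) (j : J) :
    G.payoff p (Pi.single j 1) = ∑ i, p i • G.r i j := by
  simp [payoff, Pi.single_apply]

theorem sum_stepProb_smul_payoffDeviation [DecidableEq J]
    {π : (t : ℕ) → (Fin t → I × S) → I → ℝ} (hπ : ∀ t o, π t o ∈ stdSimplex ℝ I)
    (τ : (t : ℕ) → (Fin t → I × J × S) → J → ℝ) (t : ℕ) (h : Fin t → I × J × S) :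
    ∑ x, G.stepProb π τ t h x • G.payoffDeviation π t h x = 0 := by
  simp only [Fintype.sum_prod_type]
  rw [Finset.sum_comm]
  refine Finset.sum_eq_zero fun j _ => ?_
  have h1 : ∀ i, ∑ s, G.stepProb π τ t h (i, j, s) • G.payoffDeviation π t h (i, j, s)
      = τ t h j • (π t (observed h) i • G.r i j
        - π t (observed h) i • ∑ i, π t (observed h) i • G.r i j) := by
    intro i
    simp only [stepProb, payoffDeviation, payoff_single_right]
    rw [← Finset.sum_smul, ← Finset.mul_sum, (G.H_mem i j).2, mul_one, ← smul_sub, smul_smul,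
      mul_comm]
  simp only [h1]
  rw [← Finset.smul_sum, Finset.sum_sub_distrib, ← Finset.sum_smul, (hπ t _).2, one_smul, sub_self,
    smul_zero]

theorem norm_payoffDeviation_le [DecidableEq J] {π : (t : ℕ) → (Fin t → I × S) → I → ℝ}
    (hπ : ∀ t o, π t o ∈ stdSimplex ℝ I) (t : ℕ) (h : Fin t → I × J × S) (x : I × J × S) :
    ‖G.payoffDeviation π t h x‖ ≤ 2 * G.payoffBound := by
  refine (norm_sub_le _ _).trans ?_
  have h1 := G.norm_r_le x.1 x.2.1
  have h2 := G.norm_payoff_le_of_mem (hπ t (observed h)) (single_mem_stdSimplex ℝ x.2.1)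
  linarith

/-- The other half of `δ` is spent on the martingale part: the Azuma–Hoeffding inequality bounds
the probability by `2 * (L * δ / (2 * T)) ^ 2`. -/
theorem prob_payoffDeviation_le [DecidableEq J] {π : (t : ℕ) → (Fin t → I × S) → I → ℝ}
    (hπ : ∀ t o, π t o ∈ stdSimplex ℝ I) {τ : (t : ℕ) → (Fin t → I × J × S) → J → ℝ}
    (hτ : IsOpponentStrategy τ) {L T : ℕ} (hL : 0 < L) (hLT : L ≤ T) {δ : ℝ} (hδ0 : 0 < δ)
    (hδ1 : δ < 1) :
    G.prob π τ T {ω | 4 * G.payoffBound * √(Real.log (2 * T / (L * δ)) / T)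
      < (T : ℝ)⁻¹ * ‖∑ t : Fin T,
        G.payoffDeviation π t (fun s => ω (Fin.castLE t.isLt.le s)) (ω t)‖}
      ≤ δ / 2 := by
  have hLr : (0 : ℝ) < L := by exact_mod_cast hL
  have hLTr : (L : ℝ) ≤ T := by exact_mod_cast hLT
  have hTr : (0 : ℝ) < T := by linarith
  set R := G.payoffBound with hR
  set l := Real.log (2 * T / (L * δ)) with hl
  have hl0 : 0 ≤ l := by
    refine Real.log_nonneg ?_
    rw [le_div_iff₀ (by positivity)]
    nlinarith
  rcases G.payoffBound_nonneg.eq_or_lt with hR0 | hR0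
  · have hempty : {ω : Fin T → I × J × S | 4 * R * √(l / T) < (T : ℝ)⁻¹ *
        ‖∑ t : Fin T, G.payoffDeviation π t (fun s => ω (Fin.castLE t.isLt.le s)) (ω t)‖} = ∅ := by
      refine Set.eq_empty_of_forall_notMem fun ω hω => ?_
      have hz : ∑ t : Fin T, G.payoffDeviation π t (fun s => ω (Fin.castLE t.isLt.le s)) (ω t)
          = 0 := Finset.sum_eq_zero fun t _ => norm_le_zero_iff.1
            ((norm_payoffDeviation_le hπ _ _ _).trans (by rw [← hR0, mul_zero]))
      simp only [Set.mem_ofPred_eq, hz, hR, ← hR0] at hω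
      simp at hω
    rw [hempty, prob_empty]
    linarith
  have hmain := prob_norm_sum_ge_le (G := G) hπ hτ (G.payoffDeviation π) (c := 2 * R)
    (by positivity) (norm_payoffDeviation_le hπ) (sum_stepProb_smul_payoffDeviation hπ τ)
    (T := T) (by exact_mod_cast hTr) (u := T * (4 * R * √(l / T))) (by positivity)
  refine (prob_mono hπ hτ fun ω hω => ?_).trans (hmain.trans ?_)
  · simp only [Set.mem_ofPred_eq] at hω ⊢
    rw [← div_eq_inv_mul, lt_div_iff₀ hTr, mul_comm] at hω
    exact hω.le
  · have h1 : (T * (4 * R * √(l / T))) ^ 2 / (2 * (2 * R) ^ 2 * T) = l + l := by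
      have hR' : R ≠ 0 := hR0.ne'
      rw [mul_pow, mul_pow, Real.sq_sqrt (by positivity)]
      field_simp
      ring
    have hexp : Real.exp (-l) = L * δ / (2 * T) := by
      rw [hl, Real.exp_neg, Real.exp_log (by positivity), inv_div]
    have h2 : L * δ / (2 * T) ≤ δ / 2 := by
      rw [div_le_div_iff₀ (by positivity) (by norm_num)]
      nlinarith
    rw [h1, neg_add, Real.exp_add, hexp]
    have h3 : 0 ≤ L * δ / (2 * T) := by positivity
    nlinarith

theorem norm_average_le {T : ℕ} (ω : Fin T → I × J × S) :
    ‖(T : ℝ)⁻¹ • ∑ t, G.r (ω t).1 (ω t).2.1‖ ≤ G.payoffBound := by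
  rcases Nat.eq_zero_or_pos T with rfl | hT
  · simpa using G.payoffBound_nonneg
  rw [norm_smul, norm_inv, Real.norm_natCast, inv_mul_le_iff₀ (by exact_mod_cast hT)]
  refine (norm_sum_le_of_le _ fun t _ => G.norm_r_le _ _).trans (le_of_eq ?_)
  simp

/-- Condition (APM) implies that `C` contains a point of norm at most `R`. -/
theorem averageDistance_le_two_mul (hAPM : G.APM C) {T : ℕ} (ω : Fin T → I × J × S) :
    G.averageDistance C ω ≤ 2 * G.payoffBound := by
  obtain ⟨σ, hσ⟩ := G.feasible_nonempty
  obtain ⟨p, hp, hpC⟩ := hAPM σ hσ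
  obtain ⟨v, hv⟩ := G.mbar_nonempty p hσ
  refine (Metric.infDist_le_dist_of_mem (hpC hv)).trans ?_
  rw [dist_eq_norm]
  refine (norm_sub_le _ _).trans ?_
  have h1 := norm_average_le (G := G) ω
  have h2 := G.norm_le_of_mem_mbar hp hv
  linarith

/-- The explicit bound. If `T ≤ 2 * L`, it is larger than `2 * R` and holds surely; otherwise it
holds whenever all the signals are estimated precisely and the martingale part is small. -/
theorem averageDistance_bound (hclosed : IsClosed C) (hconvex : Convex ℝ C) (hAPM : G.APM C)
    (hBΦ : G.IsSignalTriangulation B Φ) (hA : G.IsActionVertexSet B A) [Nonempty S]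
    (hΨ : G.IsRobustBlackwell C A B Ψ) {κ : NNReal} (hκ : LipschitzOnWith κ Φ G.feasible)
    {T L : ℕ} {γ δ : ℝ} (hL : 1 ≤ L) (hLT : L < T) (hγ0 : 0 < γ) (hγ1 : γ ≤ 1) (hδ0 : 0 < δ)
    (hδ1 : δ < 1) {τ : (t : ℕ) → (Fin t → I × J × S) → J → ℝ} (hτ : IsOpponentStrategy τ) :
    1 - δ ≤ G.prob (G.blockStrategy A B Φ Ψ L γ) τ T {ω | G.averageDistance C ω ≤
            2 * L / T * G.payoffBound
            + 4 * G.payoffBound * √(Real.log (2 * T / (L * δ)) / T)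
            + 2 * γ * G.payoffBound
            + 2 * G.payoffBound / √((T : ℝ) / L - 1) * √((A.card : ℝ) * B.card)
            + G.payoffBound * κ * √((Fintype.card I : ℝ) * Fintype.card S * B.card) *
              (√(2 * Fintype.card I / (γ * L) *
                  Real.log (2 * Fintype.card I * Fintype.card S * T / (L * δ)))
                + 1 / 3 * (Fintype.card I / (γ * L)) *
                  Real.log (2 * Fintype.card I * Fintype.card S * T / (L * δ)))} := by
  classical
  have hLr : (0 : ℝ) < L := by exact_mod_cast hL
  have hLTr : (L : ℝ) < T := by exact_mod_cast hLT
  have hTr : (0 : ℝ) < T := by linarith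
  have hR := G.payoffBound_nonneg
  have hπ : ∀ t o, G.blockStrategy A B Φ Ψ L γ t o ∈ stdSimplex ℝ I :=
    blockStrategy_mem hΨ hA hBΦ hγ0.le hγ1 L
  have hI : (1 : ℝ) ≤ Fintype.card I := by exact_mod_cast Fintype.card_pos
  have hS : (1 : ℝ) ≤ Fintype.card S := by exact_mod_cast Fintype.card_pos
  have hIS : 1 ≤ (Fintype.card I : ℝ) * Fintype.card S := by nlinarith
  set l := Real.log (2 * Fintype.card I * Fintype.card S * T / (L * δ)) with hl
  have hl0 : 0 ≤ l := by
    refine Real.log_nonneg ?_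
    rw [le_div_iff₀ (by positivity), mul_assoc 2]
    nlinarith
  have hAB : 1 ≤ √((A.card : ℝ) * B.card) := by
    have h1 := hA.nonempty hBΦ.subset_feasible
    have h2 := hBΦ.nonempty
    have h3 : 1 ≤ A.card := Finset.card_pos.2 (Finset.nonempty_coe_sort.1 h1)
    have h4 : 1 ≤ B.card := Finset.card_pos.2 (Finset.nonempty_coe_sort.1 h2)
    rw [Real.one_le_sqrt]
    exact_mod_cast Nat.mul_le_mul h3 h4
  have hTL1 : 0 < (T : ℝ) / L - 1 := by
    rw [sub_pos, one_lt_div hLr]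
    exact hLTr
  have hsTL : 0 < √((T : ℝ) / L - 1) := Real.sqrt_pos.2 hTL1
  rw [show 2 * (Fintype.card I : ℝ) / (γ * L) * l = 2 * (Fintype.card I / γ / L) * l by
      rw [div_div, mul_div_assoc],
    show 1 / 3 * ((Fintype.card I : ℝ) / (γ * L)) * l = 1 / 3 * (Fintype.card I / γ / L) * l by
      rw [div_div]]
  set x := √(2 * (Fintype.card I / γ / L) * l) + 1 / 3 * (Fintype.card I / γ / L) * l with hx
  have hx0 : 0 ≤ x := by positivity
  rcases le_or_gt T (2 * L) with hT2 | hT2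
  · -- the bound is larger than the diameter of the set of the payoffs
    have hT2r : (T : ℝ) ≤ 2 * L := by exact_mod_cast hT2
    refine one_sub_le_prob_of_compl hπ hτ (F := ∅) (by rw [prob_empty]; exact hδ0.le) fun ω _ => ?_
    refine (averageDistance_le_two_mul hAPM ω).trans ?_
    have h1 : √((T : ℝ) / L - 1) ≤ 1 := by
      rw [Real.sqrt_le_one, sub_le_iff_le_add, div_le_iff₀ hLr]
      linarith
    have h2 : 2 * G.payoffBound ≤ 2 * G.payoffBound / √((T : ℝ) / L - 1) :=
      le_div_self (by positivity) hsTL h1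
    have h3 : 2 * G.payoffBound
        ≤ 2 * G.payoffBound / √((T : ℝ) / L - 1) * √((A.card : ℝ) * B.card) :=
      h2.trans (le_mul_of_one_le_right (by positivity) hAB)
    have h4 : 0 ≤ 2 * L / T * G.payoffBound := by positivity
    have h5 : 0 ≤ 4 * G.payoffBound * √(Real.log (2 * T / (L * δ)) / T) := by positivity
    have h6 : 0 ≤ 2 * γ * G.payoffBound := by positivity
    have h7 : 0 ≤ G.payoffBound * κ * √((Fintype.card I : ℝ) * Fintype.card S * B.card) * x := by
      positivity
    linarith
  obtain ⟨F, hF, hest⟩ := exists_prob_le_half_estimation hΨ hA hBΦ hL hT2.le hγ0 hγ1 hδ0 hδ1 hτ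
    hl hx
  have hmart := prob_payoffDeviation_le (G := G) hπ hτ hL hLT.le hδ0 hδ1
  refine one_sub_le_prob_of_compl hπ hτ ((prob_union_le hπ hτ _ _).trans (add_le_add hF hmart)
    |>.trans (by linarith)) fun ω hω => ?_
  rw [Set.mem_union, not_or] at hω
  obtain ⟨hω1, hω2⟩ := hω
  simp only [Set.mem_ofPred_eq, not_lt] at hω2
  set y : ℕ → B → ℝ := fun n b => Φ (nearestPoint G.feasible
    (estimate L (G.blockAction A B Φ Ψ L γ (observed ω) n) (observed ω) n)) b with hy
  have hnear : ∀ n, nearestPoint G.feasible (estimate L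
      (G.blockAction A B Φ Ψ L γ (observed ω) n) (observed ω) n) ∈ G.feasible := fun n =>
    nearestPoint_mem G.feasible_nonempty G.isClosed_feasible _
  have hN : 0 < T / L := Nat.div_pos hLT.le hL
  have hlift := infDist_average_payoff_le hΨ hclosed hconvex hAPM hA hBΦ
    (fun n => G.blockHistory A B Φ Ψ L γ (observed ω) n) y
    (fun n => hBΦ.mem_stdSimplex (hnear n)) rfl (fun n => rfl) (empirical L ω) hN
    (fun n hn => empirical_mem hL hn ω)
    (e := κ * √((Fintype.card I : ℝ) * Fintype.card S * B.card) * x) (fun n hn => by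
      have h1 := EuclideanSpace.sum_abs_le_sqrt_card_mul_norm
        (Φ (G.signals (empirical L ω n)) - Φ (nearestPoint G.feasible
          (estimate L (G.blockAction A B Φ Ψ L γ (observed ω) n) (observed ω) n)))
      have h2 := hκ.norm_sub_le (show G.signals (empirical L ω n) ∈ G.feasible from
        ⟨_, empirical_mem hL hn ω, rfl⟩) (hnear n)
      refine h1.trans ?_
      rw [Fintype.card_coe, Real.sqrt_mul (by positivity)]
      calc _ ≤ √(B.card : ℝ) * (κ * (√((Fintype.card I : ℝ) * Fintype.card S) * x)) := by
            refine mul_le_mul_of_nonneg_left (h2.trans ?_) (Real.sqrt_nonneg _)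
            exact mul_le_mul_of_nonneg_left (hest ω hω1 n hn) κ.2
        _ = _ := by ring)
  have hpay := norm_average_sub_le hΨ hA hBΦ hL hLT.le hγ0.le hγ1 ω
  have hdist := Metric.infDist_le_infDist_add_dist (s := C)
    (x := (T : ℝ)⁻¹ • ∑ t, G.r (ω t).1 (ω t).2.1)
    (y := ((T / L : ℕ) : ℝ)⁻¹ • ∑ n ∈ Finset.range (T / L), G.payoff (∑ a,
          Ψ (G.blockHistory A B Φ Ψ L γ (observed ω) n) a • (a : I → ℝ)) (empirical L ω n))
  rw [dist_eq_norm] at hdist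
  have hrate : √(2 / ((T / L : ℕ) : ℝ)) ≤ 2 / √((T : ℝ) / L - 1) := by
    have hNr : (T : ℝ) / L - 1 ≤ ((T / L : ℕ) : ℝ) := by
      rw [sub_le_iff_le_add, div_le_iff₀ hLr]
      have : T < (T / L + 1) * L := by
        rw [mul_comm]
        exact Nat.lt_mul_div_succ T hL
      exact_mod_cast this.le
    refine Real.sqrt_le_iff.2 ⟨by positivity, ?_⟩
    rw [div_pow, Real.sq_sqrt hTL1.le]
    exact div_le_div₀ (by positivity) (by norm_num) hTL1 hNr
  have hrate' : G.payoffBound * √((A.card : ℝ) * B.card) * √(2 / ((T / L : ℕ) : ℝ))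
      ≤ 2 * G.payoffBound / √((T : ℝ) / L - 1) * √((A.card : ℝ) * B.card) := by
    refine (mul_le_mul_of_nonneg_left hrate (by positivity)).trans (le_of_eq ?_)
    ring
  have hx' : G.payoffBound * (κ * √((Fintype.card I : ℝ) * Fintype.card S * B.card) * x)
      = G.payoffBound * κ * √((Fintype.card I : ℝ) * Fintype.card S * B.card) * x := by ring
  simp only [Set.mem_ofPred_eq, averageDistance]
  linarith

end Play

end MonitoringGame

namespace MonitoringGame

variable {I J S : Type*} [Fintype I] [Fintype J] [Fintype S] [Nonempty I] [Nonempty J] {d : ℕ}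
  {G : MonitoringGame I J S d} {B : Finset (EuclideanSpace ℝ (I × S))}
  {Φ : EuclideanSpace ℝ (I × S) → EuclideanSpace ℝ B} {A : Finset (I → ℝ)}
  {C : Set (EuclideanSpace ℝ (Fin d))} {Ψ : List ((A → ℝ) × (B → ℝ)) → A → ℝ}

/-! ### The rate of convergence -/

/-- The explicit bound for blocks of length `⌈X ^ 3⌉` and the exploration parameter `X⁻¹` in
`X ^ 5` rounds. -/
theorem explicit_bound_le_rate {X L δ R P Q nI nS : ℝ} (hX : 2 ≤ X) (hL1 : X ^ 3 ≤ L)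
    (hL2 : L ≤ 2 * X ^ 3) (hδ0 : 0 < δ) (hδ1 : δ < 1) (hR : 0 ≤ R) (hP : 0 ≤ P) (hQ : 0 ≤ Q)
    (hI : 1 ≤ nI) (hS : 1 ≤ nS) {K : ℝ} (hK : K = 1 + 2 * Real.log (2 * nI * nS)) :
    2 * L / X ^ 5 * R + 4 * R * √(Real.log (2 * X ^ 5 / (L * δ)) / X ^ 5) + 2 * X⁻¹ * R
      + 2 * R / √(X ^ 5 / L - 1) * P
      + Q * (√(2 * nI / (X⁻¹ * L) * Real.log (2 * nI * nS * X ^ 5 / (L * δ)))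
        + 1 / 3 * (nI / (X⁻¹ * L)) * Real.log (2 * nI * nS * X ^ 5 / (L * δ)))
      ≤ (16 * R + 8 * R * P + Q * (√(2 * nI * K) + nI * K)) *
        (X⁻¹ * √(Real.log (X ^ 5 / δ)) + (X ^ 2)⁻¹ * Real.log (X ^ 5 / δ)) := by
  have hX0 : 0 < X := by linarith
  have hX3 : 8 ≤ X ^ 3 := by
    have := pow_le_pow_left₀ (by norm_num) hX 3
    norm_num at this
    exact this
  have hX2 : 4 ≤ X ^ 2 := by nlinarith
  have hX5 : 32 ≤ X ^ 5 := by
    have := pow_le_pow_left₀ (by norm_num) hX 5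
    norm_num at this
    exact this
  have hL0 : 0 < L := by linarith
  set Λ := Real.log (X ^ 5 / δ) with hΛ
  have hXδ : X ^ 5 ≤ X ^ 5 / δ := le_div_self (by positivity) hδ0 hδ1.le
  have hΛ1 : 1 / 2 ≤ Λ := by
    have h1 : Real.log 2 ≤ Λ := Real.log_le_log (by norm_num) (by linarith)
    linarith [Real.log_two_gt_d9]
  have hs : 1 / 2 ≤ √Λ := Real.le_sqrt_of_sq_le (by linarith)
  have hK1 : 1 ≤ K := by
    have : 0 ≤ Real.log (2 * nI * nS) := Real.log_nonneg (by nlinarith)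
    linarith
  set l := Real.log (2 * nI * nS * X ^ 5 / (L * δ)) with hl
  have hIS : 1 ≤ 2 * nI * nS := by nlinarith
  have hlK : l ≤ K * Λ := by
    have h1 : 2 * nI * nS * X ^ 5 / (L * δ) ≤ 2 * nI * nS * (X ^ 5 / δ) := by
      rw [mul_div_assoc]
      refine mul_le_mul_of_nonneg_left (div_le_div_of_nonneg_left (by positivity) hδ0 ?_)
        (by positivity)
      nlinarith
    have h2 : l ≤ Real.log (2 * nI * nS) + Λ := by
      rw [hl, hΛ, ← Real.log_mul (by positivity) (by positivity)]
      exact Real.log_le_log (by positivity) h1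
    have h3 : 0 ≤ Real.log (2 * nI * nS) := Real.log_nonneg hIS
    rw [hK]
    nlinarith
  have hXL : X ^ 2 ≤ X⁻¹ * L := by
    rw [← div_eq_inv_mul, le_div_iff₀ hX0]
    linarith
  have hsq : √((X ^ 2)⁻¹ * Λ) = X⁻¹ * √Λ := by
    rw [Real.sqrt_mul (by positivity), Real.sqrt_inv, Real.sqrt_sq hX0.le]
  set a := X⁻¹ * √Λ with ha
  set b := (X ^ 2)⁻¹ * Λ with hb
  have ha0 : 0 ≤ a := by positivity
  have hb0 : 0 ≤ b := by positivity
  have hXa : X⁻¹ ≤ 2 * a := by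
    have := mul_le_mul_of_nonneg_left hs (inv_nonneg.2 hX0.le)
    rw [ha]
    linarith
  have t1 : 2 * L / X ^ 5 * R ≤ 8 * R * b := by
    have h1 : 2 * L / X ^ 5 ≤ 4 * (X ^ 2)⁻¹ := by
      rw [div_le_iff₀ (by positivity), show 4 * (X ^ 2)⁻¹ * X ^ 5 = 4 * X ^ 3 by field_simp]
      linarith
    have h2 : (X ^ 2)⁻¹ ≤ 2 * b := by
      have := mul_le_mul_of_nonneg_left hΛ1 (inv_nonneg.2 (sq_nonneg X))
      rw [hb]
      linarith
    calc _ ≤ (8 * b) * R := mul_le_mul_of_nonneg_right (by linarith) hR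
      _ = _ := by ring
  have t2 : 4 * R * √(Real.log (2 * X ^ 5 / (L * δ)) / X ^ 5) ≤ 4 * R * a := by
    refine mul_le_mul_of_nonneg_left ?_ (by positivity)
    rw [← hsq]
    refine Real.sqrt_le_sqrt ?_
    rw [div_eq_inv_mul]
    have h1 : Real.log (2 * X ^ 5 / (L * δ)) ≤ Λ := by
      refine Real.log_le_log (by positivity) ?_
      rw [mul_comm L, ← div_div, div_le_iff₀ hL0, div_mul_eq_mul_div, mul_comm]
      exact div_le_div_of_nonneg_right
        (mul_le_mul_of_nonneg_left (by linarith) (by positivity)) hδ0.le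
    have h2 : (X ^ 5)⁻¹ ≤ (X ^ 2)⁻¹ :=
      inv_anti₀ (by positivity) (pow_le_pow_right₀ (by linarith) (by norm_num))
    exact (mul_le_mul_of_nonneg_left h1 (by positivity)).trans
      (mul_le_mul_of_nonneg_right h2 (by linarith))
  have t3 : 2 * X⁻¹ * R ≤ 4 * R * a := by
    have := mul_le_mul_of_nonneg_right hXa hR
    linarith
  have t4 : 2 * R / √(X ^ 5 / L - 1) * P ≤ 8 * R * P * a := by
    have h1 : X / 2 ≤ √(X ^ 5 / L - 1) := by
      refine Real.le_sqrt_of_sq_le ?_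
      have : X ^ 2 / 2 ≤ X ^ 5 / L := by
        rw [le_div_iff₀ hL0]
        calc X ^ 2 / 2 * L ≤ X ^ 2 / 2 * (2 * X ^ 3) :=
              mul_le_mul_of_nonneg_left hL2 (by positivity)
          _ = X ^ 5 := by ring
      rw [div_pow]
      linarith
    calc _ ≤ 2 * R / (X / 2) * P := mul_le_mul_of_nonneg_right
          (div_le_div_of_nonneg_left (by positivity) (by positivity) h1) hP
      _ = 4 * R * P * X⁻¹ := by
          field_simp
          ring
      _ ≤ 4 * R * P * (2 * a) := mul_le_mul_of_nonneg_left hXa (by positivity)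
      _ = _ := by ring
  have t5 : √(2 * nI / (X⁻¹ * L) * l) ≤ √(2 * nI * K) * a := by
    rw [← hsq, ← Real.sqrt_mul (by positivity)]
    refine Real.sqrt_le_sqrt ?_
    calc _ ≤ 2 * nI / (X⁻¹ * L) * (K * Λ) := mul_le_mul_of_nonneg_left hlK (by positivity)
      _ ≤ 2 * nI / X ^ 2 * (K * Λ) := mul_le_mul_of_nonneg_right
          (div_le_div_of_nonneg_left (by positivity) (by positivity) hXL) (by positivity)
      _ = _ := by
          rw [hb, div_eq_mul_inv]
          ring
  have t6 : 1 / 3 * (nI / (X⁻¹ * L)) * l ≤ nI * K * b := by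
    calc _ ≤ 1 / 3 * (nI / (X⁻¹ * L)) * (K * Λ) := mul_le_mul_of_nonneg_left hlK (by positivity)
      _ ≤ 1 * (nI / X ^ 2) * (K * Λ) := by
          gcongr
          norm_num
      _ = _ := by
          rw [hb, div_eq_mul_inv]
          ring
  have t56 := mul_le_mul_of_nonneg_left (add_le_add t5 t6) hQ
  have e : (16 * R + 8 * R * P + Q * (√(2 * nI * K) + nI * K)) * (a + b)
      = (8 * R * b + 4 * R * a + 4 * R * a + 8 * R * P * a
        + Q * (√(2 * nI * K) * a + nI * K * b)) + (8 * R * a + 8 * R * b + 8 * R * P * b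
        + Q * (√(2 * nI * K) * b + nI * K * a)) := by ring
  have hrest : 0 ≤ 8 * R * a + 8 * R * b + 8 * R * P * b
      + Q * (√(2 * nI * K) * b + nI * K * a) := by positivity
  rw [e]
  linarith

variable [DecidableEq I] [DecidableEq S]

theorem exists_rate (hclosed : IsClosed C) (hconvex : Convex ℝ C) (hAPM : G.APM C)
    (hBΦ : G.IsSignalTriangulation B Φ) (hA : G.IsActionVertexSet B A) [Nonempty S] :
    ∃ c : ℝ, ∀ Ψ, G.IsRobustBlackwell C A B Ψ →
        ∀ (T : ℕ) (δ : ℝ), 2 ≤ T → 0 < δ → δ < 1 →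
        ∀ τ : (t : ℕ) → (Fin t → I × J × S) → J → ℝ, MonitoringGame.IsOpponentStrategy τ →
          1 - δ ≤ G.prob
            (G.blockStrategy A B Φ Ψ ⌈(T : ℝ) ^ (3 / 5 : ℝ)⌉₊ ((T : ℝ) ^ (-(1 / 5) : ℝ))) τ T
            {ω | G.averageDistance C ω ≤
              c * ((T : ℝ) ^ (-(1 / 5) : ℝ) * √(Real.log (T / δ))
                + (T : ℝ) ^ (-(2 / 5) : ℝ) * Real.log (T / δ))} := by
  obtain ⟨κ, hκ⟩ := hBΦ.lipschitz
  have hR := G.payoffBound_nonneg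
  have hI : (1 : ℝ) ≤ Fintype.card I := by exact_mod_cast Fintype.card_pos
  have hS : (1 : ℝ) ≤ Fintype.card S := by exact_mod_cast Fintype.card_pos
  set K : ℝ := 1 + 2 * Real.log (2 * Fintype.card I * Fintype.card S) with hK
  have hK0 : 0 ≤ K := by
    have : 0 ≤ Real.log (2 * Fintype.card I * Fintype.card S : ℝ) := Real.log_nonneg (by nlinarith)
    linarith
  set P : ℝ := √((A.card : ℝ) * B.card) with hP
  set Q : ℝ := G.payoffBound * κ * √((Fintype.card I : ℝ) * Fintype.card S * B.card) with hQ
  have hQ0 : 0 ≤ Q := by positivity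
  set c : ℝ := 16 * G.payoffBound + 8 * G.payoffBound * P
    + Q * (√(2 * Fintype.card I * K) + Fintype.card I * K) with hc
  have hc8 : 8 * G.payoffBound ≤ c := by
    have : 0 ≤ 8 * G.payoffBound + 8 * G.payoffBound * P
      + Q * (√(2 * Fintype.card I * K) + Fintype.card I * K) := by positivity
    linarith
  refine ⟨c, fun Ψ hΨ T δ hT hδ0 hδ1 τ hτ => ?_⟩
  have hTr : (2 : ℝ) ≤ T := by exact_mod_cast hT
  have hT0 : (0 : ℝ) ≤ T := by linarith
  set X : ℝ := (T : ℝ) ^ (1 / 5 : ℝ) with hX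
  have hX1 : 1 ≤ X := Real.one_le_rpow (by linarith) (by norm_num)
  have hX0 : 0 < X := by linarith
  have e1 : (T : ℝ) ^ (-(1 / 5) : ℝ) = X⁻¹ := Real.rpow_neg hT0 _
  have e2 : (T : ℝ) ^ (-(2 / 5) : ℝ) = (X ^ 2)⁻¹ := by
    rw [Real.rpow_neg hT0, hX, ← Real.rpow_natCast, ← Real.rpow_mul hT0]
    norm_num
  have e3 : (T : ℝ) ^ (3 / 5 : ℝ) = X ^ 3 := by
    rw [hX, ← Real.rpow_natCast, ← Real.rpow_mul hT0]
    norm_num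
  have e5 : (T : ℝ) = X ^ 5 := by
    rw [hX, ← Real.rpow_natCast, ← Real.rpow_mul hT0]
    norm_num
  rw [e1, e2, e3]
  have hγ0 : 0 < X⁻¹ := inv_pos.2 hX0
  have hγ1 : X⁻¹ ≤ 1 := inv_le_one_of_one_le₀ hX1
  have hπ : ∀ t o, G.blockStrategy A B Φ Ψ ⌈X ^ 3⌉₊ X⁻¹ t o ∈ stdSimplex ℝ I :=
    blockStrategy_mem hΨ hA hBΦ hγ0.le hγ1 _
  rcases le_or_gt 2 X with hX2 | hX2
  · set L := ⌈X ^ 3⌉₊ with hL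
    have hX3 : 8 ≤ X ^ 3 := by
      have := pow_le_pow_left₀ (by norm_num) hX2 3
      norm_num at this
      exact this
    have hL1 : X ^ 3 ≤ (L : ℝ) := Nat.le_ceil _
    have hL2 : (L : ℝ) ≤ 2 * X ^ 3 := by
      have := Nat.ceil_lt_add_one (show 0 ≤ X ^ 3 by positivity)
      linarith
    have hL0 : 1 ≤ L := by
      have : (1 : ℝ) ≤ L := by linarith
      exact_mod_cast this
    have hLT : L < T := by
      have : (L : ℝ) < T := by
        rw [e5, show X ^ 5 = X ^ 2 * X ^ 3 by ring]
        have hX4 : 4 ≤ X ^ 2 := by nlinarith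
        have := mul_le_mul_of_nonneg_right hX4 (show 0 ≤ X ^ 3 by positivity)
        linarith
      exact_mod_cast this
    refine (averageDistance_bound hclosed hconvex hAPM hBΦ hA hΨ hκ hL0 hLT hγ0 hγ1 hδ0 hδ1
      hτ).trans (prob_mono hπ hτ fun ω hω => ?_)
    simp only [Set.mem_ofPred_eq] at hω ⊢
    rw [e5] at hω ⊢
    exact hω.trans (explicit_bound_le_rate hX2 hL1 hL2 hδ0 hδ1 hR (Real.sqrt_nonneg _) hQ0 hI hS hK)
  · -- there are fewer than `32` rounds, and the bound is larger than `2 * R`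
    refine one_sub_le_prob_of_compl hπ hτ (F := ∅) (by rw [prob_empty]; exact hδ0.le) fun ω _ => ?_
    refine (averageDistance_le_two_mul hAPM ω).trans ?_
    have hΛ : 1 / 2 ≤ Real.log (T / δ) := by
      have h1 : (T : ℝ) ≤ T / δ := le_div_self hT0 hδ0 hδ1.le
      have h2 : Real.log 2 ≤ Real.log (T / δ) := Real.log_le_log (by norm_num) (by linarith)
      linarith [Real.log_two_gt_d9]
    have hs : 1 / 2 ≤ √(Real.log (T / δ)) := Real.le_sqrt_of_sq_le (by linarith)
    have hXi : 1 / 2 ≤ X⁻¹ := by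
      rw [one_div]
      exact inv_anti₀ hX0 hX2.le
    have h1 : 1 / 4 ≤ X⁻¹ * √(Real.log (T / δ)) := by nlinarith
    have h2 : 0 ≤ (X ^ 2)⁻¹ * Real.log (T / δ) := mul_nonneg (by positivity) (by linarith)
    nlinarith

end MonitoringGame

theorem mainTheorem1 {I J S : Type*} [Fintype I] [Fintype J] [Fintype S] [Nonempty I] [Nonempty J]
    [Nonempty S] [DecidableEq I] [DecidableEq S] {d : ℕ} (G : MonitoringGame I J S d)
    (C : Set (EuclideanSpace ℝ (Fin d))) (hclosed : IsClosed C) (hconvex : Convex ℝ C)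
    (hAPM : G.APM C)
    (B : Finset (EuclideanSpace ℝ (I × S))) (Φ : EuclideanSpace ℝ (I × S) → EuclideanSpace ℝ B)
    (hBΦ : G.IsSignalTriangulation B Φ) (hlin : G.IsBiPiecewiseLinear B) :
    -- the ingredients of the strategy exist
    (∃ κ : NNReal, LipschitzOnWith κ Φ G.feasible) ∧
    (∃ A : Finset (I → ℝ), G.IsActionVertexSet B A) ∧
    ∀ A : Finset (I → ℝ), G.IsActionVertexSet B A →
      (∃ Ψ, G.IsRobustBlackwell C A B Ψ) ∧
      -- the explicit bound
      (∀ Ψ, G.IsRobustBlackwell C A B Ψ →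
        ∀ κ : NNReal, LipschitzOnWith κ Φ G.feasible →
        ∀ (T L : ℕ) (γ δ : ℝ), 1 ≤ L → L < T → 0 < γ → γ ≤ 1 → 0 < δ → δ < 1 →
        ∀ τ : (t : ℕ) → (Fin t → I × J × S) → J → ℝ, MonitoringGame.IsOpponentStrategy τ →
          1 - δ ≤ G.prob (G.blockStrategy A B Φ Ψ L γ) τ T {ω | G.averageDistance C ω ≤
            2 * L / T * G.payoffBound
            + 4 * G.payoffBound * √(Real.log (2 * T / (L * δ)) / T)
            + 2 * γ * G.payoffBound
            + 2 * G.payoffBound / √((T : ℝ) / L - 1) * √((A.card : ℝ) * B.card)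
            + G.payoffBound * κ * √((Fintype.card I : ℝ) * Fintype.card S * B.card) *
              (√(2 * Fintype.card I / (γ * L) *
                  Real.log (2 * Fintype.card I * Fintype.card S * T / (L * δ)))
                + 1 / 3 * (Fintype.card I / (γ * L)) *
                  Real.log (2 * Fintype.card I * Fintype.card S * T / (L * δ)))}) ∧
      -- the rate
      (∃ c : ℝ, ∀ Ψ, G.IsRobustBlackwell C A B Ψ →
        ∀ (T : ℕ) (δ : ℝ), 2 ≤ T → 0 < δ → δ < 1 →
        ∀ τ : (t : ℕ) → (Fin t → I × J × S) → J → ℝ, MonitoringGame.IsOpponentStrategy τ →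
          1 - δ ≤ G.prob
            (G.blockStrategy A B Φ Ψ ⌈(T : ℝ) ^ (3 / 5 : ℝ)⌉₊ ((T : ℝ) ^ (-(1 / 5) : ℝ))) τ T
            {ω | G.averageDistance C ω ≤
              c * ((T : ℝ) ^ (-(1 / 5) : ℝ) * √(Real.log (T / δ))
                + (T : ℝ) ^ (-(2 / 5) : ℝ) * Real.log (T / δ))}) := by
  have hB := hBΦ.nonempty
  refine ⟨hBΦ.lipschitz, MonitoringGame.exists_isActionVertexSet hB hlin, fun A hA => ?_⟩
  have hA' := hA.nonempty hBΦ.subset_feasible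
  refine ⟨MonitoringGame.exists_isRobustBlackwell, ?_,
    MonitoringGame.exists_rate hclosed hconvex hAPM hBΦ hA⟩
  intro Ψ hΨ κ hκ T L γ δ hL hLT hγ0 hγ1 hδ0 hδ1 τ hτ
  exact MonitoringGame.averageDistance_bound hclosed hconvex hAPM hBΦ hA hΨ hκ hL hLT hγ0 hγ1 hδ0
    hδ1 hτ
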